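/- **Setting.** A multi-access channel has $K$ users with $N_t$ transmit antennas each, $N_r$ receive antennas, channel matrices $H_k\in\mathbb C^{N_r\times N_t}$, $H_k\neq 0$, and priority weights $w_k>0$. Time is split into $N$ epochs of lengths $L_i>0$, with $t_n=L_1+\dots+L_n$. User $k$ has a battery of capacity $E_{\max,k}$ and energy arrivals $0\le E_{i,k}\le E_{\max,k}$, $0\le i\le N-1$; set $E_{N,k}:=E_{\max,k}$. For $1\le n\le N$ put $E^a_{n,k}:=\sum_{i=0}^{n-1}E_{i,k}$ and $E^c_{n,k}:=\big(\sum_{i=0}^{n}E_{i,k}-E_{\max,k}\big)^+$. Covariances $Q_1,\dots,Q_K\succeq0$ achieve the rate vectors $r\in\mathbb R^K$ with $\sum_{k\in A}r_k\le\log\big|I+\sum_{k\in A}H_kQ_kH_k^\dagger\big|$ for all $A\subseteq\{1,\dots,K\}$; the capacity region $\mathcal C(P)$ is the set of all rate vectors achieved by some $Q\succeq 0$ with $\mathrm{tr}\,Q_k\le P_k$ for all $k$. *Problem (A).* Maximize $\sum_k w_k\sum_i r_{i,k}L_i$ over covariances $Q_{i,k}\succeq0$ and rates $r_i\in\mathcal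 C\big((\mathrm{tr}\,Q_{i,k})_k\big)$ subject to $E^c_{n,k}\le\sum_{i\le n}\mathrm{tr}(Q_{i,k})L_i\le E^a_{n,k}$ for all $n,k$. *Problem (B).* With $R(P):=\max_{r\in\mathcal C(P)}\sum_k w_kr_k$, maximize $W(P):=\sum_{i=1}^N R(P_i)L_i$ over powers $P_{i,k}\ge0$ subject to $E^c_{n,k}\le\sum_{i\le n}P_{i,k}L_i\le E^a_{n,k}$ for all $n,k$. *Problem (C) at $P\in[0,\infty)^K$.* With a permutation $\pi$ such that $w_{\pi(1)}\ge\dots\ge w_{\pi(K)}$ and $w_{\pi(K+1)}:=0$, maximize $\sum_{k=1}^K(w_{\pi(k)}-w_{\pi(k+1)})\log\big|I+\sum_{u\le k}H_{\pi(u)}Q_{\pi(u)}H_{\pi(u)}^\dagger\big|$ over $Q_k\succeq0$ with $\mathrm{tr}\,Q_k=P_k$ for all $k$. **String tautening for user $k$**, the other users' powers being fixed. Let $g_i$ be the partial derivative of $R(P_i)$ in $P_{i,k}\ge0$ (one-sided at $0$), and $g_i^{-1}$ its inverse, extended by $g_i^{-1}(y):=0$ for $y\ge g_i(0)$, including $y=\infty$.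 Start with all $N$ epochs remaining and arrivals $(E_0,\dots,E_N)=(E_{0,k},\dots,E_{N,k})$. As long as $M\ge1$ epochs remain, number them $1,\dots,M$, denote their arrivals by $E_0,\dots,E_M$, put $E^a_n=\sum_{i<n}E_i$ and $E^c_n=(\sum_{i\le n}E_i-E_{\max,k})^+$, set $\omega^-=0$, $\omega^+=\infty$, $\tau^-=\tau^+=0$, and for $n=1,2,\dots,M$ do the following, until a pair $(\tau,\omega)$ and an energy $E$ are returned. Let $\omega_n^+$ and $\omega_n^-$ be the (least) water-levels $\omega\ge 0$ with $\sum_{i\le n}g_i^{-1}(1/\omega)L_i=E^a_n$ and $=E^c_n$, respectively. If $\omega_n^+\le\omega^+$, set $\tau^+=n$, $\omega^+=\omega_n^+$; if $\omega_n^-\ge\omega^-$, set $\tau^-=n$, $\omega^-=\omega_n^-$. If then $\omega^->\omega^+$ and $\tau^-<\tau^+$, return $(\tau,\omega)=(\tau^-,\omega^-)$ and $E=E^c_{\tau}$; otherwise, if $\omega^-\ge\omega^+$ and $\tau^-\ge\tau^+$, or if $\tau^+=M$, return $(\tau,\omega)=(\tau^+,\omega^+)$ and $E=E^a_{\tau}$.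 The powers in epochs $1,\dots,\tau$ are set to $g_i^{-1}(1/\omega)$; the procedure goes on with the remaining $M-\tau$ epochs and the arrivals $\sum_{i\le\tau}E_i-E,\ E_{\tau+1},\dots,E_M$. **Block coordinate ascent.** Start from any feasible point $P^{(0)}$ of (B). In iteration $q\ge1$, replace in turn, for $k=1,\dots,K$, the powers of user $k$ by the result of string tautening, the other users keeping their current powers; this gives $P^{(q)}$. With tolerance $\epsilon>0$, stop at the first $q\ge1$ with $\big(W(P^{(q)})-W(P^{(q-1)})\big)/W(P^{(q-1)})\le\epsilon$ (a quotient with denominator $0$ is read as $0$) and return $P^{(q)}$. **Theorem.** 1. Problem (B) has a globally optimal solution. Let $\mathcal O$ be the set of all of them and $W^*$ the optimal value. 2. For every feasible $P$ of (B) and every user $k$, replacing the powers of user $k$ by the result of string tautening gives a feasible point that maximizes $W$ among all feasible points with the same powers of the other users. 3. For every feasible $P^{(0)}$, the block coordinate ascent converges to the global optimum of (B): all $P^{(q)}$ are feasible, $W(P^{(q)})\to W^*$, the distance from $P^{(q)}$ to $\mathcal O$ tends to $0$, and every accumulation point of $(P^{(q)})_q$ is in $\mathcal O$; in particular $P^{(q)}\to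 P^*$ if $\mathcal O=\{P^*\}$. For every $\epsilon>0$ the method stops, and as $\epsilon\downarrow0$ the throughput of the returned allocation tends to $W^*$ and its distance to $\mathcal O$ tends to $0$. 4. For every $P^*\in\mathcal O$ and every admissible $\pi$, problem (C) has a solution at each $P_i^*$; and whenever $Q^*_i$ solves (C) at $P^*_i$ for $i=1,\dots,N$, there are rates $r^*_i\ge 0$ achieved by $Q^*_i$ such that $(Q^*,r^*)$ is a globally optimal solution of (A), with value $W^*$. -/

import Mathlib

open Set Filter Topology
open scoped ComplexOrder Matrix ENNReal

noncomputable section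

namespace EHMAC

/-- Data of an energy-harvesting MIMO multi-access channel with `K` users, `N` epochs,
`Nt` transmit antennas per user and `Nr` receive antennas. The `N` arrivals `E 0, …, E (N-1)`
happen at the starts of the `N` epochs (`E 0` is the energy initially stored). -/
structure System (K N Nt Nr : ℕ) where
  /-- channel matrix of each user -/
  H : Fin K → Matrix (Fin Nr) (Fin Nt) ℂ
  /-- priority weights -/
  w : Fin K → ℝ
  /-- epoch lengths -/
  L : Fin N → ℝ
  /-- energy arrivals -/
  E : Fin N → Fin K → ℝ
  /-- battery capacities -/
  Emax : Fin K → ℝ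

/-- Transmit covariance matrices, one per user. -/
abbrev Cov (K Nt : ℕ) := Fin K → Matrix (Fin Nt) (Fin Nt) ℂ

/-- Extension of a finite sequence by a constant value. -/
def extend {N : ℕ} {α : Type*} (x : Fin N → α) (d : α) : ℕ → α :=
  fun i => if h : i < N then x ⟨i, h⟩ else d

/-! ### Energy curves (for one user) -/

/-- `E^a_n = ∑_{i=0}^{n-1} a_i`, the energy harvested before `t_n`. -/
def harvested (a : ℕ → ℝ) (n : ℕ) : ℝ := ∑ i ∈ Finset.range n, a i

/-- `E^c_n = (∑_{i=0}^{n} a_i - B)^+`, the energy that must be consumed by `t_n` in order that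
a battery of capacity `B` does not overflow. -/
def mustUse (B : ℝ) (a : ℕ → ℝ) (n : ℕ) : ℝ := max (harvested a (n + 1) - B) 0

/-! ### Water-level based string tautening -/

/-- `g⁻¹(y)`: the inverse of a marginal-rate function `g` that decreases on `[0, ∞)`, extended by
the value `0` for `y ≥ g 0` (so it is the maximizer over `P ≥ 0` of "rate minus `y * P`"). -/
def gInv (g : ℝ → ℝ) (y : ℝ≥0∞) : ℝ := sInf {p : ℝ | 0 ≤ p ∧ ENNReal.ofReal (g p) ≤ y}

/-- Energy spent in the first `n` epochs when the water-level is constantly `ω`, so that the power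
in epoch `i` is `g_i⁻¹(1/ω)`. -/
def levelEnergy (L : ℕ → ℝ) (g : ℕ → ℝ → ℝ) (n : ℕ) (ω : ℝ≥0∞) : ℝ :=
  ∑ i ∈ Finset.range n, gInv (g i) ω⁻¹ * L i

/-- The constant water-level that spends exactly the energy `e` in the first `n` epochs. (It is
the only one if `e > 0`; for `e = 0` this is the least one, `ω = 0`.) -/
def waterLevel (L : ℕ → ℝ) (g : ℕ → ℝ → ℝ) (n : ℕ) (e : ℝ) : ℝ≥0∞ :=
  sInf {ω : ℝ≥0∞ | levelEnergy L g n ω = e}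

/-- The loop of `FirstChangeW`, with `fuel` passes still to go, currently at index `n`, with `M`
epochs in total and current candidates `ωm = ω⁻, τm = τ⁻, ωp = ω⁺, τp = τ⁺`.
It returns `(τ, ω, E)`. -/
def firstChangeLoop (B : ℝ) (M : ℕ) (a L : ℕ → ℝ) (g : ℕ → ℝ → ℝ) :
    (fuel n : ℕ) → (ωm : ℝ≥0∞) → (τm : ℕ) → (ωp : ℝ≥0∞) → (τp : ℕ) → ℕ × ℝ≥0∞ × ℝ
  | 0, _, _, _, ωp, τp => (τp, ωp, harvested a τp)
  | fuel + 1, n, ωm, τm, ωp, τp =>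
    let up := waterLevel L g n (harvested a n)
    let um := waterLevel L g n (mustUse B a n)
    let τp' := if up ≤ ωp then n else τp
    let ωp' := if up ≤ ωp then up else ωp
    let τm' := if ωm ≤ um then n else τm
    let ωm' := if ωm ≤ um then um else ωm
    if ωp' < ωm' ∧ τm' < τp' then (τm', ωm', mustUse B a τm')
    else if (ωp' ≤ ωm' ∧ τp' ≤ τm') ∨ τp' = M then (τp', ωp', harvested a τp')
    else firstChangeLoop B M a L g fuel (n + 1) ωm' τm' ωp' τp'

/-- `FirstChangeW`: first water-level changing index, the water-level used before it, and the
energy spent by then. -/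
def firstChange (B : ℝ) (M : ℕ) (a L : ℕ → ℝ) (g : ℕ → ℝ → ℝ) : ℕ × ℝ≥0∞ × ℝ :=
  firstChangeLoop B M a L g M 1 0 0 ⊤ 0

/-- The arrivals seen from `t_τ` on, when the energy `e` has been spent by then: the first
entry is what the battery then holds. -/
def remaining (a : ℕ → ℝ) (τ : ℕ) (e : ℝ) : ℕ → ℝ
  | 0 => harvested a (τ + 1) - e
  | j + 1 => a (τ + 1 + j)

/-- The `while` loop of `Schedule` for `M` remaining epochs; `fuel` bounds the number of passes
(each pass settles at least one epoch, so `M` passes suffice). -/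
def scheduleLoop (B : ℝ) : (fuel M : ℕ) → (a L : ℕ → ℝ) → (g : ℕ → ℝ → ℝ) → ℕ → ℝ
  | 0, _, _, _, _ => fun _ => 0
  | fuel + 1, M, a, L, g =>
    if M = 0 then fun _ => 0
    else
      let c := firstChange B M a L g
      fun i =>
        if i < c.1 then gInv (g i) c.2.1⁻¹
        else scheduleLoop B fuel (M - c.1) (remaining a c.1 c.2.2)
          (fun j => L (c.1 + j)) (fun j => g (c.1 + j)) (i - c.1)

/-- Procedure `Schedule`: the powers of one user in the `N` epochs. -/
def schedule (B : ℝ) (N : ℕ) (a L : ℕ → ℝ) (g : ℕ → ℝ → ℝ) : ℕ → ℝ := scheduleLoop B N N a L g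

namespace System

variable {K N Nt Nr : ℕ} (S : System K N Nt Nr)

/-! ### Capacity region and the original problem -/

/-- `log |I + ∑_{k ∈ A} H_k Q_k H_k†|`. -/
def logDet (A : Finset (Fin K)) (Q : Cov K Nt) : ℝ :=
  Real.log (1 + ∑ k ∈ A, S.H k * Q k * (S.H k)ᴴ).det.re

/-- The rate vectors achieved with the transmit covariances `Q`. -/
def rateRegion (Q : Cov K Nt) : Set (Fin K → ℝ) :=
  {r | ∀ A : Finset (Fin K), ∑ k ∈ A, r k ≤ S.logDet A Q}

/-- The MAC capacity region for the power budgets `P`. -/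
def capacityRegion (P : Fin K → ℝ) : Set (Fin K → ℝ) :=
  {r | ∃ Q : Cov K Nt, (∀ k, (Q k).PosSemidef ∧ (Q k).trace.re ≤ P k) ∧ r ∈ S.rateRegion Q}

/-- `R(P)`, the largest weighted sum of rates over the capacity region. -/
def R (P : Fin K → ℝ) : ℝ := sSup ((fun r => ∑ k, S.w k * r k) '' S.capacityRegion P)

/-- Arrivals `E_{0,k}, …, E_{N-1,k}, E_{N,k} = Emax_k` of user `k`. -/
def arrivals (k : Fin K) : ℕ → ℝ := extend (fun i => S.E i k) (S.Emax k)

/-- The energy causality and the non-overflow constraints of user `k`, for the powers `p`. -/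
def EnergyFeasible (k : Fin K) (p : Fin N → ℝ) : Prop :=
  ∀ n : ℕ, 1 ≤ n → n ≤ N →
    ∑ i : Fin N with i.val < n, p i * S.L i ≤ harvested (S.arrivals k) n ∧
    mustUse (S.Emax k) (S.arrivals k) n ≤ ∑ i : Fin N with i.val < n, p i * S.L i

/-- Policies (covariances and rates) allowed in the weighted sum-throughput problem. -/
def policies : Set ((Fin N → Cov K Nt) × (Fin N → Fin K → ℝ)) :=
  {x | (∀ i k, (x.1 i k).PosSemidef) ∧
    (∀ k, S.EnergyFeasible k (fun i => (x.1 i k).trace.re)) ∧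
    (∀ i, x.2 i ∈ S.capacityRegion (fun k => (x.1 i k).trace.re))}

/-- Weighted sum-throughput of the rates `r`. -/
def throughput (r : Fin N → Fin K → ℝ) : ℝ := ∑ k, S.w k * ∑ i, r i k * S.L i

/-! ### The power allocation problem -/

/-- Feasible power allocations. -/
def feasible : Set (Fin N → Fin K → ℝ) :=
  {P | (∀ k, S.EnergyFeasible k (fun i => P i k)) ∧ ∀ i k, 0 ≤ P i k}

/-- Sum-throughput of a power allocation. -/
def W (P : Fin N → Fin K → ℝ) : ℝ := ∑ i, S.R (P i) * S.L i

/-- Globally optimal power allocations. -/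
def optimal : Set (Fin N → Fin K → ℝ) := {P | P ∈ S.feasible ∧ IsMaxOn S.W S.feasible P}

/-! ### The covariance problem at given powers -/

/-- `∑_k (w_{π(k)} - w_{π(k+1)}) log |I + ∑_{u ≤ k} H_{π(u)} Q_{π(u)} H_{π(u)}†|`, where
`w_{π(K+1)} = 0`. -/
def covObjective (π : Equiv.Perm (Fin K)) (Q : Cov K Nt) : ℝ :=
  ∑ k : Fin K, (S.w (π k) - extend (fun j => S.w (π j)) 0 (k.val + 1)) *
    S.logDet ((Finset.Iic k).map π.toEmbedding) Q

/-- Covariances with exactly the powers `P`. -/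
def covFeasible (P : Fin K → ℝ) : Set (Cov K Nt) :=
  {Q | ∀ k, (Q k).PosSemidef ∧ (Q k).trace = (P k : ℂ)}

/-- `Q` solves the covariance problem at the powers `P`. -/
def SolvesCov (π : Equiv.Perm (Fin K)) (P : Fin K → ℝ) (Q : Cov K Nt) : Prop :=
  Q ∈ covFeasible P ∧ IsMaxOn (S.covObjective π) (covFeasible P) Q

/-! ### Block coordinate ascent -/

/-- `g(x) = ∂R/∂P_k` at `P_k = x ≥ 0`, the other users having the powers in `P`
(one-sided derivative at `x = 0`). -/
def marginal (k : Fin K) (P : Fin K → ℝ) (x : ℝ) : ℝ :=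
  derivWithin (fun y => S.R (Function.update P k y)) (Ici 0) x

/-- The powers of user `k` are replaced by the output of `Schedule`, those of the other users are
kept. -/
def stepUser (P : Fin N → Fin K → ℝ) (k : Fin K) : Fin N → Fin K → ℝ :=
  fun i => Function.update (P i) k
    (schedule (S.Emax k) N (S.arrivals k) (extend S.L 0)
      (extend (fun j => S.marginal k (P j)) 0) i)

/-- One iteration: the users `1, …, K` are updated in turn. -/
def sweep (P : Fin N → Fin K → ℝ) : Fin N → Fin K → ℝ := (List.finRange K).foldl S.stepUser P

/-- `P^{(q)}`, started from `P0 = P^{(0)}`. -/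
def iter (P0 : Fin N → Fin K → ℝ) (q : ℕ) : Fin N → Fin K → ℝ := S.sweep^[q] P0

/-- The stopping test with tolerance `ε` succeeds in iteration `q ≥ 1`. -/
def Stops (P0 : Fin N → Fin K → ℝ) (ε : ℝ) (q : ℕ) : Prop :=
  1 ≤ q ∧ (S.W (S.iter P0 q) - S.W (S.iter P0 (q - 1))) / S.W (S.iter P0 (q - 1)) ≤ ε

/-- The allocation that is returned with tolerance `ε`. -/
def output (P0 : Fin N → Fin K → ℝ) (ε : ℝ) : Fin N → Fin K → ℝ :=
  S.iter P0 (sInf {q | S.Stops P0 ε q})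

end System

end EHMAC

end

/-!
Write `R` for the largest weighted sum of rates at given powers. Because `log det` is submodular,
the rates achieved by given covariances form a polymatroid, over which the weighted sum is
maximized by a greedy corner; so `R(P)` is the maximum of the concave function `covObjective` over
the covariances with powers `P` (`SolvesCov.isGreatest`). From this description come the facts on
which everything rests. `R` is strictly increasing and strictly concave in the power of each user
(`R_strictMonoOn`, `R_strictConcaveOn`), although `covObjective` need not be strictly concave in
the covariances: it is so along segments at whose ends its values differ, since then the matrices
whose `log det` it adds up differ too. And the partial derivatives of `R` exist, one-sided where a
power vanishes, and form a supergradient even at the boundary of the orthant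
(`marginal_supergradient`); this is what makes an allocation optimal as soon as it is optimal for
each user separately (`mem_optimal_of_stepUser_eq`), which fails for general concave functions.

For one user, a schedule is called taut (`IsTaut`) if moving energy between two epochs cannot pay
to first order; the optimal powers of a user are taut. String tautening computes the only taut
schedule: where `FirstChangeW` returns a level and an index, the curve of energy spent at that
constant level runs between the two constraints up to the index, and the curve of a taut schedule
cannot leave it and return to it on the side where the constraint lies beyond the level curve,
since at the two crossings energy could be moved with profit (`IsTaut.spent_le_of_level`,
`IsTaut.level_le_spent`). Hence both curves agree up to the index, and the rest of a taut schedule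
is taut for the remaining epochs (`IsTaut.tail`). No comparison between the levels of consecutive
segments is needed, which matters because a level is not unique when no energy is to be spent.

In particular the optimal powers of one user are unique given those of the others. So the update
of one user is a continuous map of the compact set of feasible allocations, a round of updates
increases the throughput strictly unless it changes nothing, and its fixed points are globally
optimal; the convergence of the iterates is then the general fact `ascent_converges`.
-/

namespace EHMAC

/-! ### Inequalities for `log det` -/

section LogDet

variable {n : Type*} [Fintype n] [DecidableEq n]

open scoped MatrixOrder in
theorem exists_eq_conjTranspose_mul_self {A : Matrix n n ℂ} (hA : A.PosSemidef) :
    ∃ C : Matrix n n ℂ, A = Cᴴ * C :=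
  CStarAlgebra.nonneg_iff_eq_star_mul_self.mp hA.nonneg

theorem trace_mul_re_nonneg {A B : Matrix n n ℂ} (hA : A.PosSemidef) (hB : B.PosSemidef) :
    0 ≤ (A * B).trace.re := by
  obtain ⟨C, rfl⟩ := exists_eq_conjTranspose_mul_self hA
  rw [Matrix.mul_assoc, Matrix.trace_mul_comm]
  exact (Complex.nonneg_iff.1 (hB.mul_mul_conjTranspose_same C).trace_nonneg).1

theorem det_re_pos {A : Matrix n n ℂ} (hA : A.PosDef) : 0 < A.det.re :=
  (Complex.pos_iff.1 hA.det_pos).1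

theorem ofReal_det_re {A : Matrix n n ℂ} (hA : A.PosDef) : ((A.det.re : ℝ) : ℂ) = A.det :=
  Complex.ext rfl (by simpa using (Complex.pos_iff.1 hA.det_pos).2)

theorem log_det_eq_sum_eigenvalues {A : Matrix n n ℂ} (hA : A.PosDef) :
    Real.log A.det.re = ∑ i, Real.log (hA.1.eigenvalues i) := by
  rw [hA.1.det_eq_prod_eigenvalues]
  simp only [RCLike.ofReal_eq_complex_ofReal]
  rw [← Complex.ofReal_prod, Complex.ofReal_re,
    Real.log_prod fun i _ => (hA.eigenvalues_pos i).ne']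

theorem trace_sub_card_eq_sum_eigenvalues {A : Matrix n n ℂ} (hA : A.PosDef) :
    A.trace.re - Fintype.card n = ∑ i, (hA.1.eigenvalues i - 1) := by
  rw [hA.1.trace_eq_sum_eigenvalues]
  simp only [RCLike.ofReal_eq_complex_ofReal]
  rw [← Complex.ofReal_sum, Complex.ofReal_re]
  simp

/-- `log det A ≤ tr A - n`, which is `log x ≤ x - 1` for the eigenvalues. -/
theorem log_det_le_trace {A : Matrix n n ℂ} (hA : A.PosDef) :
    Real.log A.det.re ≤ A.trace.re - Fintype.card n := by
  rw [log_det_eq_sum_eigenvalues hA, trace_sub_card_eq_sum_eigenvalues hA]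
  exact Finset.sum_le_sum fun i _ => Real.log_le_sub_one_of_pos (hA.eigenvalues_pos i)

theorem log_det_lt_trace {A : Matrix n n ℂ} (hA : A.PosDef) (h : A ≠ 1) :
    Real.log A.det.re < A.trace.re - Fintype.card n := by
  have h3 : ∃ i, hA.1.eigenvalues i ≠ 1 := by
    by_contra! h3
    apply h
    have h4 : (RCLike.ofReal ∘ hA.1.eigenvalues : n → ℂ) = fun _ => 1 := by
      ext i; simp [h3 i]
    have h5 := hA.1.spectral_theorem
    rw [h4, Matrix.diagonal_one, map_one] at h5
    exact h5
  rw [log_det_eq_sum_eigenvalues hA, trace_sub_card_eq_sum_eigenvalues hA]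
  obtain ⟨i, hi⟩ := h3
  exact Finset.sum_lt_sum (fun i _ => Real.log_le_sub_one_of_pos (hA.eigenvalues_pos i))
    ⟨i, Finset.mem_univ _, Real.log_lt_sub_one_of_pos (hA.eigenvalues_pos i) hi⟩

/-- Two positive definite matrices `A`, `Z` are congruent to `B`, `1` for some `B`. -/
theorem exists_congruent_one {A Z : Matrix n n ℂ} (hA : A.PosDef) (hZ : Z.PosDef) :
    ∃ B : Matrix n n ℂ, B.PosDef ∧ (B = 1 → A = Z) ∧ B.trace = (Z⁻¹ * A).trace ∧
      Real.log B.det.re = Real.log A.det.re - Real.log Z.det.re := by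
  obtain ⟨C, hC⟩ := exists_eq_conjTranspose_mul_self hZ.posSemidef
  have hdet : IsUnit C.det := by
    have h1 : Z.det = (Cᴴ).det * C.det := by rw [hC, Matrix.det_mul]
    have := hZ.det_pos.ne'
    rw [h1] at this
    exact (right_ne_zero_of_mul this).isUnit
  have hCu : IsUnit C := (Matrix.isUnit_iff_isUnit_det C).2 hdet
  have hdet' : IsUnit (Cᴴ).det := by rw [Matrix.det_conjTranspose]; exact hdet.star
  have hA2 : A = Cᴴ * ((C⁻¹)ᴴ * A * C⁻¹) * C := by
    rw [Matrix.conjTranspose_nonsing_inv]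
    simp only [Matrix.mul_assoc]
    rw [Matrix.nonsing_inv_mul _ hdet, Matrix.mul_one, ← Matrix.mul_assoc,
      Matrix.mul_nonsing_inv _ hdet', Matrix.one_mul]
  have hB : ((C⁻¹)ᴴ * A * C⁻¹).PosDef := by
    have hu : IsUnit C⁻¹ := (Matrix.isUnit_nonsing_inv_iff).2 hCu
    exact (Matrix.IsUnit.posDef_star_left_conjugate_iff hu).2 hA
  refine ⟨(C⁻¹)ᴴ * A * C⁻¹, hB, fun h => ?_, ?_, ?_⟩
  · rw [hA2, h, Matrix.mul_one, ← hC]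
  · rw [hC, Matrix.mul_inv_rev, Matrix.trace_mul_comm, Matrix.conjTranspose_nonsing_inv,
      Matrix.mul_assoc]
  · have h1 : A.det = Z.det * ((C⁻¹)ᴴ * A * C⁻¹).det := by
      have h0 : Z.det = (Cᴴ).det * C.det := by rw [hC, Matrix.det_mul]
      conv_lhs => rw [hA2, Matrix.det_mul, Matrix.det_mul]
      rw [h0]; ring
    have h2 : A.det.re = Z.det.re * ((C⁻¹)ᴴ * A * C⁻¹).det.re := by
      rw [h1, ← ofReal_det_re hZ, ← ofReal_det_re hB]; simp
    rw [h2, Real.log_mul (det_re_pos hZ).ne' (det_re_pos hB).ne']; ring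

/-- The tangent inequality of the concave function `log det` at `Z`. -/
theorem log_det_le_tangent {A Z : Matrix n n ℂ} (hA : A.PosDef) (hZ : Z.PosDef) :
    Real.log A.det.re ≤ Real.log Z.det.re + (Z⁻¹ * (A - Z)).trace.re := by
  obtain ⟨B, hB, -, ht, hl⟩ := exists_congruent_one hA hZ
  have h := log_det_le_trace hB
  have hu : IsUnit Z.det := hZ.det_pos.ne'.isUnit
  rw [Matrix.mul_sub, Matrix.nonsing_inv_mul _ hu, Matrix.trace_sub, Matrix.trace_one,
    Complex.sub_re, Complex.natCast_re]
  rw [hl, ht] at h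
  linarith

theorem log_det_lt_tangent {A Z : Matrix n n ℂ} (hA : A.PosDef) (hZ : Z.PosDef) (h : A ≠ Z) :
    Real.log A.det.re < Real.log Z.det.re + (Z⁻¹ * (A - Z)).trace.re := by
  obtain ⟨B, hB, h1, ht, hl⟩ := exists_congruent_one hA hZ
  have h := log_det_lt_trace hB fun hb => h (h1 hb)
  have hu : IsUnit Z.det := hZ.det_pos.ne'.isUnit
  rw [Matrix.mul_sub, Matrix.nonsing_inv_mul _ hu, Matrix.trace_sub, Matrix.trace_one,
    Complex.sub_re, Complex.natCast_re]
  rw [hl, ht] at h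
  linarith

theorem log_det_le_add {A X : Matrix n n ℂ} (hA : A.PosDef) (hX : X.PosSemidef) :
    Real.log A.det.re ≤ Real.log (A + X).det.re := by
  have hS := hA.add_posSemidef hX
  have h := log_det_le_tangent hA hS
  have h1 := trace_mul_re_nonneg hS.inv.posSemidef hX
  rw [sub_add_cancel_left, Matrix.mul_neg, Matrix.trace_neg, Complex.neg_re] at h
  linarith

theorem log_det_lt_add {A X : Matrix n n ℂ} (hA : A.PosDef) (hX : X.PosSemidef) (h0 : X ≠ 0) :
    Real.log A.det.re < Real.log (A + X).det.re := by
  have hS := hA.add_posSemidef hX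
  have h := log_det_lt_tangent hA hS (by simpa using h0)
  have h1 := trace_mul_re_nonneg hS.inv.posSemidef hX
  rw [sub_add_cancel_left, Matrix.mul_neg, Matrix.trace_neg, Complex.neg_re] at h
  linarith

theorem inv_sub_inv_add_posSemidef {A Y : Matrix n n ℂ} (hA : A.PosDef) (hY : Y.PosSemidef) :
    (A⁻¹ - (A + Y)⁻¹).PosSemidef := by
  have hS := hA.add_posSemidef hY
  have hu : IsUnit A.det := hA.det_pos.ne'.isUnit
  have hu' : IsUnit (A + Y).det := hS.det_pos.ne'.isUnit
  have h1 : (Y + Y * A⁻¹ * Y).PosSemidef := by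
    refine hY.add ?_
    have := hA.inv.posSemidef.conjTranspose_mul_mul_same Y
    rwa [hY.1.eq] at this
  have h2 := h1.conjTranspose_mul_mul_same (A + Y)⁻¹
  rw [hS.inv.1.eq] at h2
  have h3 : (A + Y) * A⁻¹ * (A + Y) - (A + Y) = Y + Y * A⁻¹ * Y := by
    rw [Matrix.add_mul A Y A⁻¹, Matrix.mul_nonsing_inv _ hu, Matrix.add_mul,
      Matrix.mul_add (Y * A⁻¹), Matrix.mul_assoc Y A⁻¹ A, Matrix.nonsing_inv_mul _ hu]
    simp only [Matrix.one_mul, Matrix.mul_one]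
    abel
  rw [← h3, Matrix.mul_sub, Matrix.sub_mul] at h2
  have h4 : (A + Y)⁻¹ * ((A + Y) * A⁻¹ * (A + Y)) * (A + Y)⁻¹ = A⁻¹ := by
    simp only [Matrix.mul_assoc]
    rw [Matrix.mul_nonsing_inv _ hu', Matrix.mul_one, ← Matrix.mul_assoc,
      Matrix.nonsing_inv_mul _ hu', Matrix.one_mul]
  rwa [h4, Matrix.nonsing_inv_mul _ hu', Matrix.one_mul] at h2

/-- `A ↦ log det (A + X) - log det A` decreases. -/
theorem log_det_submodular {A X Y : Matrix n n ℂ} (hA : A.PosDef) (hX : X.PosSemidef)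
    (hY : Y.PosSemidef) :
    Real.log (A + Y + X).det.re - Real.log (A + Y).det.re ≤
      Real.log (A + X).det.re - Real.log A.det.re := by
  obtain ⟨C, rfl⟩ := exists_eq_conjTranspose_mul_self hX
  have hone : (1 : Matrix n n ℂ).PosDef := Matrix.PosDef.one
  have key : ∀ B : Matrix n n ℂ, B.PosDef →
      (1 + C * B⁻¹ * Cᴴ).PosDef ∧ Real.log (B + Cᴴ * C).det.re - Real.log B.det.re =
        Real.log (1 + C * B⁻¹ * Cᴴ).det.re := by
    intro B hB
    have h1 : (1 + C * B⁻¹ * Cᴴ).PosDef :=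
      hone.add_posSemidef (hB.inv.posSemidef.mul_mul_conjTranspose_same C)
    refine ⟨h1, ?_⟩
    rw [Matrix.det_add_mul _ _ hB.det_pos.ne'.isUnit, ← ofReal_det_re hB, ← ofReal_det_re h1,
      ← Complex.ofReal_mul, Complex.ofReal_re, Complex.ofReal_re,
      Complex.ofReal_re, Real.log_mul (det_re_pos hB).ne' (det_re_pos h1).ne']
    ring
  have hS := hA.add_posSemidef hY
  rw [(key A hA).2, (key _ hS).2]
  have h2 := log_det_le_add (key _ hS).1
    ((inv_sub_inv_add_posSemidef hA hY).mul_mul_conjTranspose_same C)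
  have h3 : 1 + C * (A + Y)⁻¹ * Cᴴ + C * (A⁻¹ - (A + Y)⁻¹) * Cᴴ = 1 + C * A⁻¹ * Cᴴ := by
    rw [Matrix.mul_sub, Matrix.sub_mul]; abel
  rwa [h3] at h2

/-- Comparison of `log det` with the trace at the scale `c`; it bounds the growth of `log det`
by an arbitrarily small multiple of the trace. -/
theorem log_det_le_trace_div {A : Matrix n n ℂ} (hA : A.PosDef) {c : ℝ} (hc : 0 < c) :
    Real.log A.det.re ≤ A.trace.re / c + Fintype.card n * (Real.log c - 1) := by
  have hc' : (0 : ℂ) < ((c⁻¹ : ℝ) : ℂ) := by exact_mod_cast inv_pos.2 hc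
  have hB : (((c⁻¹ : ℝ) : ℂ) • A).PosDef := hA.smul hc'
  have h := log_det_le_trace hB
  rw [Matrix.det_smul, Matrix.trace_smul, smul_eq_mul, Complex.re_ofReal_mul,
    ← Complex.ofReal_pow, Complex.re_ofReal_mul,
    Real.log_mul (pow_pos (inv_pos.2 hc) _).ne' (det_re_pos hA).ne', Real.log_pow,
    Real.log_inv] at h
  rw [div_eq_inv_mul]
  linarith

end LogDet
end EHMAC

namespace EHMAC

section Concavity

theorem posDef_combination {n : Type*} {A B : Matrix n n ℂ} (hA : A.PosDef) (hB : B.PosDef)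
    {a b : ℝ} (ha : 0 ≤ a) (hb : 0 ≤ b) (hab : a + b = 1) : (a • A + b • B).PosDef := by
  rcases ha.eq_or_lt with rfl | ha
  · obtain rfl : b = 1 := by linarith
    simpa using hB
  · exact (hA.smul ha).add_posSemidef (hB.posSemidef.smul hb)

variable {n : Type*} [Fintype n] [DecidableEq n]

theorem trace_mul_combination_sub {A B Z C : Matrix n n ℂ} {a b : ℝ} (hab : a + b = 1)
    (hZ : Z = a • A + b • B) :
    a * (C * (A - Z)).trace.re + b * (C * (B - Z)).trace.re = 0 := by
  have h1 : a • (A - Z) + b • (B - Z) = 0 := by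
    have : a • (A - Z) + b • (B - Z) = (a • A + b • B) - (a + b) • Z := by module
    rw [this, hab, one_smul, hZ, sub_self]
  have h2 := congrArg (fun X => (C * X).trace.re) h1
  simpa [Matrix.mul_add, Matrix.trace_add, Matrix.trace_smul] using h2

theorem log_det_concave {A B : Matrix n n ℂ} (hA : A.PosDef) (hB : B.PosDef)
    {a b : ℝ} (ha : 0 ≤ a) (hb : 0 ≤ b) (hab : a + b = 1) :
    a * Real.log A.det.re + b * Real.log B.det.re ≤ Real.log (a • A + b • B).det.re := by
  have hZ := posDef_combination hA hB ha hb hab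
  have h1 := mul_le_mul_of_nonneg_left (log_det_le_tangent hA hZ) ha
  have h2 := mul_le_mul_of_nonneg_left (log_det_le_tangent hB hZ) hb
  have h3 := trace_mul_combination_sub (A := A) (B := B) (C := (a • A + b • B)⁻¹) hab rfl
  set l := Real.log (a • A + b • B).det.re
  have h4 : a * l + b * l = l := by rw [← add_mul, hab, one_mul]
  linarith

theorem log_det_strictConcave {A B : Matrix n n ℂ} (hA : A.PosDef) (hB : B.PosDef) (h : A ≠ B)
    {a b : ℝ} (ha : 0 < a) (hb : 0 < b) (hab : a + b = 1) :
    a * Real.log A.det.re + b * Real.log B.det.re < Real.log (a • A + b • B).det.re := by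
  have hZ := posDef_combination hA hB ha.le hb.le hab
  have hne : A ≠ a • A + b • B := by
    intro h1
    have h2 : b • (A - B) = 0 := by
      have : b • (A - B) = (a + b) • A - (a • A + b • B) := by module
      rw [this, hab, one_smul, ← h1, sub_self]
    exact h (sub_eq_zero.1 ((smul_eq_zero.1 h2).resolve_left hb.ne'))
  have h1 := mul_lt_mul_of_pos_left (log_det_lt_tangent hA hZ hne) ha
  have h2 := mul_le_mul_of_nonneg_left (log_det_le_tangent hB hZ) hb.le
  have h3 := trace_mul_combination_sub (A := A) (B := B) (C := (a • A + b • B)⁻¹) hab rfl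
  set l := Real.log (a • A + b • B).det.re
  have h4 : a * l + b * l = l := by rw [← add_mul, hab, one_mul]
  linarith

end Concavity

/-! ### Covariances seen by the receiver -/

namespace System

variable {K N Nt Nr : ℕ} (S : System K N Nt Nr)

/-- The cone of all covariances. -/
def psd (K Nt : ℕ) : Set (Cov K Nt) := {Q | ∀ k, (Q k).PosSemidef}

/-- `∑_{k ∈ A} H_k Q_k H_k†`. -/
noncomputable def recv (A : Finset (Fin K)) : Cov K Nt →ₗ[ℝ] Matrix (Fin Nr) (Fin Nr) ℂ where
  toFun Q := ∑ k ∈ A, S.H k * Q k * (S.H k)ᴴ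
  map_add' Q Q' := by simp [Matrix.mul_add, Matrix.add_mul, Finset.sum_add_distrib]
  map_smul' c Q := by simp [Finset.smul_sum]

theorem recv_apply (A : Finset (Fin K)) (Q : Cov K Nt) :
    S.recv A Q = ∑ k ∈ A, S.H k * Q k * (S.H k)ᴴ := rfl

theorem logDet_eq (A : Finset (Fin K)) (Q : Cov K Nt) :
    S.logDet A Q = Real.log (1 + S.recv A Q).det.re := rfl

variable {S}

theorem recv_posSemidef (A : Finset (Fin K)) {Q : Cov K Nt} (hQ : Q ∈ psd K Nt) :
    (S.recv A Q).PosSemidef :=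
  Matrix.posSemidef_sum _ fun k _ => (hQ k).mul_mul_conjTranspose_same _

theorem one_add_recv_posDef (A : Finset (Fin K)) {Q : Cov K Nt} (hQ : Q ∈ psd K Nt) :
    (1 + S.recv A Q).PosDef :=
  Matrix.PosDef.one.add_posSemidef (recv_posSemidef A hQ)

theorem logDet_empty (Q : Cov K Nt) : S.logDet ∅ Q = 0 := by
  simp [logDet]

theorem logDet_mono {A B : Finset (Fin K)} (h : A ⊆ B) {Q : Cov K Nt} (hQ : Q ∈ psd K Nt) :
    S.logDet A Q ≤ S.logDet B Q := by
  rw [logDet_eq, logDet_eq, recv_apply S B, ← Finset.sum_sdiff h, add_comm (∑ _ ∈ _, _),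
    ← add_assoc]
  exact log_det_le_add (one_add_recv_posDef A hQ) (recv_posSemidef (B \ A) hQ)

theorem logDet_submodular {A B : Finset (Fin K)} (h : A ⊆ B) {k : Fin K} (hk : k ∉ B)
    {Q : Cov K Nt} (hQ : Q ∈ psd K Nt) :
    S.logDet (insert k B) Q - S.logDet B Q ≤ S.logDet (insert k A) Q - S.logDet A Q := by
  have h1 := log_det_submodular (one_add_recv_posDef (S := S) A hQ)
    ((hQ k).mul_mul_conjTranspose_same (S.H k)) (recv_posSemidef (S := S) (B \ A) hQ)
  have h2 : 1 + S.recv A Q + S.recv (B \ A) Q = 1 + S.recv B Q := by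
    rw [recv_apply S B, ← Finset.sum_sdiff h, add_assoc, add_comm (S.recv A Q)]; rfl
  have h3 : ∀ C : Finset (Fin K), k ∉ C →
      1 + S.recv C Q + S.H k * Q k * (S.H k)ᴴ = 1 + S.recv (insert k C) Q := fun C hC => by
    rw [recv_apply S (insert k C), Finset.sum_insert hC, add_assoc, add_comm (S.recv C Q)]; rfl
  rw [h2, h3 B hk, h3 A fun hA => hk (h hA)] at h1
  exact h1

/-! ### Weighted rates over the polymatroid -/

/-- The first `n` users in the order `π`. -/
def initial (π : Equiv.Perm (Fin K)) (n : ℕ) : Finset (Fin K) :=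
  Finset.univ.filter fun k => (π.symm k).val < n

theorem mem_initial {π : Equiv.Perm (Fin K)} {n : ℕ} {k : Fin K} :
    k ∈ initial π n ↔ (π.symm k).val < n := by simp [initial]

theorem initial_zero (π : Equiv.Perm (Fin K)) : initial π 0 = ∅ := by
  ext; simp [mem_initial]

theorem initial_full (π : Equiv.Perm (Fin K)) : initial π K = Finset.univ := by
  ext; simp [mem_initial]

theorem initial_succ (π : Equiv.Perm (Fin K)) (j : Fin K) :
    initial π (j + 1) = insert (π j) (initial π j) := by
  ext k
  rw [Finset.mem_insert, mem_initial, mem_initial, Nat.lt_succ_iff_lt_or_eq, or_comm,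
    ← Equiv.symm_apply_eq, Fin.ext_iff]

theorem notMem_initial (π : Equiv.Perm (Fin K)) (j : Fin K) : π j ∉ initial π j := by
  simp [mem_initial]

theorem map_Iic_eq_initial (π : Equiv.Perm (Fin K)) (j : Fin K) :
    (Finset.Iic j).map π.toEmbedding = initial π (j + 1) := by
  ext k
  simp only [Finset.mem_map, Finset.mem_Iic, Equiv.coe_toEmbedding, mem_initial]
  constructor
  · rintro ⟨u, hu, rfl⟩
    simpa [Nat.lt_succ_iff] using hu
  · intro h
    exact ⟨π.symm k, Fin.le_def.2 (Nat.lt_succ_iff.1 h), by simp⟩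

/-- The increments `w_{π(k)} - w_{π(k+1)}` of the weights. -/
noncomputable def increment (S : System K N Nt Nr) (π : Equiv.Perm (Fin K)) (k : Fin K) : ℝ :=
  S.w (π k) - extend (fun j => S.w (π j)) 0 (k.val + 1)

theorem covObjective_eq (π : Equiv.Perm (Fin K)) (Q : Cov K Nt) :
    S.covObjective π Q = ∑ k, S.increment π k * S.logDet (initial π (k + 1)) Q := by
  simp only [covObjective, map_Iic_eq_initial]; rfl

theorem increment_nonneg (hw : ∀ k, 0 < S.w k) {π : Equiv.Perm (Fin K)}
    (hπ : Antitone fun k => S.w (π k)) (k : Fin K) : 0 ≤ S.increment π k := by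
  rw [increment, extend]
  split_ifs with h
  · exact sub_nonneg.2 (hπ (Fin.le_def.2 (Nat.le_succ _)))
  · simpa using (hw _).le

theorem increment_last (hw : ∀ k, 0 < S.w k) {π : Equiv.Perm (Fin K)} {k : Fin K}
    (hk : k.val + 1 = K) : 0 < S.increment π k := by
  rw [increment, extend, dif_neg (by omega), sub_zero]
  exact hw _

theorem sum_range_mul_eq_abel (X Y : ℕ → ℝ) (n : ℕ) :
    ∑ j ∈ Finset.range n, X j * Y j =
      ∑ j ∈ Finset.range n, (X j - X (j + 1)) * ∑ u ∈ Finset.range (j + 1), Y u +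
        X n * ∑ u ∈ Finset.range n, Y u := by
  induction n with
  | zero => simp
  | succ n ih =>
    rw [Finset.sum_range_succ, ih, Finset.sum_range_succ _ n, Finset.sum_range_succ Y n]; ring

theorem sum_initial (π : Equiv.Perm (Fin K)) (r : Fin K → ℝ) {n : ℕ} (hn : n ≤ K) :
    ∑ k ∈ initial π n, r k = ∑ u ∈ Finset.range n, extend (fun j => r (π j)) 0 u := by
  induction n with
  | zero => simp [initial_zero]
  | succ n ih =>
    have h := initial_succ π ⟨n, hn⟩
    simp only at h
    rw [h, Finset.sum_insert (notMem_initial π ⟨n, hn⟩), Finset.sum_range_succ, ih (by omega),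
      extend, dif_pos (show n < K from hn), add_comm]

theorem weighted_sum_eq (π : Equiv.Perm (Fin K)) (r : Fin K → ℝ) :
    ∑ k, S.w k * r k = ∑ j, S.increment π j * ∑ k ∈ initial π (j + 1), r k := by
  have h1 := sum_range_mul_eq_abel (extend (fun j => S.w (π j)) 0) (extend (fun j => r (π j)) 0) K
  have h2 : extend (fun j => S.w (π j)) 0 K = 0 := by simp [extend]
  rw [h2, zero_mul, add_zero, ← Fin.sum_univ_eq_sum_range
    (fun j => extend (fun j => S.w (π j)) 0 j * extend (fun j => r (π j)) 0 j),
    ← Fin.sum_univ_eq_sum_range (fun j => (extend (fun j => S.w (π j)) 0 j -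
      extend (fun j => S.w (π j)) 0 (j + 1)) *
        ∑ u ∈ Finset.range (j + 1), extend (fun j => r (π j)) 0 u)] at h1
  rw [← Equiv.sum_comp π]
  refine Eq.trans (Finset.sum_congr rfl fun j _ => ?_) (h1.trans
    (Finset.sum_congr rfl fun j _ => ?_))
  · simp [extend]
  · rw [sum_initial π r (by omega), increment]
    simp [extend]

theorem weighted_sum_le (hw : ∀ k, 0 < S.w k) {π : Equiv.Perm (Fin K)}
    (hπ : Antitone fun k => S.w (π k)) {Q : Cov K Nt} {r : Fin K → ℝ} (hr : r ∈ S.rateRegion Q) :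
    ∑ k, S.w k * r k ≤ S.covObjective π Q := by
  rw [weighted_sum_eq π, covObjective_eq]
  exact Finset.sum_le_sum fun j _ =>
    mul_le_mul_of_nonneg_left (hr _) (increment_nonneg hw hπ j)

/-- The corner of the polymatroid `rateRegion Q` that is reached greedily in the order `π`. -/
noncomputable def corner (S : System K N Nt Nr) (π : Equiv.Perm (Fin K)) (Q : Cov K Nt)
    (k : Fin K) : ℝ :=
  S.logDet (initial π ((π.symm k).val + 1)) Q - S.logDet (initial π (π.symm k)) Q

theorem corner_nonneg (π : Equiv.Perm (Fin K)) {Q : Cov K Nt} (hQ : Q ∈ psd K Nt) (k : Fin K) :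
    0 ≤ S.corner π Q k :=
  sub_nonneg.2 (logDet_mono (by rw [initial_succ]; exact Finset.subset_insert _ _) hQ)

theorem sum_initial_corner (π : Equiv.Perm (Fin K)) (Q : Cov K Nt) {n : ℕ} (hn : n ≤ K) :
    ∑ k ∈ initial π n, S.corner π Q k = S.logDet (initial π n) Q := by
  induction n with
  | zero => simp [initial_zero, logDet_empty]
  | succ n ih =>
    have h := initial_succ π ⟨n, hn⟩
    simp only at h
    rw [h, Finset.sum_insert (notMem_initial π ⟨n, hn⟩), ih (by omega), corner, ← h]
    simp

theorem corner_mem_rateRegion (π : Equiv.Perm (Fin K)) {Q : Cov K Nt} (hQ : Q ∈ psd K Nt) :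
    S.corner π Q ∈ S.rateRegion Q := by
  intro A
  have key : ∀ n ≤ K, ∑ k ∈ A ∩ initial π n, S.corner π Q k ≤ S.logDet (A ∩ initial π n) Q := by
    intro n
    induction n with
    | zero => intro _; simp [initial_zero, logDet_empty]
    | succ n ih =>
      intro hn
      have h := initial_succ π ⟨n, hn⟩
      have h' := notMem_initial π ⟨n, hn⟩
      simp only at h h'
      by_cases hA : π ⟨n, hn⟩ ∈ A
      · rw [h, Finset.inter_insert_of_mem hA,
          Finset.sum_insert fun hm => h' (Finset.mem_inter.1 hm).2]
        have h1 := logDet_submodular (S := S) (Finset.inter_subset_right (s₁ := A)) h' hQ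
        have h2 : S.corner π Q (π ⟨n, hn⟩) =
            S.logDet (insert (π ⟨n, hn⟩) (initial π n)) Q - S.logDet (initial π n) Q := by
          rw [corner, ← h]; simp
        have h3 := ih (by omega)
        linarith
      · rw [h, Finset.inter_insert_of_notMem hA]
        exact ih (by omega)
  simpa [initial_full] using key K le_rfl

theorem weighted_sum_corner (π : Equiv.Perm (Fin K)) (Q : Cov K Nt) :
    ∑ k, S.w k * S.corner π Q k = S.covObjective π Q := by
  rw [weighted_sum_eq π, covObjective_eq]
  exact Finset.sum_congr rfl fun j _ => by rw [sum_initial_corner π Q (by omega)]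

/-! ### The concave objective of the covariance problem -/

theorem psd_convex {Q Q' : Cov K Nt} (hQ : Q ∈ psd K Nt) (hQ' : Q' ∈ psd K Nt) {a b : ℝ}
    (ha : 0 ≤ a) (hb : 0 ≤ b) : a • Q + b • Q' ∈ psd K Nt := fun k =>
  ((hQ k).smul ha).add ((hQ' k).smul hb)

theorem one_add_recv_combination (A : Finset (Fin K)) (Q Q' : Cov K Nt) {a b : ℝ}
    (hab : a + b = 1) :
    1 + S.recv A (a • Q + b • Q') = a • (1 + S.recv A Q) + b • (1 + S.recv A Q') := by
  have : (1 : Matrix (Fin Nr) (Fin Nr) ℂ) = (a + b) • 1 := by rw [hab, one_smul]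
  rw [map_add, map_smul, map_smul]
  nth_rewrite 1 [this]
  module

/-- `covObjective` is strictly concave along every segment at whose ends its values
differ, since then one of the matrices of which it takes `log det` differs too. -/
theorem covObjective_strictConcave (hw : ∀ k, 0 < S.w k) {π : Equiv.Perm (Fin K)}
    (hπ : Antitone fun k => S.w (π k)) {Q Q' : Cov K Nt} (hQ : Q ∈ psd K Nt)
    (hQ' : Q' ∈ psd K Nt) (hne : S.covObjective π Q ≠ S.covObjective π Q') {a b : ℝ} (ha : 0 < a)
    (hb : 0 < b) (hab : a + b = 1) :
    a * S.covObjective π Q + b * S.covObjective π Q' < S.covObjective π (a • Q + b • Q') := by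
  have hex : ∃ k, S.increment π k ≠ 0 ∧
      S.recv (initial π (k + 1)) Q ≠ S.recv (initial π (k + 1)) Q' := by
    by_contra! h
    apply hne
    rw [covObjective_eq, covObjective_eq]
    refine Finset.sum_congr rfl fun k _ => ?_
    by_cases h0 : S.increment π k = 0
    · rw [h0, zero_mul, zero_mul]
    · rw [logDet_eq, logDet_eq, h k h0]
  obtain ⟨k₀, hk₀, hk₀'⟩ := hex
  simp only [covObjective_eq, Finset.mul_sum, ← Finset.sum_add_distrib]
  refine Finset.sum_lt_sum (fun k _ => ?_) ⟨k₀, Finset.mem_univ _, ?_⟩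
  · have h := log_det_concave (one_add_recv_posDef (S := S) (initial π (k + 1)) hQ)
      (one_add_recv_posDef (S := S) (initial π (k + 1)) hQ') ha.le hb.le hab
    rw [← one_add_recv_combination _ _ _ hab, ← logDet_eq, ← logDet_eq, ← logDet_eq] at h
    have := mul_le_mul_of_nonneg_left h (increment_nonneg hw hπ k)
    linarith
  · have h := log_det_strictConcave (one_add_recv_posDef (S := S) (initial π (k₀ + 1)) hQ)
      (one_add_recv_posDef (S := S) (initial π (k₀ + 1)) hQ') (by simpa using hk₀') ha hb hab
    rw [← one_add_recv_combination _ _ _ hab, ← logDet_eq, ← logDet_eq, ← logDet_eq] at h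
    have := mul_lt_mul_of_pos_left h ((increment_nonneg hw hπ k₀).lt_of_ne' hk₀)
    linarith

theorem covObjective_le_add (hw : ∀ k, 0 < S.w k) {π : Equiv.Perm (Fin K)}
    (hπ : Antitone fun k => S.w (π k)) {Q D : Cov K Nt} (hQ : Q ∈ psd K Nt)
    (hD : D ∈ psd K Nt) : S.covObjective π Q ≤ S.covObjective π (Q + D) := by
  rw [covObjective_eq, covObjective_eq]
  refine Finset.sum_le_sum fun k _ => mul_le_mul_of_nonneg_left ?_ (increment_nonneg hw hπ k)
  rw [logDet_eq, logDet_eq, map_add, ← add_assoc]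
  exact log_det_le_add (one_add_recv_posDef _ hQ) (recv_posSemidef _ hD)

theorem covObjective_lt_add (hw : ∀ k, 0 < S.w k) {π : Equiv.Perm (Fin K)}
    (hπ : Antitone fun k => S.w (π k)) {Q D : Cov K Nt} (hQ : Q ∈ psd K Nt)
    (hD : D ∈ psd K Nt) {k : Fin K} (hk : S.H k * D k * (S.H k)ᴴ ≠ 0) :
    S.covObjective π Q < S.covObjective π (Q + D) := by
  rw [covObjective_eq, covObjective_eq]
  have hle : ∀ j : Fin K, S.logDet (initial π (j + 1)) Q ≤ S.logDet (initial π (j + 1)) (Q + D) :=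
    fun j => by
      rw [logDet_eq, logDet_eq, map_add, ← add_assoc]
      exact log_det_le_add (one_add_recv_posDef _ hQ) (recv_posSemidef _ hD)
  have hK : 0 < K := k.pos
  refine Finset.sum_lt_sum
    (fun j _ => mul_le_mul_of_nonneg_left (hle j) (increment_nonneg hw hπ j))
    ⟨⟨K - 1, by omega⟩, Finset.mem_univ _, ?_⟩
  have hlast : K - 1 + 1 = K := by omega
  refine mul_lt_mul_of_pos_left ?_ (increment_last hw hlast)
  simp only [hlast, initial_full]
  rw [logDet_eq, logDet_eq, map_add, ← add_assoc]
  refine log_det_lt_add (one_add_recv_posDef _ hQ) (recv_posSemidef _ hD) fun h0 => hk ?_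
  have hpos := fun j => (hD j).mul_mul_conjTranspose_same (S.H j)
  rw [← (hpos k).trace_eq_zero_iff]
  have h1 := congrArg Matrix.trace h0
  rw [recv_apply, Matrix.trace_sum, Matrix.trace_zero] at h1
  exact (Finset.sum_eq_zero_iff_of_nonneg fun j _ => (hpos j).trace_nonneg).1 h1 k
    (Finset.mem_univ _)

/-- The derivative of `covObjective` at `Q`. -/
noncomputable def slope (S : System K N Nt Nr) (π : Equiv.Perm (Fin K)) (Q : Cov K Nt) :
    Cov K Nt →ₗ[ℝ] ℝ where
  toFun D := ∑ k : Fin K, S.increment π k *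
    ((1 + S.recv (initial π (k + 1)) Q)⁻¹ * S.recv (initial π (k + 1)) D).trace.re
  map_add' D D' := by
    simp only [map_add, Matrix.trace_add, Complex.add_re, mul_add,
      Finset.sum_add_distrib]
  map_smul' c D := by
    simp only [map_smul, Matrix.mul_smul, Matrix.trace_smul, Complex.smul_re, smul_eq_mul,
      Finset.mul_sum, RingHom.id_apply]
    exact Finset.sum_congr rfl fun k _ => by ring

theorem covObjective_le_tangent (hw : ∀ k, 0 < S.w k) {π : Equiv.Perm (Fin K)}
    (hπ : Antitone fun k => S.w (π k)) {Q Q' : Cov K Nt} (hQ : Q ∈ psd K Nt)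
    (hQ' : Q' ∈ psd K Nt) :
    S.covObjective π Q' ≤ S.covObjective π Q + S.slope π Q (Q' - Q) := by
  simp only [covObjective_eq, slope, LinearMap.coe_mk, AddHom.coe_mk, ← Finset.sum_add_distrib,
    ← mul_add]
  refine Finset.sum_le_sum fun k _ => mul_le_mul_of_nonneg_left ?_ (increment_nonneg hw hπ k)
  have h := log_det_le_tangent (one_add_recv_posDef (S := S) (initial π (k + 1)) hQ')
    (one_add_recv_posDef (S := S) (initial π (k + 1)) hQ)
  rwa [add_sub_add_left_eq_sub, ← map_sub] at h

theorem continuous_recv (A : Finset (Fin K)) : Continuous (S.recv A) := by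
  show Continuous fun Q : Cov K Nt => ∑ k ∈ A, S.H k * Q k * (S.H k)ᴴ
  fun_prop

theorem continuousOn_inv_one_add_recv (A : Finset (Fin K)) :
    ContinuousOn (fun Q : Cov K Nt => (1 + S.recv A Q)⁻¹) (psd K Nt) := by
  intro Q hQ
  have h1 : ContinuousAt (fun Q : Cov K Nt => 1 + S.recv A Q) Q :=
    (continuous_const.add (continuous_recv A)).continuousAt
  have h2 : (1 + S.recv A Q).det ≠ 0 := (one_add_recv_posDef A hQ).det_pos.ne'
  have h3 : ContinuousAt (fun Q : Cov K Nt => (1 + S.recv A Q).det) Q :=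
    (continuous_const.add (continuous_recv A)).matrix_det.continuousAt
  have h4 : ContinuousAt (fun Q : Cov K Nt => (1 + S.recv A Q).adjugate) Q :=
    (continuous_const.add (continuous_recv A)).matrix_adjugate.continuousAt
  refine ContinuousAt.continuousWithinAt ?_
  simp only [Matrix.inv_def, Ring.inverse_eq_inv']
  exact (h3.inv₀ h2).smul h4

theorem continuousOn_covObjective (π : Equiv.Perm (Fin K)) :
    ContinuousOn (S.covObjective π) (psd K Nt) := by
  have : S.covObjective π = fun Q => ∑ k : Fin K, S.increment π k * S.logDet (initial π (k + 1)) Q :=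
    funext fun Q => covObjective_eq π Q
  rw [this]
  refine continuousOn_finsetSum _ fun k _ => continuousOn_const.mul ?_
  have h1 : Continuous fun Q : Cov K Nt => (1 + S.recv (initial π (k + 1)) Q).det.re :=
    Complex.continuous_re.comp (continuous_const.add (continuous_recv _)).matrix_det
  exact h1.continuousOn.log fun Q hQ => (det_re_pos (one_add_recv_posDef _ hQ)).ne'

theorem continuousOn_slope (π : Equiv.Perm (Fin K)) (D : Cov K Nt) :
    ContinuousOn (fun Q => S.slope π Q D) (psd K Nt) := by
  show ContinuousOn (fun Q => ∑ k : Fin K, S.increment π k *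
    ((1 + S.recv (initial π (k + 1)) Q)⁻¹ * S.recv (initial π (k + 1)) D).trace.re) (psd K Nt)
  refine continuousOn_finsetSum _ fun k _ => continuousOn_const.mul ?_
  have h : Continuous fun X : Matrix (Fin Nr) (Fin Nr) ℂ =>
      (X * S.recv (initial π (k + 1)) D).trace.re :=
    Complex.continuous_re.comp (continuous_id.matrix_mul continuous_const).matrix_trace
  exact h.comp_continuousOn (continuousOn_inv_one_add_recv (S := S) (initial π (k + 1)))

theorem continuous_slope_apply (π : Equiv.Perm (Fin K)) (Q : Cov K Nt) :
    Continuous (S.slope π Q) := by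
  show Continuous fun D => ∑ k : Fin K, S.increment π k *
    ((1 + S.recv (initial π (k + 1)) Q)⁻¹ * S.recv (initial π (k + 1)) D).trace.re
  refine continuous_finsetSum _ fun k _ => continuous_const.mul ?_
  have h : Continuous fun X : Matrix (Fin Nr) (Fin Nr) ℂ =>
      ((1 + S.recv (initial π (k + 1)) Q)⁻¹ * X).trace.re :=
    Complex.continuous_re.comp (continuous_const.matrix_mul continuous_id).matrix_trace
  exact h.comp (continuous_recv _)

end System

end EHMAC

namespace EHMAC

/-! ### Inverses of marginal rates -/

section Inverse

/-- The properties of a marginal-rate function on `[0, ∞)` which string tautening needs: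
it decreases strictly, from `h 0` at `0` towards the limit `0`, without jumps. -/
structure IsMarginal (h : ℝ → ℝ) : Prop where
  strictAnti : StrictAntiOn h (Ici 0)
  pos : ∀ p, 0 ≤ p → 0 < h p
  surj : ∀ y, 0 < y → y ≤ h 0 → ∃ p, 0 ≤ p ∧ h p = y

theorem gInv_nonneg (h : ℝ → ℝ) (y : ℝ≥0∞) : 0 ≤ gInv h y :=
  Real.sInf_nonneg fun _ hp => hp.1

theorem gInv_top (h : ℝ → ℝ) : gInv h ⊤ = 0 := by
  have : {p : ℝ | 0 ≤ p ∧ ENNReal.ofReal (h p) ≤ ⊤} = Ici 0 := by ext; simp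
  rw [gInv, this, csInf_Ici]

theorem IsMarginal.gInv_zero {h : ℝ → ℝ} (hh : IsMarginal h) : gInv h 0 = 0 := by
  have : {p : ℝ | 0 ≤ p ∧ ENNReal.ofReal (h p) ≤ 0} = ∅ := by
    ext p
    simp only [nonpos_iff_eq_zero, ENNReal.ofReal_eq_zero, mem_ofPred_eq, mem_empty_iff_false,
      iff_false, not_and, not_le]
    exact hh.pos p
  rw [gInv, this, Real.sInf_empty]

theorem IsMarginal.gInv_apply {h : ℝ → ℝ} (hh : IsMarginal h) {p : ℝ} (hp : 0 ≤ p) :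
    gInv h (ENNReal.ofReal (h p)) = p := by
  have : {q : ℝ | 0 ≤ q ∧ ENNReal.ofReal (h q) ≤ ENNReal.ofReal (h p)} = Ici p := by
    ext q
    simp only [mem_ofPred_eq, mem_Ici]
    constructor
    · rintro ⟨hq, hle⟩
      rw [ENNReal.ofReal_le_ofReal_iff (hh.pos p hp).le] at hle
      exact (hh.strictAnti.le_iff_ge hq hp).1 hle
    · intro hq
      exact ⟨hp.trans hq, ENNReal.ofReal_le_ofReal
        ((hh.strictAnti.le_iff_ge (hp.trans hq) hp).2 hq)⟩
  rw [gInv, this, csInf_Ici]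

theorem gInv_of_le {h : ℝ → ℝ} {y : ℝ} (hy : h 0 ≤ y) : gInv h (ENNReal.ofReal y) = 0 :=
  le_antisymm (csInf_le ⟨0, fun _ hp => hp.1⟩ ⟨le_rfl, ENNReal.ofReal_le_ofReal hy⟩)
    (gInv_nonneg _ _)

theorem IsMarginal.gInv_lt_iff {h : ℝ → ℝ} (hh : IsMarginal h) {y p : ℝ} (hy : 0 < y)
    (hp : 0 < p) : gInv h (ENNReal.ofReal y) < p ↔ h p < y := by
  rcases le_total (h 0) y with h0 | h0
  · rw [gInv_of_le h0]
    exact ⟨fun _ => (hh.strictAnti self_mem_Ici hp.le hp).trans_le h0, fun _ => hp⟩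
  · obtain ⟨q, hq, rfl⟩ := hh.surj y hy h0
    rw [hh.gInv_apply hq]
    exact (hh.strictAnti.lt_iff_gt hp.le hq).symm

theorem IsMarginal.lt_gInv_iff {h : ℝ → ℝ} (hh : IsMarginal h) {y p : ℝ} (hy : 0 < y)
    (hp : 0 ≤ p) : p < gInv h (ENNReal.ofReal y) ↔ y < h p := by
  rcases le_total (h 0) y with h0 | h0
  · rw [gInv_of_le h0]
    refine ⟨fun h1 => absurd h1 hp.not_gt, fun h1 => ?_⟩
    exact absurd (h1.trans_le ((hh.strictAnti.le_iff_ge hp self_mem_Ici).2 hp)) h0.not_gt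
  · obtain ⟨q, hq, rfl⟩ := hh.surj y hy h0
    rw [hh.gInv_apply hq]
    exact (hh.strictAnti.lt_iff_gt hq hp).symm

theorem IsMarginal.continuousOn_gInv {h : ℝ → ℝ} (hh : IsMarginal h) :
    ContinuousOn (fun y : ℝ => gInv h (ENNReal.ofReal y)) (Ioi 0) := by
  intro y hy
  refine ContinuousAt.continuousWithinAt (tendsto_order.2 ⟨fun p hp => ?_, fun p hp => ?_⟩)
  · rcases lt_or_ge p 0 with h0 | h0
    · exact Eventually.of_forall fun _ => h0.trans_le (gInv_nonneg _ _)
    · filter_upwards [lt_mem_nhds hy, gt_mem_nhds ((hh.lt_gInv_iff hy h0).1 hp)] with z hz hz'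
      exact (hh.lt_gInv_iff hz h0).2 hz'
  · have h0 : 0 < p := (gInv_nonneg _ _).trans_lt hp
    filter_upwards [lt_mem_nhds hy, lt_mem_nhds ((hh.gInv_lt_iff hy h0).1 hp)] with z hz hz'
    exact (hh.gInv_lt_iff hz h0).2 hz'

theorem gInv_anti {h : ℝ → ℝ} (hh : IsMarginal h) {y z : ℝ≥0∞} (hy : y ≠ 0) (hyz : y ≤ z) :
    gInv h z ≤ gInv h y := by
  rcases eq_or_ne z ⊤ with rfl | hz
  · rw [gInv_top]; exact gInv_nonneg _ _
  have hyt : y ≠ ⊤ := ne_top_of_le_ne_top hz hyz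
  refine le_of_not_gt fun hlt => ?_
  rw [← ENNReal.ofReal_toReal hz, ← ENNReal.ofReal_toReal hyt] at hlt
  have hy0 := ENNReal.toReal_pos hy hyt
  have hz0 := hy0.trans_le (ENNReal.toReal_mono hz hyz)
  have h1 := (hh.lt_gInv_iff hz0 (gInv_nonneg _ _)).1 hlt
  have h2 := (hh.lt_gInv_iff hy0 (gInv_nonneg _ _)).2
    ((ENNReal.toReal_mono hz hyz).trans_lt h1)
  exact lt_irrefl _ h2

theorem gInv_strictAnti {h : ℝ → ℝ} (hh : IsMarginal h) {y z : ℝ≥0∞} (hy : y ≠ 0) (hyz : y < z)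
    (h0 : 0 < gInv h y) : gInv h z < gInv h y := by
  rcases eq_or_ne z ⊤ with rfl | hz
  · rwa [gInv_top]
  have hyt : y ≠ ⊤ := ne_top_of_lt hyz
  rw [← ENNReal.ofReal_toReal hz]
  have hy0 := ENNReal.toReal_pos hy hyt
  have hlt := ENNReal.toReal_strict_mono hz hyz
  rw [hh.gInv_lt_iff (hy0.trans hlt) h0]
  refine lt_of_le_of_lt (le_of_not_gt fun h1 => ?_) hlt
  have h2 := (hh.lt_gInv_iff hy0 h0.le).2 h1
  rw [ENNReal.ofReal_toReal hyt] at h2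
  exact lt_irrefl _ h2

end Inverse

/-! ### Water-levels -/

section WaterLevel

variable {M n : ℕ} {L : ℕ → ℝ} {g : ℕ → ℝ → ℝ}

theorem levelEnergy_zero : levelEnergy L g n 0 = 0 := by
  simp [levelEnergy, gInv_top]

theorem levelEnergy_top (hg : ∀ i < n, IsMarginal (g i)) : levelEnergy L g n ⊤ = 0 :=
  Finset.sum_eq_zero fun i hi => by
    rw [ENNReal.inv_top, (hg i (Finset.mem_range.1 hi)).gInv_zero, zero_mul]

theorem levelEnergy_mono (hL : ∀ i < n, 0 < L i) (hg : ∀ i < n, IsMarginal (g i))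
    {ω ω' : ℝ≥0∞} (h : ω ≤ ω') (h' : ω' ≠ ⊤) : levelEnergy L g n ω ≤ levelEnergy L g n ω' :=
  Finset.sum_le_sum fun i hi => mul_le_mul_of_nonneg_right
    (gInv_anti (hg i (Finset.mem_range.1 hi)) (ENNReal.inv_ne_zero.2 h') (ENNReal.inv_le_inv.2 h))
    (hL i (Finset.mem_range.1 hi)).le

theorem levelEnergy_strictMono (hL : ∀ i < n, 0 < L i) (hg : ∀ i < n, IsMarginal (g i))
    {ω ω' : ℝ≥0∞} (h : ω < ω') (h' : ω' ≠ ⊤) (h0 : 0 < levelEnergy L g n ω') :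
    levelEnergy L g n ω < levelEnergy L g n ω' := by
  have h0' : ∑ i ∈ Finset.range n, (0 : ℝ) < ∑ i ∈ Finset.range n, gInv (g i) ω'⁻¹ * L i := by
    rw [Finset.sum_const_zero]; exact h0
  obtain ⟨i, hi, hpos⟩ := Finset.exists_lt_of_sum_lt h0'
  have hi' := Finset.mem_range.1 hi
  refine Finset.sum_lt_sum (fun j hj => mul_le_mul_of_nonneg_right
    (gInv_anti (hg j (Finset.mem_range.1 hj)) (ENNReal.inv_ne_zero.2 h')
      (ENNReal.inv_le_inv.2 h.le)) (hL j (Finset.mem_range.1 hj)).le) ⟨i, hi, ?_⟩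
  exact mul_lt_mul_of_pos_right (gInv_strictAnti (hg i hi') (ENNReal.inv_ne_zero.2 h')
    (ENNReal.inv_lt_inv.2 h) (pos_of_mul_pos_left hpos (hL i hi').le)) (hL i hi')

/-- Every energy `e > 0` is spent by some constant water-level, by the intermediate value
theorem. -/
theorem exists_levelEnergy_eq (hn : 1 ≤ n) (hL : ∀ i < n, 0 < L i)
    (hg : ∀ i < n, IsMarginal (g i)) {e : ℝ} (he : 0 < e) :
    ∃ ω : ℝ≥0∞, ω ≠ ⊤ ∧ levelEnergy L g n ω = e := by
  set ψ : ℝ → ℝ := fun y => ∑ i ∈ Finset.range n, gInv (g i) (ENNReal.ofReal y) * L i with hψ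
  have hcont : ContinuousOn ψ (Ioi 0) :=
    continuousOn_finsetSum _ fun i hi =>
      (hg i (Finset.mem_range.1 hi)).continuousOn_gInv.mul continuousOn_const
  -- the level `y₁` is so low that epoch `0` alone spends at least `e`
  set y₁ := g 0 (e / L 0 + 1)
  have hp : 0 ≤ e / L 0 := (div_pos he (hL 0 hn)).le
  have hp1 : 0 ≤ e / L 0 + 1 := by linarith
  have hy₁ : 0 < y₁ := (hg 0 hn).pos _ hp1
  set y₂ := y₁ + ∑ i ∈ Finset.range n, g i 0
  have hg0 : ∀ i ∈ Finset.range n, 0 ≤ g i 0 := fun i hi =>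
    ((hg i (Finset.mem_range.1 hi)).pos 0 le_rfl).le
  have hy₁₂ : y₁ ≤ y₂ := le_add_of_nonneg_right (Finset.sum_nonneg hg0)
  have h1 : e ≤ ψ y₁ := by
    have h2 : gInv (g 0) (ENNReal.ofReal y₁) * L 0 ≤ ψ y₁ :=
      Finset.single_le_sum (f := fun i => gInv (g i) (ENNReal.ofReal y₁) * L i)
        (fun i hi => mul_nonneg (gInv_nonneg _ _) (hL i (Finset.mem_range.1 hi)).le)
        (Finset.mem_range.2 hn)
    rw [(hg 0 hn).gInv_apply hp1, add_mul, div_mul_cancel₀ _ (hL 0 hn).ne'] at h2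
    linarith [hL 0 hn]
  have h2 : ψ y₂ ≤ e := by
    refine le_of_eq_of_le (Finset.sum_eq_zero fun i hi => ?_) he.le
    rw [gInv_of_le, zero_mul]
    have := Finset.single_le_sum hg0 hi
    linarith
  obtain ⟨y, hy, hye⟩ := intermediate_value_Icc' hy₁₂
    (hcont.mono fun z hz => hy₁.trans_le hz.1) ⟨h2, h1⟩
  have hy0 : 0 < y := hy₁.trans_le hy.1
  refine ⟨(ENNReal.ofReal y)⁻¹, ENNReal.inv_ne_top.2 (ENNReal.ofReal_pos.2 hy0).ne', ?_⟩
  rw [levelEnergy, inv_inv]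
  exact hye

theorem waterLevel_spec (hn : 1 ≤ n) (hL : ∀ i < n, 0 < L i)
    (hg : ∀ i < n, IsMarginal (g i)) {e : ℝ} (he : 0 ≤ e) :
    waterLevel L g n e ≠ ⊤ ∧ levelEnergy L g n (waterLevel L g n e) = e := by
  rcases he.eq_or_lt with rfl | he
  · have : waterLevel L g n 0 = 0 :=
      nonpos_iff_eq_zero.1 (sInf_le levelEnergy_zero)
    rw [this]
    exact ⟨ENNReal.zero_ne_top, levelEnergy_zero⟩
  · obtain ⟨ω, hω, hωe⟩ := exists_levelEnergy_eq hn hL hg he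
    have : {ω : ℝ≥0∞ | levelEnergy L g n ω = e} = {ω} := by
      ext ω'
      simp only [mem_ofPred_eq, mem_singleton_iff]
      refine ⟨fun h => ?_, fun h => h ▸ hωe⟩
      have hω' : ω' ≠ ⊤ := by
        rintro rfl
        rw [levelEnergy_top hg] at h
        exact he.ne h
      rcases lt_trichotomy ω ω' with h1 | h1 | h1
      · exact absurd (levelEnergy_strictMono hL hg h1 hω' (h ▸ he)) (by rw [h, hωe]; exact lt_irrefl _)
      · exact h1.symm
      · exact absurd (levelEnergy_strictMono hL hg h1 hω (hωe ▸ he))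
          (by rw [h, hωe]; exact lt_irrefl _)
    rw [waterLevel, this, sInf_singleton]
    exact ⟨hω, hωe⟩

theorem waterLevel_mono (hn : 1 ≤ n) (hL : ∀ i < n, 0 < L i)
    (hg : ∀ i < n, IsMarginal (g i)) {e e' : ℝ} (he : 0 ≤ e) (hee : e ≤ e') :
    waterLevel L g n e ≤ waterLevel L g n e' := by
  obtain ⟨h1, h2⟩ := waterLevel_spec hn hL hg he
  obtain ⟨h3, h4⟩ := waterLevel_spec hn hL hg (he.trans hee)
  refine le_of_not_gt fun hlt => ?_
  have h5 := levelEnergy_mono hL hg hlt.le h1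
  rw [h2, h4] at h5
  rw [le_antisymm hee h5] at hlt
  exact lt_irrefl _ hlt

end WaterLevel

/-! ### The first change of the water-level -/

section FirstChange

/-- What `FirstChangeW` returns, in terms of the water-levels `up m`, `um m` at which the two
constraints at `m` are met with equality: either the battery is full at `τ` and the level `ω`
would use up, if not exceed, the energy available at some later `n`, or it is empty at `τ` and the
level `ω` would fill the battery, if not let it overflow, at some `n ≥ τ`. In both cases the level
`ω` is admissible up to `τ`. -/
def IsFirstChange (B : ℝ) (M : ℕ) (a : ℕ → ℝ) (up um : ℕ → ℝ≥0∞) (c : ℕ × ℝ≥0∞ × ℝ) : Prop :=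
  1 ≤ c.1 ∧ c.1 ≤ M ∧ (∀ m, 1 ≤ m → m ≤ c.1 → um m ≤ c.2.1 ∧ c.2.1 ≤ up m) ∧
  ((c.2.2 = mustUse B a c.1 ∧ c.2.1 = um c.1 ∧ 0 < c.2.1 ∧
      ∃ n, c.1 < n ∧ n ≤ M ∧ up n ≤ c.2.1 ∧ ∀ m, 1 ≤ m → m < n → um m ≤ c.2.1) ∨
    (c.2.2 = harvested a c.1 ∧ c.2.1 = up c.1 ∧
      ∃ n, c.1 ≤ n ∧ n ≤ M ∧ c.2.1 ≤ um n ∧ ∀ m, 1 ≤ m → m < n → c.2.1 ≤ up m))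

theorem firstChangeLoop_spec (B : ℝ) (M : ℕ) (a L : ℕ → ℝ) (g : ℕ → ℝ → ℝ)
    (up um : ℕ → ℝ≥0∞) (hup : up = fun n => waterLevel L g n (harvested a n))
    (hum : um = fun n => waterLevel L g n (mustUse B a n)) (hM : 1 ≤ M)
    (hle : ∀ m, 1 ≤ m → m ≤ M → um m ≤ up m) (hlast : um M = up M) :
    ∀ (fuel n : ℕ) (ωm : ℝ≥0∞) (τm : ℕ) (ωp : ℝ≥0∞) (τp : ℕ), fuel + n = M + 1 → 1 ≤ n →
      τp < n → τm < n → τp < M →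
      (∀ m, 1 ≤ m → m < n → um m ≤ ωm) → (∀ m, 1 ≤ m → m < n → ωp ≤ up m) →
      (∀ m, 1 ≤ m → τp < m → m < n → ωp < up m) →
      (2 ≤ n → 1 ≤ τp ∧ 1 ≤ τm ∧ ωp = up τp ∧ ωm = um τm) → (n = 1 → ωp = ⊤ ∧ ωm = 0) →
      (ωm < ωp ∨ ωm = ωp ∧ τm < τp) →
      IsFirstChange B M a up um (firstChangeLoop B M a L g fuel n ωm τm ωp τp) := by
  intro fuel
  induction fuel with
  | zero =>
    intro n ωm τm ωp τp hn hn1 hτp hτm hτM hm hp hps h2 h1 hlt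
    -- the loop cannot run out of fuel, since both constraints at `M` have the same level
    exfalso
    have hnM : n = M + 1 := by omega
    have h3 := hps M hM hτM (by omega)
    have h4 := hm M hM (by omega)
    rw [hlast] at h4
    rcases hlt with h | ⟨h, -⟩
    · exact absurd (h3.trans_le h4) h.not_gt
    · exact absurd (h3.trans_le h4) h.le.not_gt
  | succ fuel ih =>
    intro n ωm τm ωp τp hn hn1 hτp hτm hτM hm hp hps h2 h1 hlt
    rw [firstChangeLoop]
    have eup : waterLevel L g n (harvested a n) = up n := by rw [hup]
    have eum : waterLevel L g n (mustUse B a n) = um n := by rw [hum]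
    simp only [eup, eum]
    have hnM : n ≤ M := by omega
    have hmp : ωm ≤ ωp := by rcases hlt with h | ⟨h, -⟩ <;> exact h.le
    set τp' := if up n ≤ ωp then n else τp with eτp
    set ωp' := if up n ≤ ωp then up n else ωp with eωp
    set τm' := if ωm ≤ um n then n else τm with eτm
    set ωm' := if ωm ≤ um n then um n else ωm with eωm
    have hτp' : τp' ≤ n := by rw [eτp]; split_ifs <;> omega
    have hτm' : τm' ≤ n := by rw [eτm]; split_ifs <;> omega
    have hup' : 1 ≤ τp' ∧ ωp' = up τp' := by
      rw [eτp, eωp]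
      split_ifs with h
      · exact ⟨hn1, rfl⟩
      · rcases Nat.lt_or_ge 1 n with h3 | h3
        · exact ⟨(h2 h3).1, (h2 h3).2.2.1⟩
        · exact absurd le_top ((h1 (by omega)).1 ▸ h)
    have hum' : 1 ≤ τm' ∧ ωm' = um τm' := by
      rw [eτm, eωm]
      split_ifs with h
      · exact ⟨hn1, rfl⟩
      · rcases Nat.lt_or_ge 1 n with h3 | h3
        · exact ⟨(h2 h3).2.1, (h2 h3).2.2.2⟩
        · exact absurd (zero_le) ((h1 (by omega)).2 ▸ h)
    have hωp : ωp' ≤ ωp := by rw [eωp]; split_ifs with h; exacts [h, le_rfl]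
    have hωm : ωm ≤ ωm' := by rw [eωm]; split_ifs with h; exacts [h, le_rfl]
    have hωpn : ωp' ≤ up n := by rw [eωp]; split_ifs with h; exacts [le_rfl, (not_le.1 h).le]
    have hωmn : um n ≤ ωm' := by rw [eωm]; split_ifs with h; exacts [le_rfl, (not_le.1 h).le]
    have hm' : ∀ m, 1 ≤ m → m < n + 1 → um m ≤ ωm' := fun m hm1 hm2 => by
      rcases Nat.lt_succ_iff_lt_or_eq.1 hm2 with h | rfl
      · exact (hm m hm1 h).trans hωm
      · exact hωmn
    have hp' : ∀ m, 1 ≤ m → m < n + 1 → ωp' ≤ up m := fun m hm1 hm2 => by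
      rcases Nat.lt_succ_iff_lt_or_eq.1 hm2 with h | rfl
      · exact hωp.trans (hp m hm1 h)
      · exact hωpn
    split_ifs with hc1 hc2
    · -- the level must drop: `τm' < n`, so the lower candidate is the one of the previous pass
      obtain ⟨h3, h4⟩ := hc1
      have h5 : ¬ ωm ≤ um n := fun h => by
        rw [eτm, if_pos h] at h4; omega
      have h6 : up n ≤ ωp := by
        by_contra h6
        rw [eωp, eωm, if_neg h5, if_neg h6] at h3
        exact absurd h3 hmp.not_gt
      have e1 : ωm' = ωm := by rw [eωm, if_neg h5]
      have e2 : ωp' = up n := by rw [eωp, if_pos h6]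
      refine ⟨hum'.1, hτm'.trans hnM, fun m hm1 hm2 => ⟨hm' m hm1 (by simp only at hm2; omega), ?_⟩,
        Or.inl ⟨rfl, hum'.2, (zero_le).trans_lt h3, n, by simp only; omega, hnM, by simpa only [e2] using h3.le,
          fun m hm1 hm2 => hm' m hm1 (by omega)⟩⟩
      simp only at hm2 ⊢
      rw [e1]
      exact hmp.trans (hp m hm1 (by omega))
    · have hωn : ωp' ≤ um n ∨ τp' = M := by
        rcases hc2 with ⟨h3, h4⟩ | h3
        · left
          by_cases h5 : ωm ≤ um n
          · rwa [eωm, if_pos h5] at h3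
          · exfalso
            rw [eτm, if_neg h5] at h4
            rw [eωm, if_neg h5] at h3
            by_cases h6 : up n ≤ ωp
            · rw [eτp, if_pos h6] at h4; omega
            · rw [eτp, if_neg h6] at h4
              rw [eωp, if_neg h6] at h3
              rcases hlt with h | ⟨-, h⟩
              · exact absurd h3 h.not_ge
              · omega
        · exact Or.inr h3
      have hωn' : ωp' ≤ um n := by
        rcases hωn with h | h
        · exact h
        · have : n = M := by omega
          rw [hup'.2, h, this, hlast]
      refine ⟨hup'.1, hτp'.trans hnM, fun m hm1 hm2 => ⟨?_, hp' m hm1 (by simp only at hm2; omega)⟩,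
        Or.inr ⟨rfl, hup'.2, n, hτp', hnM, hωn', fun m hm1 hm2 => hp' m hm1 (by omega)⟩⟩
      simp only at hm2 ⊢
      by_cases h6 : up n ≤ ωp
      · have e1 : τp' = n := by rw [eτp, if_pos h6]
        have e2 : ωp' = up n := by rw [eωp, if_pos h6]
        by_cases h5 : ωm ≤ um n
        · have e3 : ωm' = um n := by rw [eωm, if_pos h5]
          have := hm' m hm1 (by omega)
          rw [e3] at this
          rw [e2]
          exact this.trans (hle n hn1 hnM)
        · have e4 : τm' = τm := by rw [eτm, if_neg h5]
          have h7 : ωm' ≤ ωp' := not_lt.1 fun h => hc1 ⟨h, by omega⟩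
          exact (hm' m hm1 (by omega)).trans h7
      · have e1 : τp' = τp := by rw [eτp, if_neg h6]
        have e2 : ωp' = ωp := by rw [eωp, if_neg h6]
        rw [e2]
        exact (hm m hm1 (by omega)).trans hmp
    · have hτpM : τp' ≠ M := fun h => hc2 (Or.inr h)
      refine ih (n + 1) ωm' τm' ωp' τp' (by omega) (by omega) (by omega) (by omega) (by omega)
        hm' hp' (fun m hm1 hm2 hm3 => ?_) (fun _ => ⟨hup'.1, hum'.1, hup'.2, hum'.2⟩)
        (fun h => by omega) ?_
      · by_cases h6 : up n ≤ ωp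
        · rw [eτp, if_pos h6] at hm2; omega
        · rw [eτp, if_neg h6] at hm2
          rw [eωp, if_neg h6]
          rcases Nat.lt_succ_iff_lt_or_eq.1 hm3 with h | rfl
          · exact hps m hm1 hm2 h
          · exact not_le.1 h6
      · by_cases h7 : τm' < τp'
        · rcases (not_lt.1 fun h => hc1 ⟨h, h7⟩).lt_or_eq with h | h
          · exact Or.inl h
          · exact Or.inr ⟨h, h7⟩
        · exact Or.inl (not_le.1 fun h => hc2 (Or.inl ⟨h, not_lt.1 h7⟩))

theorem firstChange_spec (B : ℝ) (M : ℕ) (a L : ℕ → ℝ) (g : ℕ → ℝ → ℝ) (hM : 1 ≤ M)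
    (hle : ∀ m, 1 ≤ m → m ≤ M →
      waterLevel L g m (mustUse B a m) ≤ waterLevel L g m (harvested a m))
    (hlast : mustUse B a M = harvested a M) :
    IsFirstChange B M a (fun n => waterLevel L g n (harvested a n))
      (fun n => waterLevel L g n (mustUse B a n)) (firstChange B M a L g) :=
  firstChangeLoop_spec B M a L g _ _ rfl rfl hM hle (by simp only [hlast]) M 1 0 0 ⊤ 0 rfl le_rfl
    one_pos one_pos hM (fun m h1 h2 => by omega) (fun m h1 h2 => by omega)
    (fun m h1 _ h2 => by omega) (fun h => by omega) (fun _ => ⟨rfl, rfl⟩)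
    (Or.inl ENNReal.zero_lt_top)

end FirstChange

end EHMAC

namespace EHMAC

/-! ### Taut schedules -/

section Tautening

/-- Energy spent by the powers `p` in the first `n` epochs. -/
noncomputable def spent (L p : ℕ → ℝ) (n : ℕ) : ℝ := ∑ i ∈ Finset.range n, p i * L i

theorem spent_succ (L p : ℕ → ℝ) (n : ℕ) : spent L p (n + 1) = spent L p n + p n * L n :=
  Finset.sum_range_succ _ _

/-- A feasible schedule `p` of one user that cannot be improved to first order by moving energy
from one epoch to a later one (possible as long as the battery is not full in between) or to an
earlier one (possible as long as the battery is not empty in between). -/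
structure IsTaut (B : ℝ) (M : ℕ) (a L : ℕ → ℝ) (g : ℕ → ℝ → ℝ) (p : ℕ → ℝ) : Prop where
  nonneg : ∀ i < M, 0 ≤ p i
  mustUse_le : ∀ n, 1 ≤ n → n ≤ M → mustUse B a n ≤ spent L p n
  le_harvested : ∀ n, 1 ≤ n → n ≤ M → spent L p n ≤ harvested a n
  later : ∀ s t, s < t → t < M → 0 < p s →
    (∀ m, s < m → m ≤ t → mustUse B a m < spent L p m) → g t (p t) ≤ g s (p s)
  earlier : ∀ s t, s < t → t < M → 0 < p t →
    (∀ m, s < m → m ≤ t → spent L p m < harvested a m) → g s (p s) ≤ g t (p t)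

theorem exists_last_before {Q : ℕ → Prop} {a m : ℕ} (ham : a ≤ m) (ha : Q a) (hm : ¬ Q m) :
    ∃ s, a ≤ s ∧ s < m ∧ Q s ∧ ∀ j, s < j → j ≤ m → ¬ Q j := by
  induction m, ham using Nat.le_induction with
  | base => exact absurd ha hm
  | succ m ham ih =>
    by_cases h : Q m
    · exact ⟨m, ham, m.lt_succ_self, h, fun j h1 h2 => by
        have : j = m + 1 := by omega
        rwa [this]⟩
    · obtain ⟨s, h1, h2, h3, h4⟩ := ih h
      refine ⟨s, h1, by omega, h3, fun j h5 h6 => ?_⟩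
      rcases Nat.lt_or_ge m j with h7 | h7
      · have : j = m + 1 := by omega
        rwa [this]
      · exact h4 j h5 h7

theorem exists_first_after {Q : ℕ → Prop} {m b : ℕ} (hmb : m ≤ b) (hb : Q b) (hm : ¬ Q m) :
    ∃ t, m < t ∧ t ≤ b ∧ Q t ∧ ∀ j, m ≤ j → j < t → ¬ Q j := by
  classical
  have hex : ∃ t, m ≤ t ∧ Q t := ⟨b, hmb, hb⟩
  refine ⟨Nat.find hex, ?_, Nat.find_min' hex ⟨hmb, hb⟩, (Nat.find_spec hex).2,
    fun j h1 h2 h3 => Nat.find_min hex h2 ⟨h1, h3⟩⟩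
  refine lt_of_le_of_ne (Nat.find_spec hex).1 fun h => hm ?_
  have := (Nat.find_spec hex).2
  rwa [← h] at this

variable {B : ℝ} {M : ℕ} {a L : ℕ → ℝ} {g : ℕ → ℝ → ℝ} {p : ℕ → ℝ}

/-- The curve of a taut schedule does not rise above the curve of a constant water-level between
two points where it is not above, as long as the latter respects the overflow constraint. -/
theorem IsTaut.spent_le_of_level (hp : IsTaut B M a L g p) (hL : ∀ i < M, 0 < L i)
    (hg : ∀ i < M, IsMarginal (g i)) {ω : ℝ≥0∞} (hω : ω ≠ 0) (hω' : ω ≠ ⊤) {s₀ t₀ : ℕ}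
    (ht₀ : t₀ ≤ M) (hs : spent L p s₀ ≤ levelEnergy L g s₀ ω)
    (ht : spent L p t₀ ≤ levelEnergy L g t₀ ω)
    (hC : ∀ m, s₀ < m → m < t₀ → mustUse B a m ≤ levelEnergy L g m ω) {m : ℕ} (h1 : s₀ ≤ m)
    (h2 : m ≤ t₀) : spent L p m ≤ levelEnergy L g m ω := by
  by_contra hm
  obtain ⟨s, hs1, hs2, hs3, hs4⟩ :=
    exists_last_before (Q := fun j => spent L p j ≤ levelEnergy L g j ω) h1 hs hm
  obtain ⟨t, ht1, ht2, ht3, ht4⟩ :=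
    exists_first_after (Q := fun j => spent L p j ≤ levelEnergy L g j ω) h2 ht hm
  obtain ⟨t, rfl⟩ : ∃ u, t = u + 1 := ⟨t - 1, by omega⟩
  have hsM : s < M := by omega
  have htM : t < M := by omega
  have hy : 0 < (ω⁻¹).toReal :=
    ENNReal.toReal_pos (ENNReal.inv_ne_zero.2 hω') (ENNReal.inv_ne_top.2 hω)
  have hyω : ENNReal.ofReal (ω⁻¹).toReal = ω⁻¹ := ENNReal.ofReal_toReal (ENNReal.inv_ne_top.2 hω)
  have above : ∀ j, s < j → j ≤ t → levelEnergy L g j ω < spent L p j := fun j h3 h4 => by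
    rcases le_total j m with h5 | h5
    · exact not_le.1 (hs4 j h3 h5)
    · exact not_le.1 (ht4 j h5 (by omega))
  have hps : gInv (g s) ω⁻¹ < p s := by
    have h3 := above (s + 1) (by omega) (by omega)
    rw [spent_succ, levelEnergy, Finset.sum_range_succ] at h3
    have h4 : gInv (g s) ω⁻¹ * L s < p s * L s := by
      have h5 := hs3; simp only [levelEnergy] at h5; linarith
    exact lt_of_mul_lt_mul_right h4 (hL s hsM).le
  have hpt : p t < gInv (g t) ω⁻¹ := by
    have h3 := above t (by omega) le_rfl
    have h5 := ht3
    simp only [spent_succ, levelEnergy, Finset.sum_range_succ] at h3 h5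
    have h4 : p t * L t < gInv (g t) ω⁻¹ * L t := by linarith
    exact lt_of_mul_lt_mul_right h4 (hL t htM).le
  have hps0 : 0 < p s := (gInv_nonneg _ _).trans_lt hps
  have key := hp.later s t (by omega) htM hps0 fun j h3 h4 =>
    (hC j (by omega) (by omega)).trans_lt (above j h3 h4)
  rw [← hyω] at hps hpt
  have h5 := ((hg s hsM).gInv_lt_iff hy hps0).1 hps
  have h6 := ((hg t htM).lt_gInv_iff hy (hp.nonneg t htM)).1 hpt
  linarith

/-- The mirror image of `IsTaut.spent_le_of_level`, for the energy causality constraint. -/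
theorem IsTaut.level_le_spent (hp : IsTaut B M a L g p) (hL : ∀ i < M, 0 < L i)
    (hg : ∀ i < M, IsMarginal (g i)) {ω : ℝ≥0∞} (hω : ω ≠ 0) (hω' : ω ≠ ⊤) {s₀ t₀ : ℕ}
    (ht₀ : t₀ ≤ M) (hs : levelEnergy L g s₀ ω ≤ spent L p s₀)
    (ht : levelEnergy L g t₀ ω ≤ spent L p t₀)
    (hA : ∀ m, s₀ < m → m < t₀ → levelEnergy L g m ω ≤ harvested a m) {m : ℕ} (h1 : s₀ ≤ m)
    (h2 : m ≤ t₀) : levelEnergy L g m ω ≤ spent L p m := by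
  by_contra hm
  obtain ⟨s, hs1, hs2, hs3, hs4⟩ :=
    exists_last_before (Q := fun j => levelEnergy L g j ω ≤ spent L p j) h1 hs hm
  obtain ⟨t, ht1, ht2, ht3, ht4⟩ :=
    exists_first_after (Q := fun j => levelEnergy L g j ω ≤ spent L p j) h2 ht hm
  obtain ⟨t, rfl⟩ : ∃ u, t = u + 1 := ⟨t - 1, by omega⟩
  have hsM : s < M := by omega
  have htM : t < M := by omega
  have hy : 0 < (ω⁻¹).toReal :=
    ENNReal.toReal_pos (ENNReal.inv_ne_zero.2 hω') (ENNReal.inv_ne_top.2 hω)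
  have hyω : ENNReal.ofReal (ω⁻¹).toReal = ω⁻¹ := ENNReal.ofReal_toReal (ENNReal.inv_ne_top.2 hω)
  have below : ∀ j, s < j → j ≤ t → spent L p j < levelEnergy L g j ω := fun j h3 h4 => by
    rcases le_total j m with h5 | h5
    · exact not_le.1 (hs4 j h3 h5)
    · exact not_le.1 (ht4 j h5 (by omega))
  have hps : p s < gInv (g s) ω⁻¹ := by
    have h3 := below (s + 1) (by omega) (by omega)
    rw [spent_succ, levelEnergy, Finset.sum_range_succ] at h3
    have h4 : p s * L s < gInv (g s) ω⁻¹ * L s := by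
      have h5 := hs3; simp only [levelEnergy] at h5; linarith
    exact lt_of_mul_lt_mul_right h4 (hL s hsM).le
  have hpt : gInv (g t) ω⁻¹ < p t := by
    have h3 := below t (by omega) le_rfl
    have h5 := ht3
    simp only [spent_succ, levelEnergy, Finset.sum_range_succ] at h3 h5
    have h4 : gInv (g t) ω⁻¹ * L t < p t * L t := by linarith
    exact lt_of_mul_lt_mul_right h4 (hL t htM).le
  have hpt0 : 0 < p t := (gInv_nonneg _ _).trans_lt hpt
  have key := hp.earlier s t (by omega) htM hpt0 fun j h3 h4 =>
    (below j h3 h4).trans_le (hA j (by omega) (by omega))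
  rw [← hyω] at hps hpt
  have h5 := ((hg s hsM).lt_gInv_iff hy (hp.nonneg s hsM)).1 hps
  have h6 := ((hg t htM).gInv_lt_iff hy hpt0).1 hpt
  linarith

theorem spent_nonneg (hL : ∀ i < M, 0 < L i) (hp : ∀ i < M, 0 ≤ p i) {n : ℕ} (hn : n ≤ M) :
    0 ≤ spent L p n :=
  Finset.sum_nonneg fun i hi =>
    have hi' := Finset.mem_range.1 hi
    mul_nonneg (hp i (by omega)) (hL i (by omega)).le

theorem harvested_remaining (a : ℕ → ℝ) (τ : ℕ) (e : ℝ) (m : ℕ) :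
    harvested (remaining a τ e) (m + 1) = harvested a (τ + m + 1) - e := by
  induction m with
  | zero => simp [harvested, remaining]
  | succ m ih =>
    rw [harvested, Finset.sum_range_succ, ← harvested, ih]
    simp only [remaining]
    rw [show τ + (m + 1) + 1 = (τ + m + 1) + 1 by ring]
    simp only [harvested]
    rw [Finset.sum_range_succ _ (τ + m + 1), show τ + 1 + m = τ + m + 1 by ring]
    ring

theorem spent_shift (L p : ℕ → ℝ) (τ m : ℕ) :
    spent (fun j => L (τ + j)) (fun j => p (τ + j)) m = spent L p (τ + m) - spent L p τ := by
  simp only [spent]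
  rw [Finset.sum_range_add]
  ring

theorem harvested_remaining' (a : ℕ → ℝ) (τ : ℕ) (e : ℝ) {m : ℕ} (hm : 1 ≤ m) :
    harvested (remaining a τ e) m = harvested a (τ + m) - e := by
  obtain ⟨m, rfl⟩ : ∃ u, m = u + 1 := ⟨m - 1, by omega⟩
  exact harvested_remaining a τ e m

/-- A taut schedule that has spent `e` by `t_τ` is taut from then on. -/
theorem IsTaut.tail (hp : IsTaut B M a L g p) (hL : ∀ i < M, 0 < L i) {τ : ℕ} (hτ : τ ≤ M)
    {e : ℝ} (he : spent L p τ = e) :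
    IsTaut B (M - τ) (remaining a τ e) (fun j => L (τ + j)) (fun j => g (τ + j))
      (fun j => p (τ + j)) := by
  have he0 : 0 ≤ e := he ▸ spent_nonneg hL hp.nonneg hτ
  have hS : ∀ m, spent (fun j => L (τ + j)) (fun j => p (τ + j)) m = spent L p (τ + m) - e :=
    fun m => by rw [spent_shift, he]
  refine ⟨fun i hi => hp.nonneg _ (by omega), fun n h1 h2 => ?_, fun n h1 h2 => ?_,
    fun s t hst ht h0 h => ?_, fun s t hst ht h0 h => ?_⟩
  · have h3 := hp.mustUse_le (τ + n) (by omega) (by omega)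
    refine max_le ?_ (spent_nonneg (M := M - τ) (fun i hi => hL _ (by omega))
      (fun i hi => hp.nonneg _ (by omega)) h2)
    rw [hS, harvested_remaining]
    have := (le_max_left _ _).trans h3
    linarith
  · rw [hS, harvested_remaining' a τ e h1]
    linarith [hp.le_harvested (τ + n) (by omega) (by omega)]
  · refine hp.later (τ + s) (τ + t) (by omega) (by omega) h0 fun m h1 h2 => ?_
    obtain ⟨j, rfl⟩ : ∃ j, m = τ + j := ⟨m - τ, by omega⟩
    have h3 := h j (by omega) (by omega)
    rw [hS, mustUse, harvested_remaining, max_lt_iff] at h3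
    refine max_lt ?_ (by linarith)
    linarith [h3.1]
  · refine hp.earlier (τ + s) (τ + t) (by omega) (by omega) h0 fun m h1 h2 => ?_
    obtain ⟨j, rfl⟩ : ∃ j, m = τ + j := ⟨m - τ, by omega⟩
    have h3 := h j (by omega) (by omega)
    rw [hS, harvested_remaining' a τ e (by omega)] at h3
    linarith

theorem IsTaut.mustUse_last (hp : IsTaut B M a L g p) (hL : ∀ i < M, 0 < L i) (hM : 1 ≤ M)
    (haM : a M = B) : mustUse B a M = harvested a M := by
  rw [mustUse, harvested, Finset.sum_range_succ, ← harvested, haM, add_sub_cancel_right]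
  exact max_eq_left ((spent_nonneg hL hp.nonneg le_rfl).trans (hp.le_harvested M hM le_rfl))

/-- The first segment returned by `FirstChangeW` is the beginning of every taut schedule. -/
theorem IsTaut.eq_level (hp : IsTaut B M a L g p) (hL : ∀ i < M, 0 < L i)
    (hg : ∀ i < M, IsMarginal (g i)) {c : ℕ × ℝ≥0∞ × ℝ}
    (hc : IsFirstChange B M a (fun n => waterLevel L g n (harvested a n))
      (fun n => waterLevel L g n (mustUse B a n)) c) :
    spent L p c.1 = c.2.2 ∧ ∀ i < c.1, p i = gInv (g i) c.2.1⁻¹ := by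
  obtain ⟨τ, ω, e⟩ := c
  obtain ⟨hτ1, hτM, hlev, hcase⟩ := hc
  simp only at hτ1 hτM hlev hcase ⊢
  have hL' : ∀ n, n ≤ M → ∀ i < n, 0 < L i := fun n hn i hi => hL i (by omega)
  have hg' : ∀ n, n ≤ M → ∀ i < n, IsMarginal (g i) := fun n hn i hi => hg i (by omega)
  have hup : ∀ m, 1 ≤ m → m ≤ M → waterLevel L g m (harvested a m) ≠ ⊤ ∧
      levelEnergy L g m (waterLevel L g m (harvested a m)) = harvested a m := fun m h1 h2 =>
    waterLevel_spec h1 (hL' m h2) (hg' m h2)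
      ((spent_nonneg hL hp.nonneg h2).trans (hp.le_harvested m h1 h2))
  have hum : ∀ m, 1 ≤ m → m ≤ M → waterLevel L g m (mustUse B a m) ≠ ⊤ ∧
      levelEnergy L g m (waterLevel L g m (mustUse B a m)) = mustUse B a m := fun m h1 h2 =>
    waterLevel_spec h1 (hL' m h2) (hg' m h2) (le_max_right _ _)
  have hωtop : ω ≠ ⊤ := by
    rcases hcase with ⟨-, h, -⟩ | ⟨-, h, -⟩
    · rw [h]; exact (hum τ hτ1 hτM).1
    · rw [h]; exact (hup τ hτ1 hτM).1
  have hleA : ∀ m, 1 ≤ m → m ≤ M → ω ≤ waterLevel L g m (harvested a m) →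
      levelEnergy L g m ω ≤ harvested a m := fun m h1 h2 h => by
    have := levelEnergy_mono (hL' m h2) (hg' m h2) h (hup m h1 h2).1
    rwa [(hup m h1 h2).2] at this
  have hCle : ∀ m, 1 ≤ m → m ≤ M → waterLevel L g m (mustUse B a m) ≤ ω →
      mustUse B a m ≤ levelEnergy L g m ω := fun m h1 h2 h => by
    have := levelEnergy_mono (hL' m h2) (hg' m h2) h hωtop
    rwa [(hum m h1 h2).2] at this
  have hzero : levelEnergy L g 0 ω = spent L p 0 := by simp [levelEnergy, spent]
  have he : levelEnergy L g τ ω = e := by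
    rcases hcase with ⟨h1, h2, -⟩ | ⟨h1, h2, -⟩
    · rw [h1, h2]; exact (hum τ hτ1 hτM).2
    · rw [h1, h2]; exact (hup τ hτ1 hτM).2
  rcases eq_or_ne ω 0 with rfl | hω
  · -- level `0`: nothing has been harvested
    have he0 : e = 0 := by rw [← he, levelEnergy_zero]
    have hS : spent L p τ ≤ 0 := by
      rcases hcase with ⟨-, -, h, -⟩ | ⟨h1, -, -⟩
      · exact absurd h (lt_irrefl _)
      · rw [← he0, h1]; exact hp.le_harvested τ hτ1 hτM
    have hS0 : spent L p τ = 0 := le_antisymm hS (spent_nonneg hL hp.nonneg hτM)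
    refine ⟨hS0.trans he0.symm, fun i hi => ?_⟩
    have h1 := (Finset.sum_eq_zero_iff_of_nonneg (fun j hj =>
      have hj' := Finset.mem_range.1 hj
      mul_nonneg (hp.nonneg j (by omega)) (hL j (by omega)).le)).1 hS0 i (Finset.mem_range.2 hi)
    rw [ENNReal.inv_zero, gInv_top]
    exact (mul_eq_zero.1 h1).resolve_right (hL i (by omega)).ne'
  have hS : spent L p τ = e := by
    rcases hcase with ⟨h1, -, -, n, hn1, hn2, hn3, hn4⟩ | ⟨h1, -, n, hn1, hn2, hn3, hn4⟩
    · refine le_antisymm ?_ (h1 ▸ hp.mustUse_le τ hτ1 hτM)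
      rw [← he]
      refine hp.spent_le_of_level hL hg hω hωtop (s₀ := 0) (t₀ := n) hn2 hzero.ge ?_
        (fun m h2 h3 => hCle m h2 (by omega) (hn4 m h2 h3)) (Nat.zero_le _) hn1.le
      have h3 := levelEnergy_mono (hL' n hn2) (hg' n hn2) hn3 hωtop
      rw [(hup n (by omega) hn2).2] at h3
      exact (hp.le_harvested n (by omega) hn2).trans h3
    · refine le_antisymm (h1 ▸ hp.le_harvested τ hτ1 hτM) ?_
      rw [← he]
      refine hp.level_le_spent hL hg hω hωtop (s₀ := 0) (t₀ := n) hn2 hzero.le ?_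
        (fun m h2 h3 => hleA m h2 (by omega) (hn4 m h2 h3)) (Nat.zero_le _) hn1
      have h3 := levelEnergy_mono (hL' n hn2) (hg' n hn2) hn3 (hum n (by omega) hn2).1
      rw [(hum n (by omega) hn2).2] at h3
      exact h3.trans (hp.mustUse_le n (by omega) hn2)
  have heq : ∀ m, m ≤ τ → spent L p m = levelEnergy L g m ω := fun m hm =>
    le_antisymm
      (hp.spent_le_of_level hL hg hω hωtop hτM hzero.ge (by rw [hS, he])
        (fun j h1 h2 => hCle j h1 (by omega) (hlev j h1 h2.le).1) (Nat.zero_le m) hm)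
      (hp.level_le_spent hL hg hω hωtop hτM hzero.le (by rw [hS, he])
        (fun j h1 h2 => hleA j h1 (by omega) (hlev j h1 h2.le).2) (Nat.zero_le m) hm)
  refine ⟨hS, fun i hi => ?_⟩
  have h1 := heq (i + 1) hi
  have h2 := heq i hi.le
  rw [spent_succ, levelEnergy, Finset.sum_range_succ, h2, levelEnergy] at h1
  exact mul_right_cancel₀ (hL i (by omega)).ne' (add_left_cancel h1)

/-- String tautening computes the taut schedule, which is therefore unique. -/
theorem IsTaut.scheduleLoop_eq (fuel : ℕ) : ∀ {M : ℕ} {a L : ℕ → ℝ} {g : ℕ → ℝ → ℝ} {p : ℕ → ℝ},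
    IsTaut B M a L g p → M ≤ fuel → (∀ i < M, 0 < L i) → (∀ i < M, IsMarginal (g i)) →
    (1 ≤ M → a M = B) → ∀ i < M, scheduleLoop B fuel M a L g i = p i := by
  induction fuel with
  | zero => intro M a L g p hp hM _ _ _ i hi; omega
  | succ fuel ih =>
    intro M a L g p hp hMf hL hg haM i hi
    have hM : 1 ≤ M := by omega
    have hle : ∀ m, 1 ≤ m → m ≤ M →
        waterLevel L g m (mustUse B a m) ≤ waterLevel L g m (harvested a m) := fun m h1 h2 =>
      waterLevel_mono h1 (fun j hj => hL j (by omega)) (fun j hj => hg j (by omega))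
        (le_max_right _ _) ((hp.mustUse_le m h1 h2).trans (hp.le_harvested m h1 h2))
    have hc := firstChange_spec B M a L g hM hle (hp.mustUse_last hL hM (haM hM))
    rw [scheduleLoop, if_neg (by omega)]
    obtain ⟨hS, hhead⟩ := hp.eq_level hL hg hc
    have hτ1 := hc.1
    have hτM := hc.2.1
    split_ifs with h
    · exact (hhead i h).symm
    · have h1 := ih (hp.tail hL hτM hS) (by omega) (fun j hj => hL _ (by omega))
        (fun j hj => hg _ (by omega)) (fun h2 => ?_) (i - (firstChange B M a L g).1) (by omega)
      · rw [h1]; congr 1; omega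
      · refine Eq.trans ?_ (haM hM)
        obtain ⟨j, hj⟩ : ∃ j, M - (firstChange B M a L g).1 = j + 1 :=
          ⟨M - (firstChange B M a L g).1 - 1, by omega⟩
        rw [hj, remaining]
        congr 1; omega

theorem IsTaut.schedule_eq (hp : IsTaut B M a L g p) (hL : ∀ i < M, 0 < L i)
    (hg : ∀ i < M, IsMarginal (g i)) (haM : a M = B) : ∀ i < M, schedule B M a L g i = p i :=
  hp.scheduleLoop_eq M le_rfl hL hg fun _ => haM

end Tautening

end EHMAC

namespace EHMAC

/-! ### Covariances with given powers -/

namespace System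

variable {K N Nt Nr : ℕ} {S : System K N Nt Nr}

/-- Covariances of unit power of one user. -/
def unitCov (Nt : ℕ) : Set (Matrix (Fin Nt) (Fin Nt) ℂ) := {U | U.PosSemidef ∧ U.trace = 1}

/-- As the image of the sphere of the Frobenius norm under `C ↦ C† C`, the set of covariances of
unit power is compact. -/
theorem isCompact_unitCov (Nt : ℕ) : IsCompact (unitCov Nt) := by
  set B : Set (Matrix (Fin Nt) (Fin Nt) ℂ) := {C | (Cᴴ * C).trace = 1} with hB
  have hcont : Continuous fun C : Matrix (Fin Nt) (Fin Nt) ℂ => Cᴴ * C := by fun_prop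
  have hball : IsCompact (Set.pi univ fun _ : Fin Nt => Set.pi univ fun _ : Fin Nt =>
      Metric.closedBall (0 : ℂ) 1) :=
    isCompact_univ_pi fun _ => isCompact_univ_pi fun _ => isCompact_closedBall _ _
  have hBc : IsCompact B := by
    refine hball.of_isClosed_subset (isClosed_eq hcont.matrix_trace continuous_const) ?_
    intro (C : Matrix (Fin Nt) (Fin Nt) ℂ) hC i _ j _
    have h1 : (Cᴴ * C).trace.re = ∑ j, ∑ i, ‖C i j‖ ^ 2 := by
      simp only [Matrix.trace, Matrix.diag_apply, Matrix.mul_apply, Matrix.conjTranspose_apply,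
        Complex.re_sum, RCLike.star_def, Complex.conj_mul']
      norm_cast
    have h2 : (Cᴴ * C).trace = 1 := hC
    rw [h2, Complex.one_re] at h1
    have h3 : ‖C i j‖ ^ 2 ≤ ∑ i, ‖C i j‖ ^ 2 :=
      Finset.single_le_sum (f := fun i => ‖C i j‖ ^ 2) (fun _ _ => sq_nonneg _) (Finset.mem_univ i)
    have h4 : ∑ i, ‖C i j‖ ^ 2 ≤ ∑ j, ∑ i, ‖C i j‖ ^ 2 :=
      Finset.single_le_sum (f := fun j => ∑ i, ‖C i j‖ ^ 2)
        (fun _ _ => Finset.sum_nonneg fun _ _ => sq_nonneg _) (Finset.mem_univ j)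
    rw [mem_closedBall_zero_iff]
    exact (sq_le_one_iff₀ (norm_nonneg _)).1 (by linarith)
  have : unitCov Nt = (fun C : Matrix (Fin Nt) (Fin Nt) ℂ => Cᴴ * C) '' B := by
    ext U
    constructor
    · rintro ⟨h1, h2⟩
      obtain ⟨C, rfl⟩ := exists_eq_conjTranspose_mul_self h1
      exact ⟨C, h2, rfl⟩
    · rintro ⟨C, hC, rfl⟩
      exact ⟨Matrix.posSemidef_conjTranspose_mul_self C, hC⟩
  rw [this]
  exact hBc.image hcont

/-- The isotropic covariance of unit power. -/
noncomputable def isotropic (Nt : ℕ) : Matrix (Fin Nt) (Fin Nt) ℂ := (Nt : ℝ)⁻¹ • 1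

theorem isotropic_mem (hNt : Nt ≠ 0) : isotropic Nt ∈ unitCov Nt := by
  refine ⟨Matrix.PosSemidef.one.smul (by positivity), ?_⟩
  rw [isotropic, Matrix.trace_smul, Matrix.trace_one, Fintype.card_fin, Complex.real_smul]
  push_cast
  exact inv_mul_cancel₀ (by exact_mod_cast hNt)

theorem antennas_ne_zero {k : Fin K} (hH : S.H k ≠ 0) : Nt ≠ 0 := by
  rintro rfl
  exact hH (by ext i j; exact j.elim0)

theorem mul_isotropic_ne_zero {k : Fin K} (hH : S.H k ≠ 0) :
    S.H k * isotropic Nt * (S.H k)ᴴ ≠ 0 := by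
  have h0 : (Nt : ℝ)⁻¹ ≠ 0 := inv_ne_zero (Nat.cast_ne_zero.2 (antennas_ne_zero hH))
  rw [isotropic, Matrix.mul_smul, Matrix.mul_one, Matrix.smul_mul]
  exact smul_ne_zero h0 fun h => hH (Matrix.self_mul_conjTranspose_eq_zero.1 h)

/-- Covariances with the powers `P` and the normalized covariances `U`. -/
noncomputable def alloc (P : Fin K → ℝ) (U : Cov K Nt) : Cov K Nt := fun k => P k • U k

theorem alloc_mem {P : Fin K → ℝ} (hP : 0 ≤ P) {U : Cov K Nt} (hU : ∀ k, U k ∈ unitCov Nt) :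
    alloc P U ∈ covFeasible P := fun k =>
  ⟨(hU k).1.smul (hP k), by rw [alloc, Matrix.trace_smul, (hU k).2, Complex.real_smul, mul_one]⟩

theorem covFeasible_subset_psd (P : Fin K → ℝ) : covFeasible P ⊆ psd K Nt := fun _ hQ k => (hQ k).1

theorem exists_eq_alloc (hNt : Nt ≠ 0) {P : Fin K → ℝ} {Q : Cov K Nt} (hQ : Q ∈ covFeasible P) :
    ∃ U : Cov K Nt, (∀ k, U k ∈ unitCov Nt) ∧ Q = alloc P U := by
  have key : ∀ k, ∃ U ∈ unitCov Nt, Q k = P k • U := by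
    intro k
    obtain ⟨h1, h2⟩ := hQ k
    by_cases h0 : P k = 0
    · refine ⟨isotropic Nt, isotropic_mem hNt, ?_⟩
      rw [h0, Complex.ofReal_zero, h1.trace_eq_zero_iff] at h2
      rw [h0, h2, zero_smul]
    · have hpos : 0 ≤ P k := by
        have := h1.trace_nonneg
        rw [h2] at this
        exact_mod_cast this
      refine ⟨(P k)⁻¹ • Q k, ⟨h1.smul (inv_nonneg.2 hpos), ?_⟩, ?_⟩
      · rw [Matrix.trace_smul, h2, Complex.real_smul, ← Complex.ofReal_mul, inv_mul_cancel₀ h0,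
          Complex.ofReal_one]
      · rw [smul_smul, mul_inv_cancel₀ h0, one_smul]
  choose U hU hQU using key
  exact ⟨U, hU, funext hQU⟩

theorem isCompact_unitCovs (K Nt : ℕ) : IsCompact {U : Cov K Nt | ∀ k, U k ∈ unitCov Nt} := by
  have h := isCompact_univ_pi fun _ : Fin K => isCompact_unitCov Nt
  have h' : (Set.pi univ fun _ : Fin K => unitCov Nt) = {U : Cov K Nt | ∀ k, U k ∈ unitCov Nt} := by
    ext U; simp [Set.mem_pi]
  rwa [h'] at h

theorem continuous_alloc : Continuous fun x : (Fin K → ℝ) × Cov K Nt => alloc x.1 x.2 :=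
  continuous_pi fun k => ((continuous_apply k).comp continuous_fst).smul
    ((continuous_apply k).comp continuous_snd)

theorem exists_antitone_perm (w : Fin K → ℝ) :
    ∃ π : Equiv.Perm (Fin K), Antitone fun k => w (π k) := by
  refine ⟨Tuple.sort fun k => -w k, fun i j hij => ?_⟩
  have := Tuple.monotone_sort (fun k => -w k) hij
  simpa using this

theorem update_nonneg {P : Fin K → ℝ} (hP : 0 ≤ P) (k : Fin K) {y : ℝ} (hy : 0 ≤ y) :
    0 ≤ Function.update P k y := fun j => by
  by_cases h : j = k
  · subst h; simpa using hy
  · simpa [h] using hP j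

/-- Every problem in the covariances with given powers has a solution. -/
theorem exists_solvesCov (hH : ∀ k, S.H k ≠ 0) (π : Equiv.Perm (Fin K)) {P : Fin K → ℝ}
    (hP : 0 ≤ P) : ∃ Q, S.SolvesCov π P Q := by
  have hne : {U : Cov K Nt | ∀ k, U k ∈ unitCov Nt}.Nonempty :=
    ⟨fun _ => isotropic Nt, fun k => isotropic_mem (antennas_ne_zero (hH k))⟩
  have hcont : ContinuousOn (fun U : Cov K Nt => S.covObjective π (alloc P U))
      {U : Cov K Nt | ∀ k, U k ∈ unitCov Nt} :=
    (continuousOn_covObjective π).comp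
      (continuous_alloc.comp (continuous_const.prodMk continuous_id)).continuousOn
      fun U hU => covFeasible_subset_psd P (alloc_mem hP hU)
  obtain ⟨U, hU, hmax⟩ := (isCompact_unitCovs K Nt).exists_isMaxOn hne hcont
  refine ⟨alloc P U, alloc_mem hP hU, fun Q hQ => ?_⟩
  rcases isEmpty_or_nonempty (Fin K) with h | ⟨⟨k⟩⟩
  · exact (congrArg (S.covObjective π) (Subsingleton.elim Q _)).le
  · obtain ⟨V, hV, rfl⟩ := exists_eq_alloc (antennas_ne_zero (hH k)) hQ
    exact hmax hV

section

variable (hH : ∀ k, S.H k ≠ 0) (hw : ∀ k, 0 < S.w k) {π : Equiv.Perm (Fin K)}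
  (hπ : Antitone fun k => S.w (π k))

include hH hw hπ

/-- The largest weighted sum of rates is the optimal value of the covariance problem: unused
power may be radiated isotropically, and the greedy corner of the rate region attains the
objective. -/
theorem SolvesCov.isGreatest {P : Fin K → ℝ} {Q : Cov K Nt} (hQ : S.SolvesCov π P Q) :
    IsGreatest ((fun r => ∑ k, S.w k * r k) '' S.capacityRegion P) (S.covObjective π Q) := by
  have hpsd := covFeasible_subset_psd P hQ.1
  refine ⟨⟨S.corner π Q, ⟨Q, fun k => ⟨hpsd k, ?_⟩, corner_mem_rateRegion π hpsd⟩,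
    weighted_sum_corner π Q⟩, ?_⟩
  · rw [(hQ.1 k).2, Complex.ofReal_re]
  · rintro _ ⟨r, ⟨Q', hQ', hr⟩, rfl⟩
    refine (weighted_sum_le hw hπ hr).trans ?_
    set D : Cov K Nt := fun k => (P k - (Q' k).trace.re) • isotropic Nt
    have hD : D ∈ psd K Nt := fun k =>
      (isotropic_mem (antennas_ne_zero (hH k))).1.smul (sub_nonneg.2 (hQ' k).2)
    refine (covObjective_le_add hw hπ (fun k => (hQ' k).1) hD).trans (hQ.2 fun k => ?_)
    refine ⟨(hQ' k).1.add (hD k), ?_⟩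
    have him : (Q' k).trace = ((Q' k).trace.re : ℂ) :=
      Complex.ext rfl (by simpa using (Complex.nonneg_iff.1 (hQ' k).1.trace_nonneg).2.symm)
    simp only [D, Pi.add_apply]
    rw [Matrix.trace_add, Matrix.trace_smul, (isotropic_mem (antennas_ne_zero (hH k))).2,
      Complex.real_smul, mul_one]
    nth_rewrite 1 [him]
    rw [← Complex.ofReal_add, add_sub_cancel]

theorem SolvesCov.R_eq {P : Fin K → ℝ} {Q : Cov K Nt} (hQ : S.SolvesCov π P Q) :
    S.R P = S.covObjective π Q := (hQ.isGreatest hH hw hπ).csSup_eq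

theorem weighted_sum_le_R {P : Fin K → ℝ} (hP : 0 ≤ P) {r : Fin K → ℝ}
    (hr : r ∈ S.capacityRegion P) : ∑ k, S.w k * r k ≤ S.R P := by
  obtain ⟨Q, hQ⟩ := exists_solvesCov hH π hP
  rw [hQ.R_eq hH hw hπ]
  exact (hQ.isGreatest hH hw hπ).2 ⟨r, hr, rfl⟩

theorem covObjective_le_R {P : Fin K → ℝ} (hP : 0 ≤ P) {Q : Cov K Nt} (hQ : Q ∈ covFeasible P) :
    S.covObjective π Q ≤ S.R P := by
  obtain ⟨Q', hQ'⟩ := exists_solvesCov hH π hP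
  rw [hQ'.R_eq hH hw hπ]
  exact hQ'.2 hQ

end

section

variable (hH : ∀ k, S.H k ≠ 0) (hw : ∀ k, 0 < S.w k)

include hH hw

/-! ### The weighted sum-rate as a function of the powers -/

theorem continuousOn_R : ContinuousOn S.R {P | 0 ≤ P} := by
  obtain ⟨π, hπ⟩ := exists_antitone_perm S.w
  rw [continuousOn_iff_continuous_domRestrict]
  have : CompactSpace {U : Cov K Nt | ∀ k, U k ∈ unitCov Nt} :=
    isCompact_iff_compactSpace.1 (isCompact_unitCovs K Nt)
  have hcont : Continuous ↿(fun (P : {P : Fin K → ℝ | 0 ≤ P})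
      (U : {U : Cov K Nt | ∀ k, U k ∈ unitCov Nt}) => S.covObjective π (alloc P.1 U.1)) :=
    (continuousOn_covObjective π).comp_continuous
      (continuous_alloc.comp ((continuous_subtype_val.comp continuous_fst).prodMk
        (continuous_subtype_val.comp continuous_snd)))
      fun x => covFeasible_subset_psd _ (alloc_mem x.1.2 x.2.2)
  refine (isCompact_univ.continuous_sSup hcont).congr fun P => ?_
  obtain ⟨Q, hQ⟩ := exists_solvesCov hH π P.2
  rw [domRestrict_apply, hQ.R_eq hH hw hπ]
  refine IsGreatest.csSup_eq ⟨?_, ?_⟩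
  · rcases isEmpty_or_nonempty (Fin K) with h | ⟨⟨k⟩⟩
    · exact ⟨⟨Q, fun k => (h.false k).elim⟩, mem_univ _,
        congrArg (S.covObjective π) (Subsingleton.elim _ _)⟩
    · obtain ⟨V, hV, rfl⟩ := exists_eq_alloc (antennas_ne_zero (hH k)) hQ.1
      exact ⟨⟨V, hV⟩, mem_univ _, rfl⟩
  · rintro _ ⟨U, -, rfl⟩
    exact hQ.2 (alloc_mem P.2 U.2)

theorem R_nonneg {P : Fin K → ℝ} (hP : 0 ≤ P) : 0 ≤ S.R P := by
  obtain ⟨π, hπ⟩ := exists_antitone_perm S.w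
  obtain ⟨Q, hQ⟩ := exists_solvesCov hH π hP
  rw [hQ.R_eq hH hw hπ, covObjective_eq]
  refine Finset.sum_nonneg fun k _ => mul_nonneg (increment_nonneg hw hπ k) ?_
  rw [← logDet_empty (S := S) Q]
  exact logDet_mono (Finset.empty_subset _) (covFeasible_subset_psd P hQ.1)

theorem R_strictMonoOn {P : Fin K → ℝ} (hP : 0 ≤ P) (k : Fin K) :
    StrictMonoOn (fun y => S.R (Function.update P k y)) (Ici 0) := by
  intro x hx y hy hxy
  obtain ⟨π, hπ⟩ := exists_antitone_perm S.w
  obtain ⟨Q, hQ⟩ := exists_solvesCov hH π (update_nonneg hP k hx)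
  have hNt := antennas_ne_zero (hH k)
  have hpsd := covFeasible_subset_psd _ hQ.1
  set D : Cov K Nt := Pi.single k ((y - x) • isotropic Nt) with hD
  have hDpsd : D ∈ psd K Nt := fun j => by
    by_cases h : j = k
    · subst h
      simpa [D] using (isotropic_mem hNt).1.smul (sub_pos.2 hxy).le
    · simpa [D, h] using Matrix.PosSemidef.zero
  simp only
  rw [hQ.R_eq hH hw hπ]
  refine (covObjective_lt_add hw hπ hpsd hDpsd (k := k) ?_).trans_le
    (covObjective_le_R hH hw hπ (update_nonneg hP k hy) fun j => ⟨(hpsd j).add (hDpsd j), ?_⟩)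
  · rw [hD, Pi.single_eq_same, Matrix.mul_smul, Matrix.smul_mul]
    exact smul_ne_zero (sub_pos.2 hxy).ne' (mul_isotropic_ne_zero (hH k))
  · rw [Pi.add_apply, Matrix.trace_add, (hQ.1 j).2]
    by_cases h : j = k
    · subst h
      rw [hD, Pi.single_eq_same, Matrix.trace_smul, (isotropic_mem hNt).2]
      simp
    · simp [D, h]

theorem R_pos {P : Fin K → ℝ} (hP : 0 ≤ P) {k : Fin K} (hk : 0 < P k) : 0 < S.R P := by
  have h := R_strictMonoOn hH hw hP k (mem_Ici.2 le_rfl) (mem_Ici.2 hk.le) hk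
  simp only [Function.update_eq_self] at h
  exact (R_nonneg hH hw (update_nonneg hP k le_rfl)).trans_lt h

/-- `R` is strictly concave in the power of each user: by strict monotonicity its values at two
powers differ, and so do the values of the covariance objective. -/
theorem R_strictConcaveOn {P : Fin K → ℝ} (hP : 0 ≤ P) (k : Fin K) :
    StrictConcaveOn ℝ (Ici 0) fun y => S.R (Function.update P k y) := by
  refine ⟨convex_Ici 0, fun x hx y hy hxy a b ha hb hab => ?_⟩
  obtain ⟨π, hπ⟩ := exists_antitone_perm S.w
  obtain ⟨Q, hQ⟩ := exists_solvesCov hH π (update_nonneg hP k hx)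
  obtain ⟨Q', hQ'⟩ := exists_solvesCov hH π (update_nonneg hP k hy)
  have hne := (R_strictMonoOn hH hw hP k).injOn.ne hx hy hxy
  simp only [smul_eq_mul] at hne ⊢
  rw [hQ.R_eq hH hw hπ, hQ'.R_eq hH hw hπ] at hne ⊢
  have hpsd := covFeasible_subset_psd _ hQ.1
  have hpsd' := covFeasible_subset_psd _ hQ'.1
  have hxy0 : 0 ≤ a * x + b * y := add_nonneg (mul_nonneg ha.le hx) (mul_nonneg hb.le hy)
  refine (covObjective_strictConcave hw hπ hpsd hpsd' hne ha hb hab).trans_le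
    (covObjective_le_R hH hw hπ (update_nonneg hP k hxy0)
      fun j => ⟨psd_convex hpsd hpsd' ha.le hb.le j, ?_⟩)
  rw [Pi.add_apply, Pi.smul_apply, Pi.smul_apply, Matrix.trace_add, Matrix.trace_smul,
    Matrix.trace_smul, (hQ.1 j).2, (hQ'.1 j).2]
  by_cases h : j = k
  · subst h; simp
  · simp only [ne_eq, h, not_false_eq_true, Function.update_of_ne, Complex.real_smul]
    rw [← add_mul, ← Complex.ofReal_add, hab, Complex.ofReal_one, one_mul]

omit hH in
/-- At a solution of the covariance problem no direction within the constraint set is one of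
ascent. -/
theorem SolvesCov.slope_nonpos {π : Equiv.Perm (Fin K)} (hπ : Antitone fun k => S.w (π k))
    {P : Fin K → ℝ} {Q Q' : Cov K Nt} (hQ : S.SolvesCov π P Q) (hQ' : Q' ∈ covFeasible P) :
    S.slope π Q (Q' - Q) ≤ 0 := by
  have hpsd := covFeasible_subset_psd _ hQ.1
  have hpsd' := covFeasible_subset_psd _ hQ'
  set γ : ℝ → Cov K Nt := fun t => (1 - t) • Q + t • Q' with hγ
  have hγ0 : γ 0 = Q := by simp [γ]
  have hγc : Continuous γ := by fun_prop
  have hγpsd : ∀ t ∈ Icc (0 : ℝ) 1, γ t ∈ psd K Nt := fun t ht =>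
    psd_convex hpsd hpsd' (sub_nonneg.2 ht.2) ht.1
  have hγP : ∀ t ∈ Icc (0 : ℝ) 1, γ t ∈ covFeasible P := fun t ht j => by
    refine ⟨hγpsd t ht j, ?_⟩
    simp only [hγ, Pi.add_apply, Pi.smul_apply]
    rw [Matrix.trace_add, Matrix.trace_smul, Matrix.trace_smul, (hQ.1 j).2, (hQ' j).2, ← add_smul,
      sub_add_cancel, one_smul]
  have hneg : ∀ t ∈ Ioc (0 : ℝ) 1, S.slope π (γ t) (Q' - Q) ≤ 0 := fun t ht => by
    have ht' : t ∈ Icc (0 : ℝ) 1 := ⟨ht.1.le, ht.2⟩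
    have h1 := covObjective_le_tangent hw hπ (hγpsd t ht') hpsd
    have h2 : S.covObjective π (γ t) ≤ S.covObjective π Q := hQ.2 (hγP t ht')
    have h3 : Q - γ t = -(t • (Q' - Q)) := by simp only [hγ]; module
    rw [h3, map_neg, map_smul, smul_eq_mul] at h1
    have h4 : t * S.slope π (γ t) (Q' - Q) ≤ 0 := by linarith
    exact nonpos_of_mul_nonpos_right h4 ht.1
  have hlim : Tendsto (fun t => S.slope π (γ t) (Q' - Q)) (𝓝[Ioc 0 1] 0)
      (𝓝 (S.slope π Q (Q' - Q))) := by
    have h1 : ContinuousOn (fun t => S.slope π (γ t) (Q' - Q)) (Icc 0 1) :=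
      (continuousOn_slope π (Q' - Q)).comp hγc.continuousOn hγpsd
    have h2 := h1 0 ⟨le_rfl, zero_le_one⟩
    rw [ContinuousWithinAt, hγ0] at h2
    exact h2.mono_left (nhdsWithin_mono _ Ioc_subset_Icc_self)
  have : (𝓝[Ioc (0 : ℝ) 1] 0).NeBot := by
    rw [nhdsWithin_Ioc_eq_nhdsGT one_pos]; infer_instance
  exact le_of_tendsto hlim (eventually_mem_nhdsWithin.mono hneg)

omit hH hw in
theorem slope_eq_sum (π : Equiv.Perm (Fin K)) (Q D : Cov K Nt) :
    S.slope π Q D = ∑ k, S.slope π Q (Pi.single k (D k)) := by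
  rw [← map_sum, Finset.univ_sum_single]

/-! ### Marginal rates -/

/-- First-order behaviour of `R` at `P`, on the boundary of the orthant too: its partial
derivatives, one-sided at `0`, form a supergradient. They are the slopes of the covariance
objective at a solution `Q` along the best covariances of unit power, with which `Q` itself can
be written, so that `y ↦ Q` with the `k`-th power replaced by `y` bounds `R` from below. -/
theorem exists_supergradient {P : Fin K → ℝ} (hP : 0 ≤ P) :
    ∃ d : Fin K → ℝ,
      (∀ k, HasDerivWithinAt (fun y => S.R (Function.update P k y)) (d k) (Ici 0) (P k)) ∧
      ∀ P', 0 ≤ P' → S.R P' ≤ S.R P + ∑ k, d k * (P' k - P k) := by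
  obtain ⟨π, hπ⟩ := exists_antitone_perm S.w
  obtain ⟨Q, hQ⟩ := exists_solvesCov hH π hP
  have hpsd := covFeasible_subset_psd _ hQ.1
  have hbest : ∀ k, ∃ U ∈ unitCov Nt, Q k = P k • U ∧
      ∀ V ∈ unitCov Nt, S.slope π Q (Pi.single k V) ≤ S.slope π Q (Pi.single k U) := by
    intro k
    have hNt := antennas_ne_zero (hH k)
    have hcont : Continuous fun V => S.slope π Q (Pi.single k V) :=
      (continuous_slope_apply π Q).comp (continuous_const.update k continuous_id)
    obtain ⟨V₀, hV₀, hmax⟩ := (isCompact_unitCov Nt).exists_isMaxOn ⟨_, isotropic_mem hNt⟩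
      hcont.continuousOn
    obtain ⟨U, hU, hQU⟩ := exists_eq_alloc hNt hQ.1
    rcases (hP k).eq_or_lt with h0 | h0
    · refine ⟨V₀, hV₀, ?_, fun V hV => hmax hV⟩
      rw [hQU, alloc, ← h0]; simp
    · refine ⟨U k, hU k, by rw [hQU, alloc], fun V hV => ?_⟩
      have hmem : alloc P (Function.update U k V) ∈ covFeasible P := alloc_mem hP fun j => by
        by_cases h : j = k
        · subst h; simpa using hV
        · simpa [h] using hU j
      have h1 := hQ.slope_nonpos hw hπ hmem
      have h2 : alloc P (Function.update U k V) - Q =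
          P k • (Pi.single k V - Pi.single k (U k) : Cov K Nt) := by
        ext1 j
        rw [hQU]
        by_cases h : j = k
        · subst h; simp [alloc, smul_sub]
        · simp [alloc, h]
      rw [h2, map_smul, map_sub, smul_eq_mul] at h1
      exact sub_nonpos.1 (nonpos_of_mul_nonpos_right h1 h0)
  choose U hU hQU hmax using hbest
  set d : Fin K → ℝ := fun k => S.slope π Q (Pi.single k (U k)) with hd
  have hsuper : ∀ P', 0 ≤ P' → S.R P' ≤ S.R P + ∑ k, d k * (P' k - P k) := by
    intro P' hP'
    obtain ⟨Q', hQ'⟩ := exists_solvesCov hH π hP'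
    rw [hQ'.R_eq hH hw hπ, hQ.R_eq hH hw hπ]
    refine (covObjective_le_tangent hw hπ hpsd (covFeasible_subset_psd _ hQ'.1)).trans
      (add_le_add_right ?_ _)
    rw [slope_eq_sum]
    refine Finset.sum_le_sum fun k _ => ?_
    obtain ⟨V, hV, hQV⟩ := exists_eq_alloc (antennas_ne_zero (hH k)) hQ'.1
    rw [Pi.sub_apply, hQU k, hQV, alloc, Pi.single_sub, map_sub, Pi.single_smul, Pi.single_smul,
      map_smul, map_smul, smul_eq_mul, smul_eq_mul]
    have := mul_le_mul_of_nonneg_left (hmax k (V k) (hV k)) (hP' k)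
    simp only [hd]
    linarith
  refine ⟨d, fun k => ?_, hsuper⟩
  -- replacing the power of user `k` by `y` in `Q` gives a lower bound that touches `R`
  set q : ℝ → Cov K Nt := fun y => Function.update Q k (y • U k) with hq
  have hqP : q (P k) = Q := by rw [hq]; simp only; rw [← hQU, Function.update_eq_self]
  have hqc : Continuous q := continuous_const.update k (continuous_id.smul continuous_const)
  have hqmem : ∀ y ∈ Ici (0 : ℝ), q y ∈ covFeasible (Function.update P k y) := fun y hy j => by
    by_cases h : j = k
    · subst h
      simp only [hq, Function.update_self]
      exact ⟨(hU j).1.smul hy, by rw [Matrix.trace_smul, (hU j).2, Complex.real_smul, mul_one]⟩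
    · simpa [hq, h] using hQ.1 j
  have hlow : ∀ y ∈ Ici (0 : ℝ), (y - P k) * S.slope π (q y) (Pi.single k (U k)) ≤
      S.R (Function.update P k y) - S.R P := fun y hy => by
    have h1 := covObjective_le_tangent hw hπ (covFeasible_subset_psd _ (hqmem y hy)) hpsd
    have h2 := covObjective_le_R hH hw hπ (update_nonneg hP k hy) (hqmem y hy)
    have h3 : Q - q y = (P k - y) • (Pi.single k (U k) : Cov K Nt) := by
      ext1 j
      by_cases h : j = k
      · subst h; simp [hq, hQU j, sub_smul]
      · simp [hq, h]
    rw [h3, map_smul, smul_eq_mul] at h1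
    rw [hQ.R_eq hH hw hπ]
    linarith
  have hupp : ∀ y ∈ Ici (0 : ℝ), S.R (Function.update P k y) - S.R P ≤ (y - P k) * d k :=
    fun y hy => by
      have h1 := hsuper _ (update_nonneg hP k hy)
      rw [Finset.sum_eq_single k (fun j _ hj => by simp [hj]) (by simp), Function.update_self] at h1
      linarith
  have hlim : Tendsto (fun y => S.slope π (q y) (Pi.single k (U k))) (𝓝[Ici 0] (P k)) (𝓝 (d k)) := by
    have h1 : ContinuousOn (fun y => S.slope π (q y) (Pi.single k (U k))) (Ici 0) :=
      (continuousOn_slope π _).comp hqc.continuousOn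
        fun y hy => covFeasible_subset_psd _ (hqmem y hy)
    have h2 := h1 (P k) (hP k)
    rwa [ContinuousWithinAt, hqP] at h2
  rw [hasDerivWithinAt_iff_isLittleO, Asymptotics.isLittleO_iff]
  intro c hc
  filter_upwards [hlim (Metric.ball_mem_nhds _ hc), self_mem_nhdsWithin] with y hy hy0
  have h1 := hlow y hy0
  have h2 := hupp y hy0
  rw [mem_preimage, Metric.mem_ball, Real.dist_eq] at hy
  rw [Function.update_eq_self, smul_eq_mul, Real.norm_eq_abs, Real.norm_eq_abs,
    abs_of_nonpos (by linarith)]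
  calc -(S.R (Function.update P k y) - S.R P - (y - P k) * d k)
      ≤ -((y - P k) * (S.slope π (q y) (Pi.single k (U k)) - d k)) := by linarith
    _ ≤ |(y - P k) * (S.slope π (q y) (Pi.single k (U k)) - d k)| := neg_le_abs _
    _ = |y - P k| * |S.slope π (q y) (Pi.single k (U k)) - d k| := abs_mul _ _
    _ ≤ |y - P k| * c := mul_le_mul_of_nonneg_left hy.le (abs_nonneg _)
    _ = c * |y - P k| := mul_comm _ _

theorem marginal_supergradient {P : Fin K → ℝ} (hP : 0 ≤ P) :
    (∀ k, HasDerivWithinAt (fun y => S.R (Function.update P k y)) (S.marginal k P (P k)) (Ici 0)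
      (P k)) ∧
    ∀ P', 0 ≤ P' → S.R P' ≤ S.R P + ∑ k, S.marginal k P (P k) * (P' k - P k) := by
  obtain ⟨d, hd, h⟩ := exists_supergradient hH hw hP
  have : ∀ k, S.marginal k P (P k) = d k := fun k =>
    (hd k).derivWithin (uniqueDiffOn_Ici 0 _ (hP k))
  simp only [this]
  exact ⟨hd, h⟩

omit hH hw in
theorem marginal_update (k : Fin K) (P : Fin K → ℝ) (y : ℝ) :
    S.marginal k (Function.update P k y) = S.marginal k P := by
  funext x
  simp only [marginal, Function.update_idem]

theorem hasDerivWithinAt_R {P : Fin K → ℝ} (hP : 0 ≤ P) (k : Fin K) {x : ℝ} (hx : 0 ≤ x) :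
    HasDerivWithinAt (fun y => S.R (Function.update P k y)) (S.marginal k P x) (Ici 0) x := by
  have h := (marginal_supergradient hH hw (update_nonneg hP k hx)).1 k
  simpa only [Function.update_idem, Function.update_self, marginal_update] using h

theorem R_update_le {P : Fin K → ℝ} (hP : 0 ≤ P) (k : Fin K) {x y : ℝ} (hx : 0 ≤ x) (hy : 0 ≤ y) :
    S.R (Function.update P k y) ≤ S.R (Function.update P k x) + S.marginal k P x * (y - x) := by
  have h := (marginal_supergradient hH hw (update_nonneg hP k hx)).2 _
    (update_nonneg hP k hy)
  rw [Finset.sum_eq_single k (fun j _ hj => by simp [hj]) (by simp)] at h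
  simpa only [Function.update_self, marginal_update] using h

/-- `R` grows more slowly than every linear function of the power of a user. -/
theorem exists_R_update_le_linear {P : Fin K → ℝ} (hP : 0 ≤ P) (k : Fin K) {β : ℝ} (hβ : 0 < β) :
    ∃ α, ∀ y, 0 ≤ y → S.R (Function.update P k y) ≤ α + β * y := by
  obtain ⟨π, hπ⟩ := exists_antitone_perm S.w
  have hNt := antennas_ne_zero (hH k)
  have hcont : ∀ j, Continuous fun U : Matrix (Fin Nt) (Fin Nt) ℂ =>
      (S.H j * U * (S.H j)ᴴ).trace.re := fun j =>
    Complex.continuous_re.comp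
      ((continuous_const.matrix_mul continuous_id).matrix_mul continuous_const).matrix_trace
  have hb : ∀ j, ∃ b, ∀ U ∈ unitCov Nt, (S.H j * U * (S.H j)ᴴ).trace.re ≤ b := fun j => by
    obtain ⟨V, -, hmax⟩ := (isCompact_unitCov Nt).exists_isMaxOn ⟨_, isotropic_mem hNt⟩
      (hcont j).continuousOn
    exact ⟨_, fun U hU => hmax hU⟩
  choose b hb using hb
  have hb0 : ∀ j, 0 ≤ b j := fun j => by
    refine le_trans ?_ (hb j _ (isotropic_mem hNt))
    exact (Complex.nonneg_iff.1
      ((isotropic_mem hNt).1.mul_mul_conjTranspose_same (S.H j)).trace_nonneg).1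
  set w := ∑ j, S.increment π j with hwdef
  have hw0 : 0 ≤ w := Finset.sum_nonneg fun j _ => increment_nonneg hw hπ j
  obtain ⟨c, hc, hcβ⟩ : ∃ c : ℝ, 0 < c ∧ w * b k / c ≤ β :=
    ⟨w * b k / β + 1, add_pos_of_nonneg_of_pos (div_nonneg (mul_nonneg hw0 (hb0 k)) hβ.le) one_pos,
      by
        rw [div_le_iff₀ (add_pos_of_nonneg_of_pos
          (div_nonneg (mul_nonneg hw0 (hb0 k)) hβ.le) one_pos), mul_add, mul_div_cancel₀ _ hβ.ne']
        linarith⟩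
  refine ⟨w * ((Nr + ∑ j, P j * b j) / c + Nr * (Real.log c - 1)), fun y hy => ?_⟩
  have hPy := update_nonneg hP k hy
  obtain ⟨Q, hQ⟩ := exists_solvesCov hH π hPy
  have hpsd := covFeasible_subset_psd _ hQ.1
  obtain ⟨U, hU, hQU⟩ := exists_eq_alloc hNt hQ.1
  have htr : ∀ A, (S.recv A Q).trace.re ≤ ∑ j, P j * b j + y * b k := fun A => by
    rw [recv_apply, Matrix.trace_sum, Complex.re_sum]
    have h1 : ∀ j, (S.H j * Q j * (S.H j)ᴴ).trace.re ≤ Function.update P k y j * b j := fun j => by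
      rw [hQU, alloc, Matrix.mul_smul, Matrix.smul_mul, Matrix.trace_smul, Complex.smul_re,
        smul_eq_mul]
      exact mul_le_mul_of_nonneg_left (hb j _ (hU j)) (hPy j)
    have h2 : ∀ j, Function.update P k y j * b j ≤ P j * b j + if j = k then y * b k else 0 :=
      fun j => by
        by_cases h : j = k
        · subst h
          simpa using mul_nonneg (hP j) (hb0 j)
        · simp [h]
    calc ∑ j ∈ A, (S.H j * Q j * (S.H j)ᴴ).trace.re
        ≤ ∑ j ∈ A, Function.update P k y j * b j := Finset.sum_le_sum fun j _ => h1 j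
      _ ≤ ∑ j, Function.update P k y j * b j :=
          Finset.sum_le_univ_sum_of_nonneg fun j => mul_nonneg (hPy j) (hb0 j)
      _ ≤ ∑ j, (P j * b j + if j = k then y * b k else 0) := Finset.sum_le_sum fun j _ => h2 j
      _ = ∑ j, P j * b j + y * b k := by
          rw [Finset.sum_add_distrib, Finset.sum_ite_eq' Finset.univ k, if_pos (Finset.mem_univ k)]
  have hlog : ∀ A, S.logDet A Q ≤
      (Nr + ∑ j, P j * b j) / c + y * b k / c + Nr * (Real.log c - 1) := fun A => by
    have h1 := log_det_le_trace_div (one_add_recv_posDef (S := S) A hpsd) hc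
    rw [Matrix.trace_add, Matrix.trace_one, Complex.add_re, Complex.natCast_re,
      Fintype.card_fin] at h1
    have h2 := div_le_div_of_nonneg_right (add_le_add_right (htr A) (Nr : ℝ)) hc.le
    rw [logDet_eq]
    refine h1.trans ?_
    rw [← add_div, add_assoc (Nr : ℝ)]
    linarith
  rw [hQ.R_eq hH hw hπ, covObjective_eq]
  calc ∑ j, S.increment π j * S.logDet (initial π (j + 1)) Q
      ≤ ∑ j, S.increment π j *
          ((Nr + ∑ j, P j * b j) / c + y * b k / c + Nr * (Real.log c - 1)) :=
        Finset.sum_le_sum fun j _ =>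
          mul_le_mul_of_nonneg_left (hlog _) (increment_nonneg hw hπ j)
    _ = w * ((Nr + ∑ j, P j * b j) / c + Nr * (Real.log c - 1)) + w * b k / c * y := by
        rw [← Finset.sum_mul]; ring
    _ ≤ _ := add_le_add_right (mul_le_mul_of_nonneg_right hcβ hy) _

/-- The marginal rates have the properties required by string tautening. By Darboux' theorem they
have no jumps. -/
theorem isMarginal_marginal {P : Fin K → ℝ} (hP : 0 ≤ P) (k : Fin K) :
    IsMarginal (S.marginal k P) where
  strictAnti := by
    intro x hx y hy hxy
    have hx0 : (0 : ℝ) ≤ x := hx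
    have hy0 : (0 : ℝ) ≤ y := hy
    have hm : 0 ≤ (1 / 2) * x + (1 / 2) * y := by positivity
    have h1 := (R_strictConcaveOn hH hw hP k).2 hx hy hxy.ne (by norm_num : (0 : ℝ) < 1 / 2)
      (by norm_num : (0 : ℝ) < 1 / 2) (by norm_num)
    simp only [smul_eq_mul] at h1
    have h2 := R_update_le hH hw hP k hx0 hm
    have h3 := R_update_le hH hw hP k hy0 hm
    have h4 : 0 < (S.marginal k P x - S.marginal k P y) * (y - x) := by linarith
    exact sub_pos.1 (pos_of_mul_pos_left h4 (sub_pos.2 hxy).le)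
  pos := by
    intro x hx
    have h1 := R_strictMonoOn hH hw hP k (mem_Ici.2 hx) (mem_Ici.2 (by linarith : 0 ≤ x + 1))
      (by linarith)
    have h2 := R_update_le hH hw hP k hx (by linarith : 0 ≤ x + 1)
    simp only at h1
    linarith
  surj := by
    intro y hy hy0
    obtain ⟨α, hα⟩ := exists_R_update_le_linear hH hw hP k (half_pos hy)
    set R₀ := S.R (Function.update P k 0)
    obtain ⟨p, hp, hpy⟩ : ∃ p : ℝ, 0 < p ∧ α - R₀ ≤ y / 2 * p :=
      ⟨|α - R₀| / (y / 2) + 1, by positivity, by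
        rw [mul_add, mul_div_cancel₀ _ (half_pos hy).ne']
        linarith [le_abs_self (α - R₀)]⟩
    have h1 := R_update_le hH hw hP k hp.le le_rfl
    have h2 := hα p hp.le
    have h3 : S.marginal k P p ≤ y := by
      have : S.marginal k P p * p ≤ y * p := by linarith
      exact le_of_mul_le_mul_right this hp
    have h4 := (ordConnected_Ici (a := (0 : ℝ))).image_hasDerivWithinAt
      (f' := S.marginal k P) fun x hx => hasDerivWithinAt_R hH hw hP k hx
    obtain ⟨q, hq, hqy⟩ := h4.out (mem_image_of_mem _ hp.le) (mem_image_of_mem _ (mem_Ici.2 le_rfl))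
      ⟨h3, hy0⟩
    exact ⟨q, hq, hqy⟩

end

end System

end EHMAC

namespace EHMAC

/-! ### Ascent methods on compact sets -/

section Ascent

variable {X : Type*} [MetricSpace X] {C O : Set X} {T : X → X} {V : X → ℝ}

/-- Convergence of an ascent method on a compact set `C`: a continuous map `T` of `C` that does
not decrease `V`, and increases it strictly outside of the set `O` of maximizers. -/
theorem ascent_converges (hC : IsCompact C) (hT : MapsTo T C C) (hTc : ContinuousOn T C)
    (hVc : ContinuousOn V C) (hle : ∀ x ∈ C, V x ≤ V (T x))
    (hO : O = {x | x ∈ C ∧ IsMaxOn V C x}) (hfix : ∀ x ∈ C, V (T x) = V x → x ∈ O) {x : X}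
    (hx : x ∈ C) :
    (∀ q, T^[q] x ∈ C) ∧ (Monotone fun q => V (T^[q] x)) ∧
    (∀ z ∈ O, Tendsto (fun q => V (T^[q] x)) atTop (𝓝 (V z))) ∧
    Tendsto (fun q => Metric.infDist (T^[q] x) O) atTop (𝓝 0) ∧
    (∀ z, MapClusterPt z atTop (fun q => T^[q] x) → z ∈ O) ∧
    (∀ z, O = {z} → Tendsto (fun q => T^[q] x) atTop (𝓝 z)) := by
  have hmem : ∀ q, T^[q] x ∈ C := fun q => by
    induction q with
    | zero => exact hx
    | succ q ih => rw [Function.iterate_succ_apply']; exact hT ih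
  have hmono : Monotone fun q => V (T^[q] x) := monotone_nat_of_le_succ fun q => by
    rw [Function.iterate_succ_apply']; exact hle _ (hmem q)
  have hbdd : BddAbove (range fun q => V (T^[q] x)) :=
    (hC.bddAbove_image hVc).mono (range_subset_iff.2 fun q => mem_image_of_mem _ (hmem q))
  have hlim := tendsto_atTop_ciSup hmono hbdd
  set c := ⨆ q, V (T^[q] x)
  have hub : ∀ (U : Ultrafilter ℕ), (U : Filter ℕ) ≤ atTop → ∀ z,
      Tendsto (fun q => T^[q] x) U (𝓝 z) → z ∈ O := by
    intro U hU z hz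
    have hzC : z ∈ C := hC.isClosed.mem_of_tendsto hz (Eventually.of_forall hmem)
    have hz' : Tendsto (fun q => T^[q] x) U (𝓝[C] z) :=
      tendsto_nhdsWithin_iff.2 ⟨hz, Eventually.of_forall hmem⟩
    have h1 : Tendsto (fun q => V (T^[q] x)) U (𝓝 (V z)) := (hVc z hzC).tendsto.comp hz'
    have h2 : Tendsto (fun q => V (T (T^[q] x))) U (𝓝 (V (T z))) :=
      ((hVc.comp hTc hT) z hzC).tendsto.comp hz'
    have h3 : Tendsto (fun q => V (T (T^[q] x))) U (𝓝 c) := by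
      refine Tendsto.mono_left ?_ hU
      have := hlim.comp (tendsto_add_atTop_nat 1)
      refine this.congr fun q => ?_
      simp only [Function.comp_apply, Function.iterate_succ_apply']
    refine hfix z hzC ?_
    rw [tendsto_nhds_unique h2 h3, tendsto_nhds_unique h1 (hlim.mono_left hU)]
  have hcl : ∀ z, MapClusterPt z atTop (fun q => T^[q] x) → z ∈ O := fun z hz => by
    obtain ⟨U, hU, hUz⟩ := mapClusterPt_iff_ultrafilter.1 hz
    exact hub U hU z hUz
  -- every continuous function that is constant on `O` converges along the iterates
  have hgen : ∀ (h : X → ℝ) (b : ℝ), ContinuousOn h C → (∀ z ∈ O, h z = b) →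
      Tendsto (fun q => h (T^[q] x)) atTop (𝓝 b) := by
    intro h b hh hb
    refine (hC.image_of_continuousOn hh).tendsto_nhds_of_unique_mapClusterPt
      (Eventually.of_forall fun q => mem_image_of_mem _ (hmem q)) fun y _ hy => ?_
    obtain ⟨U, hU, hUy⟩ := mapClusterPt_iff_ultrafilter.1 hy
    obtain ⟨z, hzC, hz⟩ := hC.ultrafilter_le_nhds (U.map fun q => T^[q] x)
      (le_principal_iff.2 (Ultrafilter.mem_map.2 (univ_mem' hmem)))
    have hz1 : Tendsto (fun q => T^[q] x) U (𝓝 z) := hz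
    have hz' : Tendsto (fun q => T^[q] x) U (𝓝[C] z) :=
      tendsto_nhdsWithin_iff.2 ⟨hz1, Eventually.of_forall hmem⟩
    rw [← hb z (hub U hU z hz1)]
    exact tendsto_nhds_unique hUy ((hh z hzC).tendsto.comp hz')
  refine ⟨hmem, hmono, fun z hz => hgen V _ hVc fun y hy => ?_,
    hgen _ 0 (Metric.continuous_infDist_pt O).continuousOn fun z hz => Metric.infDist_zero_of_mem hz,
    hcl, fun z hz => ?_⟩
  · rw [hO] at hz hy
    exact le_antisymm (hz.2 hy.1) (hy.2 hz.1)
  · refine hC.tendsto_nhds_of_unique_mapClusterPt (Eventually.of_forall hmem) fun y _ hy => ?_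
    have := hcl y hy
    rwa [hz] at this

end Ascent

/-! ### Feasible allocations -/

theorem eventually_le_add_mul {A B c : ℝ} (h : A ≤ B) (h' : 0 ≤ c ∨ A < B) :
    ∀ᶠ ε in 𝓝[>] (0 : ℝ), A ≤ B + ε * c := by
  rcases h' with hc | hlt
  · filter_upwards [self_mem_nhdsWithin] with ε hε
    exact h.trans (le_add_of_nonneg_right (mul_nonneg (mem_Ioi.1 hε).le hc))
  · have h1 : Tendsto (fun ε : ℝ => B + ε * c) (𝓝 0) (𝓝 (B + 0 * c)) :=
      (continuous_const.add (continuous_id.mul continuous_const)).tendsto 0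
    rw [zero_mul, add_zero] at h1
    exact ((h1.mono_left nhdsWithin_le_nhds).eventually (lt_mem_nhds hlt)).mono fun _ h => h.le

theorem extend_apply {N : ℕ} {α : Type*} (x : Fin N → α) (d : α) (i : Fin N) :
    extend x d i = x i := by
  rw [extend, dif_pos i.2]

namespace System

variable {K N Nt Nr : ℕ} {S : System K N Nt Nr}

theorem sum_filter_eq_spent (S : System K N Nt Nr) (p : Fin N → ℝ) {n : ℕ} (hn : n ≤ N) :
    ∑ i : Fin N with i.val < n, p i * S.L i = spent (extend S.L 0) (extend p 0) n := by
  rw [spent, Finset.sum_filter]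
  have h1 : ∀ i : Fin N, (if i.val < n then p i * S.L i else 0) =
      (fun j : ℕ => if j < n then extend p 0 j * extend S.L 0 j else 0) i := fun i => by
    simp only [extend_apply]
  rw [Finset.sum_congr rfl fun i _ => h1 i, Fin.sum_univ_eq_sum_range
    (fun j : ℕ => if j < n then extend p 0 j * extend S.L 0 j else 0) N, ← Finset.sum_filter]
  congr 1
  ext j
  simp only [Finset.mem_filter, Finset.mem_range]
  omega

/-- Feasible powers of one user. -/
def userFeasible (S : System K N Nt Nr) (k : Fin K) : Set (Fin N → ℝ) :=
  {p | S.EnergyFeasible k p ∧ ∀ i, 0 ≤ p i}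

/-- The allocation `P` with the powers of user `k` replaced by `p`. -/
def setUser (P : Fin N → Fin K → ℝ) (k : Fin K) (p : Fin N → ℝ) : Fin N → Fin K → ℝ :=
  fun i => Function.update (P i) k (p i)

theorem mem_feasible_iff {P : Fin N → Fin K → ℝ} :
    P ∈ S.feasible ↔ ∀ k, (fun i => P i k) ∈ S.userFeasible k :=
  ⟨fun h k => ⟨h.1 k, fun i => h.2 i k⟩, fun h => ⟨fun k => (h k).1, fun i k => (h k).2 i⟩⟩

theorem nonneg_of_mem_feasible {P : Fin N → Fin K → ℝ} (hP : P ∈ S.feasible) (i : Fin N) :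
    0 ≤ P i := fun k => hP.2 i k

theorem setUser_mem {P : Fin N → Fin K → ℝ} (hP : P ∈ S.feasible) {k : Fin K} {p : Fin N → ℝ}
    (hp : p ∈ S.userFeasible k) : setUser P k p ∈ S.feasible := by
  rw [mem_feasible_iff] at hP ⊢
  intro j
  by_cases h : j = k
  · subst h; simpa [setUser] using hp
  · simpa [setUser, h] using hP j

theorem setUser_eq {P P' : Fin N → Fin K → ℝ} {k : Fin K} (h : ∀ i j, j ≠ k → P' i j = P i j) :
    setUser P k (fun i => P' i k) = P' := by
  ext i j
  by_cases hj : j = k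
  · subst hj; simp [setUser]
  · simp [setUser, hj, h i j hj]

theorem setUser_self (P : Fin N → Fin K → ℝ) (k : Fin K) : setUser P k (fun i => P i k) = P :=
  setUser_eq fun _ _ _ => rfl

theorem continuous_setUser (k : Fin K) :
    Continuous fun x : (Fin N → Fin K → ℝ) × (Fin N → ℝ) => setUser x.1 k x.2 :=
  continuous_pi fun i => ((continuous_apply i).comp continuous_fst).update k
    ((continuous_apply i).comp continuous_snd)

theorem energyFeasible_iff {k : Fin K} {p : Fin N → ℝ} :
    S.EnergyFeasible k p ↔ ∀ n, 1 ≤ n → n ≤ N →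
      mustUse (S.Emax k) (S.arrivals k) n ≤ spent (extend S.L 0) (extend p 0) n ∧
      spent (extend S.L 0) (extend p 0) n ≤ harvested (S.arrivals k) n := by
  refine forall_congr' fun n => forall_congr' fun _ => forall_congr' fun hn => ?_
  rw [S.sum_filter_eq_spent p hn, and_comm]

theorem isClosed_userFeasible (k : Fin K) : IsClosed (S.userFeasible k) := by
  have h1 : ∀ n, Continuous fun p : Fin N → ℝ => ∑ i : Fin N with i.val < n, p i * S.L i :=
    fun n => by fun_prop
  have h2 : S.userFeasible k = {p | S.EnergyFeasible k p} ∩ Ici 0 := by ext p; rfl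
  rw [h2]
  refine IsClosed.inter ?_ isClosed_Ici
  · have : {p | S.EnergyFeasible k p} = ⋂ n, ⋂ (_ : 1 ≤ n), ⋂ (_ : n ≤ N),
        {p : Fin N → ℝ | ∑ i : Fin N with i.val < n, p i * S.L i ≤ harvested (S.arrivals k) n ∧
          mustUse (S.Emax k) (S.arrivals k) n ≤ ∑ i : Fin N with i.val < n, p i * S.L i} := by
      ext p; simp [EnergyFeasible]
    rw [this]
    exact isClosed_iInter fun n => isClosed_iInter fun _ => isClosed_iInter fun _ =>
      (isClosed_le (h1 n) continuous_const).inter (isClosed_le continuous_const (h1 n))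

section

variable (hL : ∀ i, 0 < S.L i)

include hL

theorem extend_L_pos : ∀ i < N, 0 < extend S.L 0 i := fun i hi => by
  rw [extend, dif_pos hi]; exact hL _

theorem isCompact_userFeasible (k : Fin K) : IsCompact (S.userFeasible k) := by
  refine (isCompact_univ_pi fun i : Fin N =>
    isCompact_Icc (a := 0) (b := harvested (S.arrivals k) N / S.L i)).of_isClosed_subset
      (isClosed_userFeasible k) fun p hp i _ => ⟨hp.2 i, ?_⟩
  rw [le_div_iff₀ (hL i)]
  have h1 := (hp.1 N (by have := i.2; omega) le_rfl).1
  refine le_trans ?_ h1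
  exact Finset.single_le_sum (f := fun i => p i * S.L i)
    (fun j _ => mul_nonneg (hp.2 j) (hL j).le) (Finset.mem_filter.2 ⟨Finset.mem_univ i, i.2⟩)

theorem isCompact_feasible : IsCompact S.feasible := by
  have h1 : S.feasible = (fun (p : Fin K → Fin N → ℝ) i k => p k i) ''
      (Set.pi univ fun k => S.userFeasible k) := by
    ext P
    rw [mem_feasible_iff]
    constructor
    · intro h
      exact ⟨fun k i => P i k, fun k _ => h k, rfl⟩
    · rintro ⟨p, hp, rfl⟩ k
      exact hp k (mem_univ k)
  rw [h1]
  exact (isCompact_univ_pi fun k => isCompact_userFeasible hL k).image (by fun_prop)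

/-- Spending in each epoch what arrives at its start is feasible. -/
theorem feasible_nonempty (hE : ∀ i k, 0 ≤ S.E i k ∧ S.E i k ≤ S.Emax k) : S.feasible.Nonempty := by
  refine ⟨fun i k => S.E i k / S.L i, mem_feasible_iff.2 fun k =>
    ⟨energyFeasible_iff.2 fun n h1 h2 => ?_, fun i => div_nonneg (hE i k).1 (hL i).le⟩⟩
  have hsp : spent (extend S.L 0) (extend (fun i => S.E i k / S.L i) 0) n =
      harvested (S.arrivals k) n := by
    refine Finset.sum_congr rfl fun i hi => ?_
    have hi' : i < N := (Finset.mem_range.1 hi).trans_le h2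
    simp only [arrivals, extend, dif_pos hi']
    exact div_mul_cancel₀ _ (hL _).ne'
  rw [hsp]
  refine ⟨max_le ?_ (Finset.sum_nonneg fun i hi => ?_), le_rfl⟩
  · rw [harvested, Finset.sum_range_succ, ← harvested]
    have : S.arrivals k n ≤ S.Emax k := by
      rw [arrivals, extend]
      split_ifs with h
      · exact (hE _ k).2
      · exact le_rfl
    linarith
  · have hi' : i < N := (Finset.mem_range.1 hi).trans_le h2
    rw [arrivals, extend, dif_pos hi']
    exact (hE _ k).1

end

section

variable (hH : ∀ k, S.H k ≠ 0) (hw : ∀ k, 0 < S.w k)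

include hH hw

/-! ### Optimality of string tautening for one user -/

theorem continuousOn_W : ContinuousOn S.W {P | ∀ i, 0 ≤ P i} :=
  continuousOn_finsetSum _ fun i _ =>
    have h : MapsTo (fun P : Fin N → Fin K → ℝ => P i) {P | ∀ i, 0 ≤ P i} {p | 0 ≤ p} :=
      fun _ hP => hP i
    ((continuousOn_R hH hw).comp (continuous_apply i).continuousOn h).mul continuousOn_const

/-- First-order optimality: if no change of the powers of user `k` increases the throughput, its
derivative is not positive in any direction `v` that is admissible, which means that every
constraint that is tight holds to first order along `v`. -/
theorem sum_marginal_nonpos {P : Fin N → Fin K → ℝ} (hP : P ∈ S.feasible) {k : Fin K}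
    (hmax : ∀ p ∈ S.userFeasible k, S.W (setUser P k p) ≤ S.W P) (v : Fin N → ℝ)
    (hv : ∀ i, 0 ≤ v i ∨ 0 < P i k)
    (hC : ∀ n, 1 ≤ n → n ≤ N → 0 ≤ spent (extend S.L 0) (extend v 0) n ∨
      mustUse (S.Emax k) (S.arrivals k) n < spent (extend S.L 0) (extend (fun i => P i k) 0) n)
    (hA : ∀ n, 1 ≤ n → n ≤ N → spent (extend S.L 0) (extend v 0) n ≤ 0 ∨
      spent (extend S.L 0) (extend (fun i => P i k) 0) n < harvested (S.arrivals k) n) :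
    ∑ i, S.marginal k (P i) (P i k) * v i * S.L i ≤ 0 := by
  have hPn := nonneg_of_mem_feasible hP
  have hf := energyFeasible_iff.1 (hP.1 k)
  set p : ℝ → Fin N → ℝ := fun ε i => P i k + ε * v i with hp
  have hlin : ∀ ε n, n ≤ N → spent (extend S.L 0) (extend (p ε) 0) n =
      spent (extend S.L 0) (extend (fun i => P i k) 0) n +
        ε * spent (extend S.L 0) (extend v 0) n := fun ε n hn => by
    simp only [spent, Finset.mul_sum, ← Finset.sum_add_distrib]
    refine Finset.sum_congr rfl fun i hi => ?_
    have hi' : i < N := (Finset.mem_range.1 hi).trans_le hn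
    simp only [extend, dif_pos hi', hp]
    ring
  have hpos : ∀ᶠ ε in 𝓝[>] (0 : ℝ), ∀ i, 0 ≤ p ε i :=
    eventually_all.2 fun i => eventually_le_add_mul (hPn i k) (hv i)
  have hfeas : ∀ᶠ ε in 𝓝[>] (0 : ℝ), p ε ∈ S.userFeasible k := by
    have h1 : ∀ᶠ ε in 𝓝[>] (0 : ℝ), ∀ n ∈ Finset.range (N + 1), 1 ≤ n →
        mustUse (S.Emax k) (S.arrivals k) n ≤ spent (extend S.L 0) (extend (p ε) 0) n ∧
        spent (extend S.L 0) (extend (p ε) 0) n ≤ harvested (S.arrivals k) n := by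
      refine (eventually_all_finset _).2 fun n hn => ?_
      have hnN : n ≤ N := Nat.lt_succ_iff.1 (Finset.mem_range.1 hn)
      by_cases hn1 : 1 ≤ n
      · have h2 := eventually_le_add_mul (hf n hn1 hnN).1 (hC n hn1 hnN)
        have h3 := eventually_le_add_mul (neg_le_neg (hf n hn1 hnN).2)
          ((hA n hn1 hnN).imp neg_nonneg.2 neg_lt_neg)
        filter_upwards [h2, h3] with ε h4 h5 _
        rw [hlin ε n hnN]
        exact ⟨h4, by linarith⟩
      · exact Eventually.of_forall fun ε h => absurd h hn1
    filter_upwards [h1, hpos] with ε h2 h3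
    exact ⟨energyFeasible_iff.2 fun n hn1 hn2 =>
      h2 n (Finset.mem_range.2 (Nat.lt_succ_iff.2 hn2)) hn1, h3⟩
  have hderiv : HasDerivWithinAt (fun ε => S.W (setUser P k (p ε)))
      (∑ i, S.marginal k (P i) (P i k) * v i * S.L i) (Ioi 0) 0 := by
    have h1 : HasDerivWithinAt (fun ε => S.W (setUser P k (p ε)))
        (∑ i, S.marginal k (P i) (P i k) * v i * S.L i) {ε | ∀ i, 0 ≤ p ε i} 0 := by
      refine HasDerivWithinAt.fun_sum fun i _ => HasDerivWithinAt.mul_const ?_ _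
      have h2 : HasDerivWithinAt (fun ε => p ε i) (v i) {ε | ∀ i, 0 ≤ p ε i} 0 :=
        ((hasDerivAt_mul_const (v i)).const_add (P i k)).hasDerivWithinAt
      have h3 : p 0 i = P i k := by simp [hp]
      have h4 := hasDerivWithinAt_R hH hw (hPn i) k (hPn i k)
      rw [← h3] at h4
      have := h4.comp 0 h2 fun ε hε => hε i
      rwa [h3] at this
    exact h1.mono_of_mem_nhdsWithin hpos
  rw [hasDerivWithinAt_iff_tendsto_slope' (by simp)] at hderiv
  refine le_of_tendsto hderiv ?_
  filter_upwards [hfeas, self_mem_nhdsWithin] with ε h1 h2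
  rw [slope_def_field, sub_zero]
  refine div_nonpos_of_nonpos_of_nonneg (sub_nonpos.2 ?_) (mem_Ioi.1 h2).le
  have h3 : p 0 = fun i => P i k := by funext i; simp [hp]
  rw [h3, setUser_self]
  exact hmax _ h1

variable (hL : ∀ i, 0 < S.L i)

include hL

omit hH hw in
theorem spent_transfer {s t : ℕ} (n : ℕ) (hn : n ≤ N) (c : ℝ) :
    spent (extend S.L 0) (extend (fun i : Fin N => ((if i.val = s then -c else 0) +
      (if i.val = t then c else 0)) / S.L i) 0) n =
      (if s < n then -c else 0) + (if t < n then c else 0) := by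
  have h1 : ∀ i ∈ Finset.range n, extend (fun i : Fin N => ((if i.val = s then -c else 0) +
      (if i.val = t then c else 0)) / S.L i) 0 i * extend S.L 0 i =
      (if i = s then -c else 0) + (if i = t then c else 0) := fun i hi => by
    have hi' : i < N := (Finset.mem_range.1 hi).trans_le hn
    simp only [extend, dif_pos hi']
    exact div_mul_cancel₀ _ (hL _).ne'
  rw [spent, Finset.sum_congr rfl h1, Finset.sum_add_distrib, Finset.sum_ite_eq',
    Finset.sum_ite_eq']
  simp only [Finset.mem_range]

/-- Powers of user `k` that are optimal given those of the other users are taut. -/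
theorem isTaut_of_isMax {P : Fin N → Fin K → ℝ} (hP : P ∈ S.feasible) {k : Fin K}
    (hmax : ∀ p ∈ S.userFeasible k, S.W (setUser P k p) ≤ S.W P) :
    IsTaut (S.Emax k) N (S.arrivals k) (extend S.L 0)
      (extend (fun i => S.marginal k (P i)) 0) (extend (fun i => P i k) 0) := by
  have hf := energyFeasible_iff.1 (hP.1 k)
  -- transfer of the energy `c = ± 1` from epoch `s` to epoch `t`
  have key : ∀ (s t : ℕ) (hs : s < N) (ht : t < N) (c : ℝ), s < t →
      (0 ≤ -c ∨ 0 < P ⟨s, hs⟩ k) → (0 ≤ c ∨ 0 < P ⟨t, ht⟩ k) →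
      (∀ m, s < m → m ≤ t → 0 ≤ -c ∨ mustUse (S.Emax k) (S.arrivals k) m <
        spent (extend S.L 0) (extend (fun i => P i k) 0) m) →
      (∀ m, s < m → m ≤ t → -c ≤ 0 ∨
        spent (extend S.L 0) (extend (fun i => P i k) 0) m < harvested (S.arrivals k) m) →
      c * (S.marginal k (P ⟨t, ht⟩) (P ⟨t, ht⟩ k) - S.marginal k (P ⟨s, hs⟩) (P ⟨s, hs⟩ k)) ≤ 0 := by
    intro s t hs ht c hst hps hpt hC hA
    have h1 := sum_marginal_nonpos hH hw hP hmax
      (fun i : Fin N => ((if i.val = s then -c else 0) + (if i.val = t then c else 0)) / S.L i)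
      (fun i => ?_) (fun n hn1 hn2 => ?_) (fun n hn1 hn2 => ?_)
    · have h2 : ∀ i : Fin N, S.marginal k (P i) (P i k) *
          (((if i.val = s then -c else 0) + (if i.val = t then c else 0)) / S.L i) * S.L i =
          (if i = ⟨s, hs⟩ then -c * S.marginal k (P i) (P i k) else 0) +
            (if i = ⟨t, ht⟩ then c * S.marginal k (P i) (P i k) else 0) := fun i => by
        rw [mul_assoc, div_mul_cancel₀ _ (hL i).ne']
        simp only [Fin.ext_iff]
        split_ifs <;> ring
      rw [Finset.sum_congr rfl fun i _ => h2 i, Finset.sum_add_distrib, Finset.sum_ite_eq',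
        Finset.sum_ite_eq', if_pos (Finset.mem_univ _), if_pos (Finset.mem_univ _)] at h1
      linarith
    · by_cases h2 : i.val = s
      · rw [if_pos h2, if_neg (by omega), add_zero]
        have h3 : i = ⟨s, hs⟩ := Fin.ext h2
        rw [h3]
        exact hps.imp (fun h => div_nonneg h (hL _).le) id
      · by_cases h3 : i.val = t
        · rw [if_neg h2, if_pos h3, zero_add]
          have h4 : i = ⟨t, ht⟩ := Fin.ext h3
          rw [h4]
          exact hpt.imp (fun h => div_nonneg h (hL _).le) id
        · left; rw [if_neg h2, if_neg h3]; simp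
    · rw [spent_transfer hL n hn2]
      by_cases h2 : s < n
      · by_cases h3 : t < n
        · left; rw [if_pos h2, if_pos h3]; simp
        · rw [if_pos h2, if_neg h3, add_zero]
          exact hC n h2 (by omega)
      · left; rw [if_neg h2, if_neg (by omega)]; simp
    · rw [spent_transfer hL n hn2]
      by_cases h2 : s < n
      · by_cases h3 : t < n
        · left; rw [if_pos h2, if_pos h3]; simp
        · rw [if_pos h2, if_neg h3, add_zero]
          exact hA n h2 (by omega)
      · left; rw [if_neg h2, if_neg (by omega)]; simp
  refine ⟨fun i hi => ?_, fun n h1 h2 => (hf n h1 h2).1, fun n h1 h2 => (hf n h1 h2).2,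
    fun s t hst ht h0 h => ?_, fun s t hst ht h0 h => ?_⟩
  · rw [extend, dif_pos hi]; exact hP.2 _ k
  · have hs : s < N := hst.trans ht
    simp only [extend, dif_pos hs, dif_pos ht] at h0 ⊢
    have := key s t hs ht 1 hst (Or.inr h0) (Or.inl zero_le_one)
      (fun m h1 h2 => Or.inr (h m h1 h2)) (fun m h1 h2 => Or.inl (by norm_num))
    linarith
  · have hs : s < N := hst.trans ht
    simp only [extend, dif_pos hs, dif_pos ht] at h0 ⊢
    have := key s t hs ht (-1) hst (Or.inl (by norm_num)) (Or.inr h0)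
      (fun m h1 h2 => Or.inl (by norm_num)) (fun m h1 h2 => Or.inr (h m h1 h2))
    linarith

omit hH hw hL in
theorem arrivals_last (k : Fin K) : S.arrivals k N = S.Emax k := by simp [arrivals, extend]

/-- Any optimal powers of user `k`, given those of the other users, are the ones computed by
string tautening. -/
theorem stepUser_eq_of_isMax {P : Fin N → Fin K → ℝ} (hP : P ∈ S.feasible) {k : Fin K}
    {p : Fin N → ℝ} (hp : p ∈ S.userFeasible k)
    (hmax : ∀ p' ∈ S.userFeasible k, S.W (setUser P k p') ≤ S.W (setUser P k p)) :
    S.stepUser P k = setUser P k p := by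
  have hP' := setUser_mem hP hp
  have htaut := isTaut_of_isMax hH hw hL hP' (k := k) fun p' hp' => by
    have : setUser (setUser P k p) k p' = setUser P k p' := by
      funext i; simp [setUser]
    rw [this]
    exact hmax p' hp'
  have h1 : (fun i => S.marginal k (setUser P k p i)) = fun i => S.marginal k (P i) := by
    funext i; rw [setUser, marginal_update]
  have h2 : (fun i => setUser P k p i k) = p := by funext i; simp [setUser]
  rw [h1, h2] at htaut
  have h3 := htaut.schedule_eq (extend_L_pos hL) (fun i hi => by
    rw [extend, dif_pos hi]
    exact isMarginal_marginal hH hw (nonneg_of_mem_feasible hP _) k) (arrivals_last k)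
  funext i
  rw [stepUser, setUser, h3 i i.2, extend_apply]

theorem exists_stepUser_eq {P : Fin N → Fin K → ℝ} (hP : P ∈ S.feasible) (k : Fin K) :
    ∃ p ∈ S.userFeasible k, S.stepUser P k = setUser P k p ∧
      ∀ p' ∈ S.userFeasible k, S.W (setUser P k p') ≤ S.W (S.stepUser P k) := by
  have hcont : ContinuousOn (fun p => S.W (setUser P k p)) (S.userFeasible k) :=
    (continuousOn_W hH hw).comp
      ((continuous_setUser k).comp (continuous_const.prodMk continuous_id)).continuousOn
      fun p hp => nonneg_of_mem_feasible (setUser_mem hP hp)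
  obtain ⟨p, hp, hmax⟩ := (isCompact_userFeasible hL k).exists_isMaxOn
    ⟨_, mem_feasible_iff.1 hP k⟩ hcont
  have h := stepUser_eq_of_isMax hH hw hL hP hp fun p' hp' => hmax hp'
  exact ⟨p, hp, h, fun p' hp' => h ▸ hmax hp'⟩

theorem stepUser_mem {P : Fin N → Fin K → ℝ} (hP : P ∈ S.feasible) (k : Fin K) :
    S.stepUser P k ∈ S.feasible := by
  obtain ⟨p, hp, h, -⟩ := exists_stepUser_eq hH hw hL hP k
  exact h ▸ setUser_mem hP hp

theorem W_setUser_le_stepUser {P : Fin N → Fin K → ℝ} (hP : P ∈ S.feasible) {k : Fin K}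
    {p : Fin N → ℝ} (hp : p ∈ S.userFeasible k) :
    S.W (setUser P k p) ≤ S.W (S.stepUser P k) := by
  obtain ⟨-, -, -, h⟩ := exists_stepUser_eq hH hw hL hP k
  exact h p hp

theorem W_le_stepUser {P : Fin N → Fin K → ℝ} (hP : P ∈ S.feasible) (k : Fin K) :
    S.W P ≤ S.W (S.stepUser P k) := by
  have := W_setUser_le_stepUser hH hw hL hP (mem_feasible_iff.1 hP k)
  rwa [setUser_self] at this

theorem stepUser_eq_self {P : Fin N → Fin K → ℝ} (hP : P ∈ S.feasible) {k : Fin K}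
    (h : S.W (S.stepUser P k) ≤ S.W P) : S.stepUser P k = P := by
  have := stepUser_eq_of_isMax hH hw hL hP (mem_feasible_iff.1 hP k) fun p' hp' => by
    rw [setUser_self]
    exact (W_setUser_le_stepUser hH hw hL hP hp').trans h
  rwa [setUser_self] at this

/-! ### Convergence of the block coordinate ascent -/

/-- The update of one user is continuous, because its result is the only maximizer of a continuous
function over a compact set. -/
theorem continuousOn_stepUser (k : Fin K) : ContinuousOn (fun P => S.stepUser P k) S.feasible := by
  intro P hP
  have hC := isCompact_feasible hL
  refine hC.tendsto_nhds_of_unique_mapClusterPt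
    (eventually_mem_nhdsWithin.mono fun x hx => stepUser_mem hH hw hL hx k) fun y hy hyc => ?_
  obtain ⟨U, hU, hUy⟩ := mapClusterPt_iff_ultrafilter.1 hyc
  have hUP : Tendsto (fun x => x) (U : Filter (Fin N → Fin K → ℝ)) (𝓝[S.feasible] P) := hU
  have hUP' := hUP.mono_right nhdsWithin_le_nhds
  have hmemU : ∀ᶠ x in (U : Filter (Fin N → Fin K → ℝ)), x ∈ S.feasible :=
    hU eventually_mem_nhdsWithin
  have hWc : ContinuousOn S.W S.feasible :=
    (continuousOn_W hH hw).mono fun P hP => nonneg_of_mem_feasible hP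
  have hoff : ∀ i j, j ≠ k → y i j = P i j := fun i j hj => by
    have h1 : Tendsto (fun x => S.stepUser x k i j) (U : Filter (Fin N → Fin K → ℝ)) (𝓝 (y i j)) :=
      ((continuous_apply_apply i j).tendsto y).comp hUy
    have h2 : Tendsto (fun x : Fin N → Fin K → ℝ => x i j) (U : Filter (Fin N → Fin K → ℝ))
        (𝓝 (P i j)) := ((continuous_apply_apply i j).tendsto P).comp hUP'
    have h3 : (fun x => S.stepUser x k i j) = fun x => x i j := by
      funext x; simp [stepUser, hj]
    rw [h3] at h1
    exact tendsto_nhds_unique h1 h2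
  have hy' : setUser P k (fun i => y i k) = y := setUser_eq hoff
  have hmax : ∀ p' ∈ S.userFeasible k,
      S.W (setUser P k p') ≤ S.W (setUser P k (fun i => y i k)) := fun p' hp' => by
    rw [hy']
    have h1 : Tendsto (fun x => S.W (S.stepUser x k)) (U : Filter (Fin N → Fin K → ℝ))
        (𝓝 (S.W y)) :=
      (hWc y hy).tendsto.comp (tendsto_nhdsWithin_iff.2
        ⟨hUy, hmemU.mono fun x hx => stepUser_mem hH hw hL hx k⟩)
    have h2 : Tendsto (fun x => S.W (setUser x k p')) (U : Filter (Fin N → Fin K → ℝ))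
        (𝓝 (S.W (setUser P k p'))) := by
      refine (hWc _ (setUser_mem hP hp')).tendsto.comp (tendsto_nhdsWithin_iff.2
        ⟨?_, hmemU.mono fun x hx => setUser_mem hx hp'⟩)
      have h3 : Continuous fun x : Fin N → Fin K → ℝ => setUser x k p' :=
        (continuous_setUser k).comp (continuous_id.prodMk continuous_const)
      exact (h3.tendsto P).comp hUP'
    exact le_of_tendsto_of_tendsto h2 h1
      (hmemU.mono fun x hx => W_setUser_le_stepUser hH hw hL hx hp')
  rw [← hy']
  exact (stepUser_eq_of_isMax hH hw hL hP (mem_feasible_iff.1 hy k) hmax).symm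

theorem foldl_stepUser (l : List (Fin K)) :
    MapsTo (fun P => l.foldl S.stepUser P) S.feasible S.feasible ∧
    ContinuousOn (fun P => l.foldl S.stepUser P) S.feasible ∧
    ∀ P ∈ S.feasible, S.W P ≤ S.W (l.foldl S.stepUser P) ∧
      (S.W (l.foldl S.stepUser P) = S.W P → ∀ k ∈ l, S.stepUser P k = P) := by
  induction l with
  | nil => exact ⟨fun P hP => hP, continuousOn_id, fun P _ => ⟨le_rfl, by simp⟩⟩
  | cons k l ih =>
    obtain ⟨h1, h2, h3⟩ := ih
    have h0 : MapsTo (fun P => S.stepUser P k) S.feasible S.feasible := fun P hP =>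
      stepUser_mem hH hw hL hP k
    refine ⟨fun P hP => h1 (h0 hP), h2.comp (continuousOn_stepUser hH hw hL k) h0, fun P hP => ?_⟩
    have h4 := W_le_stepUser hH hw hL hP k
    have h5 := (h3 _ (h0 hP)).1
    refine ⟨h4.trans h5, fun heq => ?_⟩
    simp only [List.foldl_cons] at heq
    have h6 : S.stepUser P k = P := stepUser_eq_self hH hw hL hP (h5.trans heq.le)
    rw [h6] at heq
    intro j hj
    rcases List.mem_cons.1 hj with rfl | hj
    · exact h6
    · exact (h3 P hP).2 heq j hj

/-- An allocation that no user can improve alone is globally optimal. -/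
theorem mem_optimal_of_stepUser_eq {P : Fin N → Fin K → ℝ} (hP : P ∈ S.feasible)
    (h : ∀ k, S.stepUser P k = P) : P ∈ S.optimal := by
  refine ⟨hP, fun P' hP' => ?_⟩
  have hPn := nonneg_of_mem_feasible hP
  have hPn' := nonneg_of_mem_feasible hP'
  have hblock : ∀ k, ∑ i, S.marginal k (P i) (P i k) * (P' i k - P i k) * S.L i ≤ 0 := fun k => by
    have hf' := energyFeasible_iff.1 (hP'.1 k)
    have hsub : ∀ n, n ≤ N → spent (extend S.L 0) (extend (fun i => P' i k - P i k) 0) n =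
        spent (extend S.L 0) (extend (fun i => P' i k) 0) n -
          spent (extend S.L 0) (extend (fun i => P i k) 0) n := fun n hn => by
      simp only [spent, ← Finset.sum_sub_distrib]
      refine Finset.sum_congr rfl fun i hi => ?_
      have hi' : i < N := (Finset.mem_range.1 hi).trans_le hn
      simp only [extend, dif_pos hi']
      ring
    refine sum_marginal_nonpos hH hw hP (fun p hp => ?_) _ (fun i => ?_)
      (fun n hn1 hn2 => ?_) (fun n hn1 hn2 => ?_)
    · have := W_setUser_le_stepUser hH hw hL hP hp
      rwa [h k] at this
    · rcases le_or_gt (P i k) (P' i k) with h1 | h1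
      · exact Or.inl (sub_nonneg.2 h1)
      · exact Or.inr ((hPn' i k).trans_lt h1)
    · rw [hsub n hn2, sub_nonneg]
      refine (le_or_gt _ _).imp id fun h1 => (hf' n hn1 hn2).1.trans_lt h1
    · rw [hsub n hn2, sub_nonpos]
      refine (le_or_gt _ _).imp id fun h1 => h1.trans_le (hf' n hn1 hn2).2
  show S.W P' ≤ S.W P
  have h1 : S.W P' ≤ ∑ i, (S.R (P i) + ∑ k, S.marginal k (P i) (P i k) * (P' i k - P i k)) * S.L i :=
    Finset.sum_le_sum fun i _ => mul_le_mul_of_nonneg_right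
      ((marginal_supergradient hH hw (hPn i)).2 _ (hPn' i)) (hL i).le
  have h2 : ∑ i, (S.R (P i) + ∑ k, S.marginal k (P i) (P i k) * (P' i k - P i k)) * S.L i =
      S.W P + ∑ k, ∑ i, S.marginal k (P i) (P i k) * (P' i k - P i k) * S.L i := by
    simp only [add_mul, Finset.sum_add_distrib, Finset.sum_mul]
    rw [Finset.sum_comm]
    rfl
  rw [h2] at h1
  exact h1.trans (add_le_of_nonpos_right (Finset.sum_nonpos fun k _ => hblock k))

/-- A feasible allocation without throughput transmits nothing, so nothing is ever harvested and
it is the only feasible one. -/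
theorem mem_optimal_of_W_eq_zero {P : Fin N → Fin K → ℝ} (hP : P ∈ S.feasible)
    (h : S.W P = 0) : P ∈ S.optimal := by
  have hPn := nonneg_of_mem_feasible hP
  have h0 : ∀ i k, P i k = 0 := fun i k => by
    have h1 := (Finset.sum_eq_zero_iff_of_nonneg fun i _ =>
      mul_nonneg (R_nonneg hH hw (hPn i)) (hL i).le).1 h i (Finset.mem_univ i)
    by_contra h2
    exact (mul_pos (R_pos hH hw (hPn i) ((hPn i k).lt_of_ne' h2)) (hL i)).ne' h1
  refine ⟨hP, fun P' hP' => ?_⟩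
  have hPP' : P' = P := by
    funext i k
    rw [h0 i k]
    have hN : 1 ≤ N := by have := i.2; omega
    have h1 := (hP'.1 k N hN le_rfl).1
    have h2 := (hP.1 k N hN le_rfl).2
    have h3 : harvested (S.arrivals k) N ≤ mustUse (S.Emax k) (S.arrivals k) N := by
      refine le_trans (le_of_eq ?_) (le_max_left _ _)
      rw [harvested, harvested, Finset.sum_range_succ, arrivals_last, add_sub_cancel_right]
    have h4 : ∑ i : Fin N with i.val < N, P i k * S.L i = 0 :=
      Finset.sum_eq_zero fun i _ => by rw [h0 i k, zero_mul]
    have h5 : P' i k * S.L i ≤ ∑ i : Fin N with i.val < N, P' i k * S.L i :=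
      Finset.single_le_sum (f := fun i => P' i k * S.L i)
        (fun j _ => mul_nonneg (hP'.2 j k) (hL j).le) (Finset.mem_filter.2 ⟨Finset.mem_univ i, i.2⟩)
    exact le_antisymm (nonpos_of_mul_nonpos_left (by linarith) (hL i)) (hP'.2 i k)
  exact (congrArg S.W hPP').le

theorem W_nonneg {P : Fin N → Fin K → ℝ} (hP : P ∈ S.feasible) : 0 ≤ S.W P :=
  Finset.sum_nonneg fun i _ =>
    mul_nonneg (R_nonneg hH hw (nonneg_of_mem_feasible hP i)) (hL i).le

theorem optimal_nonempty (hE : ∀ i k, 0 ≤ S.E i k ∧ S.E i k ≤ S.Emax k) : S.optimal.Nonempty := by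
  obtain ⟨P, hP, hmax⟩ := (isCompact_feasible hL).exists_isMaxOn (feasible_nonempty hL hE)
    ((continuousOn_W hH hw).mono fun P hP => nonneg_of_mem_feasible hP)
  exact ⟨P, hP, hmax⟩

/-- The iterates converge, by the general principle for ascent methods. -/
theorem iter_converges {P0 : Fin N → Fin K → ℝ} (hP0 : P0 ∈ S.feasible) :
    (∀ q, S.iter P0 q ∈ S.feasible) ∧ (Monotone fun q => S.W (S.iter P0 q)) ∧
    (∀ z ∈ S.optimal, Tendsto (fun q => S.W (S.iter P0 q)) atTop (𝓝 (S.W z))) ∧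
    Tendsto (fun q => Metric.infDist (S.iter P0 q) S.optimal) atTop (𝓝 0) ∧
    (∀ z, MapClusterPt z atTop (S.iter P0) → z ∈ S.optimal) ∧
    (∀ z, S.optimal = {z} → Tendsto (S.iter P0) atTop (𝓝 z)) := by
  obtain ⟨h1, h2, h3⟩ := foldl_stepUser hH hw hL (List.finRange K)
  exact ascent_converges (isCompact_feasible hL) h1 h2
    ((continuousOn_W hH hw).mono fun P hP => nonneg_of_mem_feasible hP) (fun P hP => (h3 P hP).1)
    rfl (fun P hP heq => mem_optimal_of_stepUser_eq hH hw hL hP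
      fun k => (h3 P hP).2 heq k (List.mem_finRange k)) hP0

theorem iter_succ_mem_optimal {P0 : Fin N → Fin K → ℝ} (hP0 : P0 ∈ S.feasible) {q : ℕ}
    (h : S.iter P0 q ∈ S.optimal) : S.iter P0 (q + 1) ∈ S.optimal := by
  obtain ⟨h1, h2, -⟩ := iter_converges hH hw hL hP0
  exact ⟨h1 _, fun P hP => (h.2 hP).trans (h2 (Nat.le_succ q))⟩

theorem mem_optimal_of_W_iter_le {P0 : Fin N → Fin K → ℝ} (hP0 : P0 ∈ S.feasible) {q : ℕ}
    (h : S.W (S.iter P0 (q + 1)) ≤ S.W (S.iter P0 q)) : S.iter P0 q ∈ S.optimal := by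
  obtain ⟨h1, h2, -⟩ := iter_converges hH hw hL hP0
  have h3 := (foldl_stepUser hH hw hL (List.finRange K)).2.2 _ (h1 q)
  have h4 : S.iter P0 (q + 1) = (List.finRange K).foldl S.stepUser (S.iter P0 q) :=
    Function.iterate_succ_apply' _ _ _
  rw [h4] at h
  exact mem_optimal_of_stepUser_eq hH hw hL (h1 q)
    fun k => h3.2 (le_antisymm h h3.1) k (List.mem_finRange k)

theorem exists_stops {P0 : Fin N → Fin K → ℝ} (hP0 : P0 ∈ S.feasible) {z : Fin N → Fin K → ℝ}
    (hz : z ∈ S.optimal) {ε : ℝ} (hε : 0 < ε) : ∃ q, S.Stops P0 ε q := by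
  obtain ⟨h1, h2, h3, -⟩ := iter_converges hH hw hL hP0
  have hlim := h3 z hz
  rcases (W_nonneg hH hw hL hz.1).eq_or_lt with h0 | h0
  · have h4 : S.W (S.iter P0 0) = 0 :=
      le_antisymm ((hz.2 (h1 0)).trans h0.ge) (W_nonneg hH hw hL (h1 0))
    exact ⟨1, le_rfl, by rw [h4, div_zero]; exact hε.le⟩
  · have h4 : Tendsto (fun q => (S.W (S.iter P0 (q + 1)) - S.W (S.iter P0 q)) / S.W (S.iter P0 q))
        atTop (𝓝 ((S.W z - S.W z) / S.W z)) :=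
      ((hlim.comp (tendsto_add_atTop_nat 1)).sub hlim).div hlim h0.ne'
    rw [sub_self, zero_div] at h4
    obtain ⟨q, hq⟩ := (h4.eventually (gt_mem_nhds hε)).exists
    exact ⟨q + 1, by omega, by simpa using hq.le⟩

/-- For small tolerances the method stops late, unless it stops at an optimal allocation. -/
theorem eventually_output {P0 : Fin N → Fin K → ℝ} (hP0 : P0 ∈ S.feasible)
    {z : Fin N → Fin K → ℝ} (hz : z ∈ S.optimal) (q₀ : ℕ) :
    ∀ᶠ ε in 𝓝[>] (0 : ℝ), (∃ q, q₀ ≤ q ∧ S.output P0 ε = S.iter P0 q) ∨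
      S.output P0 ε ∈ S.optimal := by
  have h1 : ∀ᶠ ε in 𝓝[>] (0 : ℝ), ∀ q ∈ Finset.range q₀, S.Stops P0 ε q →
      S.iter P0 q ∈ S.optimal := by
    refine (eventually_all_finset _).2 fun q _ => ?_
    rcases q with _ | q
    · exact Eventually.of_forall fun ε h => absurd h.1 (by omega)
    by_cases hopt : S.iter P0 q ∈ S.optimal
    · exact Eventually.of_forall fun ε _ => iter_succ_mem_optimal hH hw hL hP0 hopt
    · have hpos : 0 < S.W (S.iter P0 q) :=
        (W_nonneg hH hw hL ((iter_converges hH hw hL hP0).1 q)).lt_of_ne' fun h =>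
          hopt (mem_optimal_of_W_eq_zero hH hw hL ((iter_converges hH hw hL hP0).1 q) h)
      have hlt : S.W (S.iter P0 q) < S.W (S.iter P0 (q + 1)) :=
        not_le.1 fun h => hopt (mem_optimal_of_W_iter_le hH hw hL hP0 h)
      have hρ : 0 < (S.W (S.iter P0 (q + 1)) - S.W (S.iter P0 q)) / S.W (S.iter P0 q) :=
        div_pos (sub_pos.2 hlt) hpos
      filter_upwards [nhdsWithin_le_nhds (gt_mem_nhds hρ)] with ε hε h
      exact absurd h.2 (not_le.2 (by simpa using hε))
  filter_upwards [h1, self_mem_nhdsWithin] with ε h2 hε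
  have h3 : S.Stops P0 ε (sInf {q | S.Stops P0 ε q}) :=
    Nat.sInf_mem (s := {q | S.Stops P0 ε q}) (exists_stops hH hw hL hP0 hz hε)
  rcases le_or_gt q₀ (sInf {q | S.Stops P0 ε q}) with h4 | h4
  · exact Or.inl ⟨_, h4, rfl⟩
  · exact Or.inr (h2 _ (Finset.mem_range.2 h4) h3)

theorem tendsto_output {P0 : Fin N → Fin K → ℝ} (hP0 : P0 ∈ S.feasible)
    {z : Fin N → Fin K → ℝ} (hz : z ∈ S.optimal) {h : (Fin N → Fin K → ℝ) → ℝ} {b : ℝ}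
    (hlim : Tendsto (fun q => h (S.iter P0 q)) atTop (𝓝 b)) (hopt : ∀ z ∈ S.optimal, h z = b) :
    Tendsto (fun ε => h (S.output P0 ε)) (𝓝[>] 0) (𝓝 b) := by
  intro s hs
  obtain ⟨q₀, hq₀⟩ := eventually_atTop.1 (hlim hs)
  show ∀ᶠ ε in 𝓝[>] (0 : ℝ), h (S.output P0 ε) ∈ s
  filter_upwards [eventually_output hH hw hL hP0 hz q₀] with ε hε
  rcases hε with ⟨q, hq, h1⟩ | h1
  · rw [h1]; exact hq₀ q hq
  · rw [hopt _ h1]; exact mem_of_mem_nhds hs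

/-! ### Optimal policies -/

omit hH hw hL in
theorem throughput_eq (r : Fin N → Fin K → ℝ) :
    S.throughput r = ∑ i, (∑ k, S.w k * r i k) * S.L i := by
  simp only [throughput, Finset.mul_sum, Finset.sum_mul]
  rw [Finset.sum_comm]
  exact Finset.sum_congr rfl fun i _ => Finset.sum_congr rfl fun k _ => by ring

/-- Optimal powers bound the weighted sum-throughput of every policy. -/
theorem throughput_le {z : Fin N → Fin K → ℝ} (hz : z ∈ S.optimal)
    {x : (Fin N → Cov K Nt) × (Fin N → Fin K → ℝ)} (hx : x ∈ S.policies) :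
    S.throughput x.2 ≤ S.W z := by
  obtain ⟨π, hπ⟩ := exists_antitone_perm S.w
  obtain ⟨h1, h2, h3⟩ := hx
  have h0 : ∀ i k, 0 ≤ (x.1 i k).trace.re := fun i k =>
    (Complex.nonneg_iff.1 (h1 i k).trace_nonneg).1
  have hmem : (fun i k => (x.1 i k).trace.re) ∈ S.feasible := ⟨h2, h0⟩
  refine le_trans ?_ (hz.2 hmem)
  rw [throughput_eq]
  exact Finset.sum_le_sum fun i _ => mul_le_mul_of_nonneg_right
    (weighted_sum_le_R hH hw hπ (fun k => h0 i k) (h3 i)) (hL i).le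

/-- Optimal covariances at optimal powers, with the corner rates, are an optimal policy. -/
theorem exists_optimal_rates {π : Equiv.Perm (Fin K)} (hπ : Antitone fun k => S.w (π k))
    {z : Fin N → Fin K → ℝ} (hz : z ∈ S.optimal) {Q : Fin N → Cov K Nt}
    (hQ : ∀ i, S.SolvesCov π (z i) (Q i)) :
    ∃ r : Fin N → Fin K → ℝ, (∀ i, r i ∈ S.rateRegion (Q i) ∧ ∀ k, 0 ≤ r i k) ∧
      (Q, r) ∈ S.policies ∧ IsMaxOn (fun x => S.throughput x.2) S.policies (Q, r) ∧
      S.throughput r = S.W z := by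
  have hpsd : ∀ i, Q i ∈ psd K Nt := fun i => covFeasible_subset_psd _ (hQ i).1
  have htr : ∀ i k, (Q i k).trace.re = z i k := fun i k => by
    rw [((hQ i).1 k).2, Complex.ofReal_re]
  have hval : S.throughput (fun i => S.corner π (Q i)) = S.W z := by
    rw [throughput_eq]
    exact Finset.sum_congr rfl fun i _ => by
      rw [weighted_sum_corner, (hQ i).R_eq hH hw hπ]
  refine ⟨fun i => S.corner π (Q i), fun i => ⟨corner_mem_rateRegion π (hpsd i),
    corner_nonneg π (hpsd i)⟩, ⟨hpsd, fun k => ?_, fun i =>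
      ⟨Q i, fun k => ⟨hpsd i k, le_rfl⟩, corner_mem_rateRegion π (hpsd i)⟩⟩, fun x hx => ?_, hval⟩
  · simp only [htr]
    exact hz.1.1 k
  · show S.throughput x.2 ≤ S.throughput (fun i => S.corner π (Q i))
    rw [hval]
    exact throughput_le hH hw hL hz hx

end

end System

end EHMAC

theorem theorem1 {K N Nt Nr : ℕ} (S : EHMAC.System K N Nt Nr)
    (hH : ∀ k, S.H k ≠ 0) (hw : ∀ k, 0 < S.w k) (hL : ∀ i, 0 < S.L i)
    (hE : ∀ i k, 0 ≤ S.E i k ∧ S.E i k ≤ S.Emax k) :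
    -- the power allocation problem has a globally optimal solution
    (S.optimal.Nonempty) ∧
    -- re-optimization of one user by string tautening, the other users being fixed
    (∀ P ∈ S.feasible, ∀ k, S.stepUser P k ∈ S.feasible ∧
      ∀ P' ∈ S.feasible, (∀ i j, j ≠ k → P' i j = P i j) → S.W P' ≤ S.W (S.stepUser P k)) ∧
    -- convergence of the block coordinate ascent from any feasible starting point
    (∀ P0 ∈ S.feasible,
      (∀ q, S.iter P0 q ∈ S.feasible) ∧
      (∀ Pstar ∈ S.optimal,
        Tendsto (fun q => S.W (S.iter P0 q)) atTop (𝓝 (S.W Pstar))) ∧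
      Tendsto (fun q => Metric.infDist (S.iter P0 q) S.optimal) atTop (𝓝 0) ∧
      (∀ P, MapClusterPt P atTop (S.iter P0) → P ∈ S.optimal) ∧
      (∀ Pstar, S.optimal = {Pstar} → Tendsto (S.iter P0) atTop (𝓝 Pstar)) ∧
      -- termination for each tolerance, and the returned allocation as the tolerance vanishes
      (∀ ε > 0, ∃ q, S.Stops P0 ε q) ∧
      (∀ Pstar ∈ S.optimal,
        Tendsto (fun ε => S.W (S.output P0 ε)) (𝓝[>] 0) (𝓝 (S.W Pstar))) ∧
      Tendsto (fun ε => Metric.infDist (S.output P0 ε) S.optimal) (𝓝[>] 0) (𝓝 0)) ∧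
    -- optimal covariances from optimal powers
    (∀ π : Equiv.Perm (Fin K), Antitone (fun k => S.w (π k)) → ∀ Pstar ∈ S.optimal,
      (∃ Q : Fin N → EHMAC.Cov K Nt, ∀ i, S.SolvesCov π (Pstar i) (Q i)) ∧
      ∀ Q : Fin N → EHMAC.Cov K Nt, (∀ i, S.SolvesCov π (Pstar i) (Q i)) →
        ∃ r : Fin N → Fin K → ℝ,
          (∀ i, r i ∈ S.rateRegion (Q i) ∧ ∀ k, 0 ≤ r i k) ∧
          (Q, r) ∈ S.policies ∧
          IsMaxOn (fun x => S.throughput x.2) S.policies (Q, r) ∧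
          S.throughput r = S.W Pstar) := by
  obtain ⟨z, hz⟩ := EHMAC.System.optimal_nonempty hH hw hL hE
  refine ⟨⟨z, hz⟩, fun P hP k => ⟨EHMAC.System.stepUser_mem hH hw hL hP k, fun P' hP' h => ?_⟩,
    fun P0 hP0 => ?_, fun π hπ Pstar hPstar => ⟨?_, fun Q hQ =>
      EHMAC.System.exists_optimal_rates hH hw hL hπ hPstar hQ⟩⟩
  · have := EHMAC.System.W_setUser_le_stepUser hH hw hL hP
      (EHMAC.System.mem_feasible_iff.1 hP' k)
    rwa [EHMAC.System.setUser_eq h] at this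
  · obtain ⟨h1, -, h3, h4, h5, h6⟩ := EHMAC.System.iter_converges hH hw hL hP0
    exact ⟨h1, h3, h4, h5, h6, fun ε hε => EHMAC.System.exists_stops hH hw hL hP0 hz hε,
      fun y hy => EHMAC.System.tendsto_output hH hw hL hP0 hz (h3 y hy) fun x hx =>
        le_antisymm (hy.2 hx.1) (hx.2 hy.1),
      EHMAC.System.tendsto_output hH hw hL hP0 hz h4 fun x hx => Metric.infDist_zero_of_mem hx⟩
  · choose Q hQ using fun i => EHMAC.System.exists_solvesCov hH π
      (EHMAC.System.nonneg_of_mem_feasible hPstar.1 i)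
    exact ⟨Q, hQ⟩
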